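/- Consider randomized programs for a word-RAM with $O(1)$ private registers of $b$ bits each, whose memory is spread over $3$ disks and in which a fresh uniformly random $b$-bit word can be drawn in unit time. Work is the number of elementary steps (in particular it bounds the number of memory accesses). The number of discontiguous memory regions accessed by a run is the total, over all disks, of the number of accesses that do not go to the address following the one accessed just before on the same disk (the first access to a disk opens a region). The access pattern is the sequence of all disk accesses (read or write, disk, address). For integers $2\le Z\le n$ put $$\epsilon(n,Z)=\frac{2n}{Z}\cdot\log_2\!\Big(\frac{2n}{Z}\Big)\cdot e^{-Z/6},$$ which is $e^{-Z/6}$ up to the factor given by the numbers of buckets and layers. There are a single program $M$ and a constant $C$ such that for all integers $2\le Z\le n$ and all word lengths $b$ with $2^b\ge C n$, when $M$ is given $n$, $Z$ and an array $x$ of $n$ words of $b$ bits: 1. (Statistical obliviousness.) There is a distribution $\mathsf{Sim}$ on access patterns, depending only on $n,Z,b$, such that for every input $x$ the pair $(\mathsf{Sim},\ \text{sorted }x)$ and the pair (access pattern of $M(x)$, output of $M(x)$) are within statistical distance $\epsilon(n,Z)$. 2. (Work and locality.) For every input $x$, except with probability at most $\epsilon(n,Z)$, $M$ halts with the array $x$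 sorted in nondecreasing order as its output, after at most $C\, n\log_2 n\,\log_2^2 Z$ work, having accessed in total at most $C\,\log_2 n\,\log_2^2 Z$ discontiguous memory regions on its $3$ disks; that is, it has $(3, O(\log n\log^2 Z))$ locality. -/

import Mathlib

open MeasureTheory

/-! A randomized word-RAM whose memory is spread over `p` disks.

A program is fixed once and for all (it depends neither on the input size nor on the word length),
so it mentions only finitely many registers: the client storage is `O(1)` words of `b` bits.
Registers and coins are private; every disk access (kind, disk, address) is visible. -/

namespace DiskRAM

/-- Unit-cost operations on words. -/
inductive Op where
  | add | sub | mul | div | mod | lt | eq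

/-- Arithmetic modulo `2 ^ b` on `b`-bit words; division and comparison of unsigned words. -/
def Op.eval (b : ℕ) : Op → ℕ → ℕ → ℕ
  | .add, x, y => (x + y) % 2 ^ b
  | .sub, x, y => (x + (2 ^ b - y)) % 2 ^ b
  | .mul, x, y => (x * y) % 2 ^ b
  | .div, x, y => x / y
  | .mod, x, y => x % y
  | .lt, x, y => if x < y then 1 % 2 ^ b else 0
  | .eq, x, y => if x = y then 1 % 2 ^ b else 0

/-- Expressions over the registers. -/
inductive Expr where
  | const (k : ℕ)
  | reg (i : ℕ)
  | bin (op : Op) (e₁ e₂ : Expr)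

def Expr.eval (b : ℕ) (r : ℕ → ℕ) : Expr → ℕ
  | .const k => k % 2 ^ b
  | .reg i => r i
  | .bin op e₁ e₂ => op.eval b (e₁.eval b r) (e₂.eval b r)

/-- The number of elementary steps needed to evaluate an expression. -/
def Expr.cost : Expr → ℕ
  | .const _ => 1
  | .reg _ => 1
  | .bin _ e₁ e₂ => 1 + e₁.cost + e₂.cost

/-- Programs of a random-access machine with `p` disks. -/
inductive Prog (p : ℕ) where
  /-- do nothing -/
  | skip
  /-- register `i` := value of `e` -/
  | assign (i : ℕ) (e : Expr)
  /-- register `i` := a fresh uniformly random word -/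
  | rand (i : ℕ)
  /-- register `i` := word of disk `d` at address `a` -/
  | read (i : ℕ) (d : Fin p) (a : Expr)
  /-- word of disk `d` at address `a` := value of `e` -/
  | write (d : Fin p) (a e : Expr)
  | seq (P Q : Prog p)
  /-- run `P` if the value of `e` is nonzero, otherwise `Q` -/
  | ite (e : Expr) (P Q : Prog p)
  /-- run `P` as long as the value of `e` is nonzero -/
  | loop (e : Expr) (P : Prog p)

/-- One memory access, as seen by the adversary. -/
structure Access (p : ℕ) where
  isWrite : Bool
  disk : Fin p
  addr : ℕ

/-- Configuration: registers, disks, number of random words consumed so far, number of elementary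
steps made so far, and all memory accesses made so far in chronological order. -/
structure State (p : ℕ) where
  reg : ℕ → ℕ
  disk : Fin p → ℕ → ℕ
  coins : ℕ
  time : ℕ
  trace : List (Access p)

/-- `Exec b ω P s s'`: with word length `b` and random tape `ω`, the program `P` started in
configuration `s` halts in configuration `s'`. -/
inductive Exec {p : ℕ} (b : ℕ) (ω : ℕ → Fin (2 ^ b)) : Prog p → State p → State p → Prop
  | skip (s : State p) : Exec b ω .skip s s
  | assign (i : ℕ) (e : Expr) (s : State p) :
      Exec b ω (.assign i e) s
        { s with
          reg := Function.update s.reg i (e.eval b s.reg)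
          time := s.time + 1 + e.cost }
  | rand (i : ℕ) (s : State p) :
      Exec b ω (.rand i) s
        { s with
          reg := Function.update s.reg i (ω s.coins : ℕ)
          coins := s.coins + 1
          time := s.time + 1 }
  | read (i : ℕ) (d : Fin p) (a : Expr) (s : State p) :
      Exec b ω (.read i d a) s
        { s with
          reg := Function.update s.reg i (s.disk d (a.eval b s.reg))
          time := s.time + 1 + a.cost
          trace := s.trace ++ [⟨false, d, a.eval b s.reg⟩] }
  | write (d : Fin p) (a e : Expr) (s : State p) :
      Exec b ω (.write d a e) s
        { s with
          disk := Function.update s.disk d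
            (Function.update (s.disk d) (a.eval b s.reg) (e.eval b s.reg))
          time := s.time + 1 + a.cost + e.cost
          trace := s.trace ++ [⟨true, d, a.eval b s.reg⟩] }
  | seq {P Q : Prog p} {s s' s'' : State p} :
      Exec b ω P s s' → Exec b ω Q s' s'' → Exec b ω (.seq P Q) s s''
  | iteTrue {e : Expr} {P Q : Prog p} {s s' : State p} :
      e.eval b s.reg ≠ 0 → Exec b ω P { s with time := s.time + 1 + e.cost } s' →
      Exec b ω (.ite e P Q) s s'
  | iteFalse {e : Expr} {P Q : Prog p} {s s' : State p} :
      e.eval b s.reg = 0 → Exec b ω Q { s with time := s.time + 1 + e.cost } s' →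
      Exec b ω (.ite e P Q) s s'
  | loopTrue {e : Expr} {P : Prog p} {s s' s'' : State p} :
      e.eval b s.reg ≠ 0 → Exec b ω P { s with time := s.time + 1 + e.cost } s' →
      Exec b ω (.loop e P) s' s'' → Exec b ω (.loop e P) s s''
  | loopFalse {e : Expr} {P : Prog p} {s : State p} :
      e.eval b s.reg = 0 → Exec b ω (.loop e P) s { s with time := s.time + 1 + e.cost }

/-- For a fixed random tape the machine is deterministic. -/
theorem Exec.det {p b : ℕ} {ω : ℕ → Fin (2 ^ b)} {P : Prog p} {s t u : State p}
    (h₁ : Exec b ω P s t) (h₂ : Exec b ω P s u) : t = u := by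
  induction h₁ generalizing u with
  | skip s => cases h₂; rfl
  | assign i e s => cases h₂; rfl
  | rand i s => cases h₂; rfl
  | read i d a s => cases h₂; rfl
  | write d a e s => cases h₂; rfl
  | seq _ _ ih₁ ih₂ =>
    cases h₂ with
    | seq k₁ k₂ => exact ih₂ ((ih₁ k₁) ▸ k₂)
  | iteTrue h _ ih =>
    cases h₂ with
    | iteTrue _ k => exact ih k
    | iteFalse h' _ => exact absurd h' h
  | iteFalse h _ ih =>
    cases h₂ with
    | iteTrue h' _ => exact absurd h h'
    | iteFalse _ k => exact ih k
  | loopTrue h _ _ ih₁ ih₂ =>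
    cases h₂ with
    | loopTrue _ k₁ k₂ => exact ih₂ ((ih₁ k₁) ▸ k₂)
    | loopFalse h' => exact absurd h' h
  | loopFalse h =>
    cases h₂ with
    | loopTrue h' _ _ => exact absurd h h'
    | loopFalse _ => rfl

/-- The random tape: independent uniformly random `b`-bit words. -/
noncomputable def tape (b : ℕ) : Measure (ℕ → Fin (2 ^ b)) :=
  Measure.infinitePi fun _ => (PMF.uniformOfFintype (Fin (2 ^ b))).toMeasure

/-- Given the address most recently accessed on a disk (if any) and the sequence of the following
addresses, the number of accesses that do not go to the successor of the preceding address. -/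
def newRegions : Option ℕ → List ℕ → ℕ
  | _, [] => 0
  | prev, a :: l => (if prev.map (· + 1) = some a then 0 else 1) + newRegions (some a) l

/-- The total number, over all disks, of discontiguous memory regions accessed: on each disk a new
region starts at the first access and at each access that is not to the successor of the address
accessed just before on this disk. -/
def numRegions {p : ℕ} (t : List (Access p)) : ℕ :=
  ∑ d : Fin p, newRegions none ((t.filter (fun a => a.disk = d)).map Access.addr)

/-- The initial configuration: `n` in register `0`, `Z` in register `1`, the input array in the
first `n` words of disk `0`, and zeros elsewhere. -/
def init {p b : ℕ} [NeZero p] (n Z : ℕ) (x : Fin n → Fin (2 ^ b)) : State p where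
  reg := fun i => if i = 0 then n else if i = 1 then Z else 0
  disk := fun d i => if h : d = 0 ∧ i < n then (x ⟨i, h.2⟩ : ℕ) else 0
  coins := 0
  time := 0
  trace := []

/-- The output array: the first `n` words of disk `0`. -/
def State.output {p : ℕ} [NeZero p] (n : ℕ) (s : State p) : List ℕ :=
  List.ofFn fun i : Fin n => s.disk 0 i

/-- The sorting functionality: the input array rearranged in nondecreasing order. -/
def sorted {b n : ℕ} (x : Fin n → Fin (2 ^ b)) : List ℕ :=
  (List.ofFn fun i => (x i : ℕ)).insertionSort (· ≤ ·)

open Classical in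
/-- The joint outcome (access pattern, output) of running `P` on `x` with parameter `Z` and random
tape `ω`; it is `none` if the run does not halt. -/
noncomputable def outcome {p : ℕ} [NeZero p] (P : Prog p) {b n : ℕ} (Z : ℕ)
    (x : Fin n → Fin (2 ^ b)) (ω : ℕ → Fin (2 ^ b)) : Option (List (Access p) × List ℕ) :=
  if h : ∃ s, Exec b ω P (init n Z x) s then some (h.choose.trace, h.choose.output n) else none

/-- Description of `outcome` for halting runs. -/
theorem outcome_of_exec {p : ℕ} [NeZero p] {P : Prog p} {b n Z : ℕ} {x : Fin n → Fin (2 ^ b)}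
    {ω : ℕ → Fin (2 ^ b)} {s : State p} (hs : Exec b ω P (init n Z x) s) :
    outcome P Z x ω = some (s.trace, s.output n) := by
  have h : ∃ s, Exec b ω P (init n Z x) s := ⟨s, hs⟩
  have e : h.choose = s := h.choose_spec.det hs
  rw [outcome, dif_pos h, e]

/-- `P`, run with parameter `Z` and word length `b`, obliviously sorts arrays of `n` words with
`ε`-obliviousness: a simulator that knows only `n`, `Z` and `b` produces access patterns such that
for every input `x` the pair (simulated access pattern, sorted `x`) is within statistical distance
`ε` of the pair (real access pattern, real output). -/
def ObliviouslySorts {p : ℕ} [NeZero p] (P : Prog p) (n Z b : ℕ) (ε : ℝ) : Prop :=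
  ∃ Sim : PMF (List (Access p)), ∀ (x : Fin n → Fin (2 ^ b))
    (A : Set (Option (List (Access p) × List ℕ))),
    |((Sim.map fun t => some (t, sorted x)).toOuterMeasure A).toReal
      - (tape b).real {ω | outcome P Z x ω ∈ A}| ≤ ε

/-- On random tape `ω` the program `P` halts with the sorted array as its output, after at most `W`
elementary steps and having accessed at most `l` discontiguous regions on its `p` disks. -/
def CompletesWithin {p : ℕ} [NeZero p] (P : Prog p) {b n : ℕ} (Z : ℕ)
    (x : Fin n → Fin (2 ^ b)) (W l : ℝ) (ω : ℕ → Fin (2 ^ b)) : Prop :=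
  ∃ s, Exec b ω P (init n Z x) s ∧ s.output n = sorted x ∧
    (s.time : ℝ) ≤ W ∧ (numRegions s.trace : ℝ) ≤ l

/-- The error probability, `e^{-Z/6}` up to the factor coming from the number of buckets
and of layers. -/
noncomputable def errorProb (n Z : ℕ) : ℝ :=
  2 * n / Z * Real.logb 2 (2 * n / Z) * Real.exp (-(Z : ℝ) / 6)

end DiskRAM

/-! The program is a bucket sort on a butterfly network. Every input word gets an independent
uniform label, and dummies are interleaved with the words so that `2 ^ m` buckets of `2 ^ (w + 1)`
places arise, each at most half full; `2 ^ w` is the least power of two that is at least `Z`, and `2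
^ (w + m)` the least that is at least `n`. A routing level brings together the buckets whose indices
differ in the top bit and sorts each such pair by the next bit of the label, dummies staying in the
middle. If no bucket overflows, after `m` levels every record lies in the bucket named by its label.
Each bucket is then sorted by value, ties being broken by index, and the buckets are merged
pairwise. Dummies are smallest, so the output is the last `n` records.

Locality. Every pass is streamed: on each disk it accesses consecutive addresses, so it opens at
most three regions. This includes the rounds of the bitonic sorter, written in perfect-shuffle form:
chunks of disk `0` are dealt alternately to disks `1` and `2` and read back in parallel, compared
and interleaved. Sorting all pairs of buckets takes `O(w ^ 2)` passes, and there are `m` levels;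
merging costs two further passes per level.

Correctness is unconditional. All phases only rearrange records, and merging sorted runs sorts
whatever they contain. Hence time, locality and output hold on every random tape
(`exec_bucketSort`), and the error is spent on obliviousness alone.

Obliviousness. The machine is followed on arrays of ranks: `0` for a dummy, otherwise the position
of the record in the sorted input. All accesses before the merges are fixed by the parameters. The
merges reveal comparisons, that is, the array of ranks in the sorted buckets. Without overflow this
array is determined by the labels as a function of rank (`IsBucketed.eq_bucketed`). That function is
the random tape composed with a permutation depending on the input, so it is uniform for every
input. The simulator draws uniform labels for the ranks and prints the resulting trace; it agrees
with the machine outside the overflow event (`obliviouslySorts_bucketSort`).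

Overflow. It depends only on the tape, since records start at places determined by their indices. A
bucket after `k` levels can receive records from `2 ^ k` initial buckets with at most `2 ^ w` real
records each, every one arriving with probability `2 ^ (-k)`. Hence the expectation of `2 ^ load` is
at most `exp (2 ^ w)`, and Markov's inequality at the bucket size gives at most `exp (-Z / 6)`. A
union bound over `m * 2 ^ m` buckets gives the error term. -/

namespace DiskRAM

/-- Registers, disks and coin counter of a configuration. -/
structure Mem (p : ℕ) where
  reg : ℕ → ℕ
  disk : Fin p → ℕ → ℕ
  coins : ℕ

def Mem.toState {p : ℕ} (m : Mem p) (time : ℕ) (trace : List (Access p)) : State p :=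
  ⟨m.reg, m.disk, m.coins, time, trace⟩

/-- From memory `m` the program `P` halts within `T` steps, performing exactly the accesses `τ`,
in a memory satisfying `Q`. -/
def Runs {p : ℕ} (b : ℕ) (ω : ℕ → Fin (2 ^ b)) (P : Prog p) (m : Mem p) (T : ℕ)
    (τ : List (Access p)) (Q : Mem p → Prop) : Prop :=
  ∀ time trace, ∃ m' time', Exec b ω P (m.toState time trace) (m'.toState time' (trace ++ τ)) ∧
    time' ≤ time + T ∧ Q m'

/-! ### Program logic: running time, exact trace and postcondition. -/

section Rules

variable {p b : ℕ} {ω : ℕ → Fin (2 ^ b)}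

theorem Runs.mono {P : Prog p} {m : Mem p} {T T' : ℕ} {τ τ' : List (Access p)}
    {Q Q' : Mem p → Prop} (h : Runs b ω P m T τ Q) (hT : T ≤ T') (hτ : τ = τ')
    (hQ : ∀ m, Q m → Q' m) : Runs b ω P m T' τ' Q' := by
  subst hτ
  intro time trace
  obtain ⟨m', time', h1, h2, h3⟩ := h time trace
  exact ⟨m', time', h1, h2.trans (by omega), hQ _ h3⟩

theorem Runs.seq {P P' : Prog p} {m : Mem p} {T T' : ℕ} {τ τ' : List (Access p)}
    {Q Q' : Mem p → Prop} (h : Runs b ω P m T τ Q) (h' : ∀ m, Q m → Runs b ω P' m T' τ' Q') :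
    Runs b ω (.seq P P') m (T + T') (τ ++ τ') Q' := by
  intro time trace
  obtain ⟨m', time', h1, h2, h3⟩ := h time trace
  obtain ⟨m'', time'', k1, k2, k3⟩ := h' m' h3 time' (trace ++ τ)
  refine ⟨m'', time'', ?_, by omega, k3⟩
  rw [← List.append_assoc]
  exact Exec.seq h1 k1

/-- The invariant is indexed by a ghost iteration counter, so the traces of the iterations may
differ but must be known in advance. The factor `M + 1` pays for the final failing test as well. -/
theorem Runs.loop {e : Expr} {P : Prog p} {T : ℕ} (I : ℕ → Mem p → Prop)
    (τ : ℕ → List (Access p)) (M : ℕ) {m : Mem p} (h0 : I 0 m)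
    (step : ∀ k < M, ∀ m, I k m → e.eval b m.reg ≠ 0 ∧ Runs b ω P m T (τ k) (I (k + 1)))
    (hend : ∀ m, I M m → e.eval b m.reg = 0) :
    Runs b ω (.loop e P) m ((M + 1) * (T + 1 + e.cost)) ((List.range M).flatMap τ) (I M) := by
  induction M generalizing I τ m with
  | zero =>
    intro time trace
    refine ⟨m, time + 1 + e.cost, ?_, by simp; omega, h0⟩
    have := Exec.loopFalse (b := b) (ω := ω) (P := P) (s := m.toState time trace) (hend m h0)
    simpa [Mem.toState] using this
  | succ M ih =>
    intro time trace
    obtain ⟨hne, hrun⟩ := step 0 (by omega) m h0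
    obtain ⟨m', time', h1, h2, h3⟩ := hrun (time + 1 + e.cost) trace
    obtain ⟨m'', time'', k1, k2, k3⟩ := ih (fun k => I (k + 1)) (fun k => τ (k + 1)) h3
      (fun k hk m hm => step (k + 1) (by omega) m hm) hend time' (trace ++ τ 0)
    refine ⟨m'', time'', ?_, ?_, k3⟩
    · rw [List.range_succ_eq_map, List.flatMap_cons, List.flatMap_map, ← List.append_assoc]
      exact Exec.loopTrue (s := m.toState time trace) hne h1 k1
    · have : (M + 1 + 1) * (T + 1 + e.cost) = (M + 1) * (T + 1 + e.cost) + (T + 1 + e.cost) := by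
        ring
      omega

def Prog.LoopFree : Prog p → Bool
  | .loop _ _ => false
  | .seq P Q => P.LoopFree && Q.LoopFree
  | .ite _ P Q => P.LoopFree && Q.LoopFree
  | _ => true

/-- Upper bound on the running time of a loop-free program. -/
def Prog.maxTime : Prog p → ℕ
  | .skip => 0
  | .assign _ e => 1 + e.cost
  | .rand _ => 1
  | .read _ _ a => 1 + a.cost
  | .write _ a e => 1 + a.cost + e.cost
  | .seq P Q => P.maxTime + Q.maxTime
  | .ite e P Q => 1 + e.cost + P.maxTime + Q.maxTime
  | .loop _ _ => 0

/-- Effect of a loop-free program on the memory. -/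
def Prog.sem (b : ℕ) (ω : ℕ → Fin (2 ^ b)) : Prog p → Mem p → Mem p
  | .skip, m => m
  | .assign i e, m => ⟨Function.update m.reg i (e.eval b m.reg), m.disk, m.coins⟩
  | .rand i, m => ⟨Function.update m.reg i (ω m.coins : ℕ), m.disk, m.coins + 1⟩
  | .read i d a, m => ⟨Function.update m.reg i (m.disk d (a.eval b m.reg)), m.disk, m.coins⟩
  | .write d a e, m =>
    ⟨m.reg, Function.update m.disk d
      (Function.update (m.disk d) (a.eval b m.reg) (e.eval b m.reg)), m.coins⟩
  | .seq P Q, m => Q.sem b ω (P.sem b ω m)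
  | .ite e P Q, m => if e.eval b m.reg ≠ 0 then P.sem b ω m else Q.sem b ω m
  | .loop _ _, m => m

/-- Accesses of a loop-free program. -/
def Prog.acc (b : ℕ) (ω : ℕ → Fin (2 ^ b)) : Prog p → Mem p → List (Access p)
  | .read _ d a, m => [⟨false, d, a.eval b m.reg⟩]
  | .write d a _, m => [⟨true, d, a.eval b m.reg⟩]
  | .seq P Q, m => P.acc b ω m ++ Q.acc b ω (P.sem b ω m)
  | .ite e P Q, m => if e.eval b m.reg ≠ 0 then P.acc b ω m else Q.acc b ω m
  | _, _ => []

/-- Loop bodies of the passes are loop-free, so this reduces reasoning about them to evaluating the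
functions `sem` and `acc`. Charging both branches of a conditional keeps the time bound independent
of the memory. -/
theorem Runs.of_loopFree {P : Prog p} (hP : P.LoopFree = true) (m : Mem p) :
    Runs b ω P m P.maxTime (P.acc b ω m) (fun m' => m' = P.sem b ω m) := by
  induction P generalizing m with
  | skip =>
    intro time trace
    exact ⟨m, time, by simpa [Prog.acc] using Exec.skip _, by simp, rfl⟩
  | assign i e =>
    intro time trace
    refine ⟨_, time + 1 + e.cost, ?_, by simp only [Prog.maxTime]; omega, rfl⟩
    rw [Prog.acc.eq_def, List.append_nil]
    exact Exec.assign i e (m.toState time trace)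
  | rand i =>
    intro time trace
    refine ⟨_, time + 1, ?_, by simp only [Prog.maxTime]; omega, rfl⟩
    rw [Prog.acc.eq_def, List.append_nil]
    exact Exec.rand i (m.toState time trace)
  | read i d a =>
    intro time trace
    exact ⟨_, _, Exec.read i d a (m.toState time trace),
      by simp only [Prog.maxTime, Mem.toState]; omega, rfl⟩
  | write d a e =>
    intro time trace
    exact ⟨_, _, Exec.write d a e (m.toState time trace),
      by simp only [Prog.maxTime, Mem.toState]; omega, rfl⟩
  | seq P Q ihP ihQ =>
    simp only [Prog.LoopFree, Bool.and_eq_true] at hP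
    refine (ihP hP.1 m).seq fun m' hm' => ?_
    subst hm'
    exact ihQ hP.2 _
  | ite e P Q ihP ihQ =>
    simp only [Prog.LoopFree, Bool.and_eq_true] at hP
    intro time trace
    by_cases h : e.eval b m.reg = 0
    · obtain ⟨m', time', h1, h2, h3⟩ := ihQ hP.2 m (time + 1 + e.cost) trace
      refine ⟨m', time', ?_, ?_, ?_⟩
      · simpa [Prog.acc, h] using Exec.iteFalse (s := m.toState time trace) h h1
      · simp only [Prog.maxTime]; omega
      · simpa [Prog.sem, h] using h3
    · obtain ⟨m', time', h1, h2, h3⟩ := ihP hP.1 m (time + 1 + e.cost) trace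
      refine ⟨m', time', ?_, ?_, ?_⟩
      · simpa [Prog.acc, h] using Exec.iteTrue (s := m.toState time trace) h h1
      · simp only [Prog.maxTime]; omega
      · simpa [Prog.sem, h] using h3
  | loop e P => simp [Prog.LoopFree] at hP

theorem Runs.loop_of_loopFree {e : Expr} {P : Prog p} (hP : P.LoopFree = true)
    (I : ℕ → Mem p → Prop) (τ : ℕ → List (Access p)) (M : ℕ) {m : Mem p} (h0 : I 0 m)
    (step : ∀ k < M, ∀ m, I k m →
      e.eval b m.reg ≠ 0 ∧ P.acc b ω m = τ k ∧ I (k + 1) (P.sem b ω m))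
    (hend : ∀ m, I M m → e.eval b m.reg = 0) :
    Runs b ω (.loop e P) m ((M + 1) * (P.maxTime + 1 + e.cost)) ((List.range M).flatMap τ)
      (I M) := by
  refine Runs.loop I τ M h0 (fun k hk m hm => ?_) hend
  obtain ⟨h1, h2, h3⟩ := step k hk m hm
  refine ⟨h1, (Runs.of_loopFree hP m).mono le_rfl h2 ?_⟩
  rintro _ rfl
  exact h3

theorem Runs.straight {P : Prog p} (hP : P.LoopFree = true) {m : Mem p} {τ : List (Access p)}
    {Q : Mem p → Prop} (h1 : P.acc b ω m = τ) (h2 : Q (P.sem b ω m)) :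
    Runs b ω P m P.maxTime τ Q :=
  (Runs.of_loopFree hP m).mono le_rfl h1 (by rintro _ rfl; exact h2)

end Rules

/-! ### Word arithmetic without overflow. -/

section Arithmetic

variable {b : ℕ} {r : ℕ → ℕ} {e f : Expr} {x y : ℕ}

theorem eval_const (h : x < 2 ^ b) : (Expr.const x).eval b r = x := Nat.mod_eq_of_lt h

theorem eval_reg {i : ℕ} (h : r i = x) : (Expr.reg i).eval b r = x := h

theorem eval_add (hx : e.eval b r = x) (hy : f.eval b r = y) (h : x + y < 2 ^ b) :
    (Expr.bin .add e f).eval b r = x + y := by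
  simp only [Expr.eval, Op.eval, hx, hy, Nat.mod_eq_of_lt h]

theorem eval_mul (hx : e.eval b r = x) (hy : f.eval b r = y) (h : x * y < 2 ^ b) :
    (Expr.bin .mul e f).eval b r = x * y := by
  simp only [Expr.eval, Op.eval, hx, hy, Nat.mod_eq_of_lt h]

theorem eval_sub (hx : e.eval b r = x) (hy : f.eval b r = y) (hyx : y ≤ x) (h : x < 2 ^ b) :
    (Expr.bin .sub e f).eval b r = x - y := by
  simp only [Expr.eval, Op.eval, hx, hy]
  rw [show x + (2 ^ b - y) = (x - y) + 2 ^ b by omega, Nat.add_mod_right,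
    Nat.mod_eq_of_lt (by omega)]

theorem eval_div (hx : e.eval b r = x) (hy : f.eval b r = y) :
    (Expr.bin .div e f).eval b r = x / y := by
  simp only [Expr.eval, Op.eval, hx, hy]

theorem eval_mod (hx : e.eval b r = x) (hy : f.eval b r = y) :
    (Expr.bin .mod e f).eval b r = x % y := by
  simp only [Expr.eval, Op.eval, hx, hy]

theorem eval_lt (hx : e.eval b r = x) (hy : f.eval b r = y) (h : 1 < 2 ^ b) :
    (Expr.bin .lt e f).eval b r = if x < y then 1 else 0 := by
  simp only [Expr.eval, Op.eval, hx, hy, Nat.mod_eq_of_lt h]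

theorem eval_eq (hx : e.eval b r = x) (hy : f.eval b r = y) (h : 1 < 2 ^ b) :
    (Expr.bin .eq e f).eval b r = if x = y then 1 else 0 := by
  simp only [Expr.eval, Op.eval, hx, hy, Nat.mod_eq_of_lt h]

end Arithmetic

/-! ### Three-word records on disks and in registers. -/

section Records

/-- A record: three consecutive words. -/
abbrev Rec := ℕ × ℕ × ℕ

def getRec (D : ℕ → ℕ) (q : ℕ) : Rec := (D (3 * q), D (3 * q + 1), D (3 * q + 2))

def putRec (D : ℕ → ℕ) (q : ℕ) (x : Rec) : ℕ → ℕ :=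
  Function.update (Function.update (Function.update D (3 * q) x.1) (3 * q + 1) x.2.1)
    (3 * q + 2) x.2.2

theorem getRec_putRec (D : ℕ → ℕ) (q q' : ℕ) (x : Rec) :
    getRec (putRec D q x) q' = if q' = q then x else getRec D q' := by
  by_cases h : q' = q
  · subst h
    simp [getRec, putRec]
  · have h1 : 3 * q' ≠ 3 * q := by omega
    simp only [getRec, putRec, Function.update_apply, h, if_false]
    simp only [show (3 * q' ≠ 3 * q + 2) by omega, show (3 * q' ≠ 3 * q + 1) by omega, h1, if_false,
      show (3 * q' + 1 ≠ 3 * q) by omega, show (3 * q' + 2 ≠ 3 * q) by omega,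
      show (3 * q' + 2 ≠ 3 * q + 1) by omega, show (3 * q' + 1 ≠ 3 * q + 2) by omega,
      show (3 * q' + 2 ≠ 3 * q + 2) by omega, show (3 * q' + 1 ≠ 3 * q + 1) by omega]

def setRec (r : ℕ → ℕ) (i : ℕ) (x : Rec) : ℕ → ℕ :=
  Function.update (Function.update (Function.update r i x.1) (i + 1) x.2.1) (i + 2) x.2.2

def regRec (r : ℕ → ℕ) (i : ℕ) : Rec := (r i, r (i + 1), r (i + 2))

/-- Access to the three words of record `q`. -/
def acc3 (w : Bool) (d : Fin 3) (q : ℕ) : List (Access 3) :=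
  [⟨w, d, 3 * q⟩, ⟨w, d, 3 * q + 1⟩, ⟨w, d, 3 * q + 2⟩]

def wordAddr (i k : ℕ) : Expr :=
  .bin .add (.bin .mul (.const 3) (.reg i)) (.const k)

/-- Load the record of disk `d` whose index is in register `i` into registers
`r`, `r + 1`, `r + 2`. -/
def readRec (r : ℕ) (d : Fin 3) (i : ℕ) : Prog 3 :=
  .seq (.read r d (wordAddr i 0))
    (.seq (.read (r + 1) d (wordAddr i 1)) (.read (r + 2) d (wordAddr i 2)))

def writeRec (d : Fin 3) (i : ℕ) (r : ℕ) : Prog 3 :=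
  .seq (.write d (wordAddr i 0) (.reg r))
    (.seq (.write d (wordAddr i 1) (.reg (r + 1))) (.write d (wordAddr i 2) (.reg (r + 2))))

variable {b : ℕ} {ω : ℕ → Fin (2 ^ b)} {i r : ℕ}

theorem eval_wordAddr {reg : ℕ → ℕ} {k : ℕ} (h : 3 * reg i + 3 < 2 ^ b) (hk : k ≤ 2) :
    (wordAddr i k).eval b reg = 3 * reg i + k :=
  eval_add (eval_mul (eval_const (by omega)) rfl (by omega)) (eval_const (by omega)) (by omega)

theorem sem_readRec {reg : ℕ → ℕ} {D : Fin 3 → ℕ → ℕ} {c x : ℕ} (d : Fin 3) (hx : reg i = x)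
    (h : 3 * x + 3 < 2 ^ b) (hi : i < r) :
    (readRec r d i).sem b ω ⟨reg, D, c⟩ = ⟨setRec reg r (getRec (D d) x), D, c⟩ ∧
    (readRec r d i).acc b ω ⟨reg, D, c⟩ = acc3 false d x := by
  subst hx
  have h1 : ∀ v, Function.update reg r v i = reg i := fun v =>
    Function.update_of_ne (by omega) _ _
  have h2 : ∀ v v', Function.update (Function.update reg r v) (r + 1) v' i = reg i :=
    fun v v' => by rw [Function.update_of_ne (by omega), h1]
  have h3 : ∀ v, (wordAddr i 1).eval b (Function.update reg r v) = 3 * reg i + 1 := fun v => by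
    rw [eval_wordAddr (by rw [h1]; exact h) (by omega), h1]
  have h4 : ∀ v v', (wordAddr i 2).eval b (Function.update (Function.update reg r v) (r + 1) v')
      = 3 * reg i + 2 := fun v v' => by
    rw [eval_wordAddr (by rw [h2]; exact h) (by omega), h2]
  simp only [readRec, Prog.sem, Prog.acc, eval_wordAddr h (Nat.zero_le 2), h3, h4]
  exact ⟨rfl, rfl⟩

theorem sem_writeRec {reg : ℕ → ℕ} {D : Fin 3 → ℕ → ℕ} {c x : ℕ} {y : Rec} (d : Fin 3)
    (hx : reg i = x) (hy : regRec reg r = y) (h : 3 * x + 3 < 2 ^ b) :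
    (writeRec d i r).sem b ω ⟨reg, D, c⟩ = ⟨reg, Function.update D d (putRec (D d) x y), c⟩ ∧
    (writeRec d i r).acc b ω ⟨reg, D, c⟩ = acc3 true d x := by
  subst hx hy
  simp only [writeRec, Prog.sem, Prog.acc, eval_wordAddr h (Nat.zero_le 2), eval_wordAddr h le_rfl,
    eval_wordAddr h (show 1 ≤ 2 by omega), Expr.eval, Function.update_self, Function.update_idem]
  exact ⟨rfl, rfl⟩

end Records


/-! ### The compare-exchange pass. -/

section Passes

variable {b : ℕ} {ω : ℕ → Fin (2 ^ b)}

/-- The registers below `10` and the coin counter agree. -/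
def Frame (m m' : Mem 3) : Prop := (∀ r < 10, m'.reg r = m.reg r) ∧ m'.coins = m.coins

theorem Frame.trans {m m' m'' : Mem 3} (h : Frame m m') (h' : Frame m' m'') : Frame m m'' :=
  ⟨fun r hr => (h'.1 r hr).trans (h.1 r hr), h'.2.trans h.2⟩

theorem setRec_of_lt {r : ℕ → ℕ} {i j : ℕ} (x : Rec) (h : j < i) : setRec r i x j = r j := by
  simp only [setRec, Function.update_apply]
  rw [if_neg (by omega), if_neg (by omega), if_neg (by omega)]

theorem regRec_setRec (r : ℕ → ℕ) (i : ℕ) (x : Rec) : regRec (setRec r i x) i = x := by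
  simp [regRec, setRec]

theorem regRec_setRec_of_le {r : ℕ → ℕ} {i j : ℕ} (x : Rec) (h : j + 3 ≤ i) :
    regRec (setRec r i x) j = regRec r j := by
  simp only [regRec]
  rw [setRec_of_lt x (by omega), setRec_of_lt x (by omega), setRec_of_lt x (by omega)]

theorem regRec_update_of_lt {r : ℕ → ℕ} {i j v : ℕ} (h : j < i) :
    regRec (Function.update r j v) i = regRec r i := by
  simp only [regRec]
  rw [Function.update_of_ne (by omega), Function.update_of_ne (by omega),
    Function.update_of_ne (by omega)]

/-- Body of the compare-exchange pass: `sw` decides whether the two records are exchanged. -/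
def combineBody (sw : Expr) : Prog 3 :=
  .seq (readRec 20 1 10) <| .seq (readRec 23 2 10) <|
  .seq (.assign 11 (.bin .mul (.const 2) (.reg 10))) <|
  .seq (.assign 12 (.bin .add (.reg 11) (.const 1))) <|
  .seq (.ite sw (.seq (writeRec 0 11 23) (writeRec 0 12 20))
    (.seq (writeRec 0 11 20) (writeRec 0 12 23)))
  (.assign 10 (.bin .add (.reg 10) (.const 1)))

/-- Interleave the contents of disks `1` and `2` on disk `0`, exchanging the records of a pair
if `sw` is nonzero. -/
def combine (sw : Expr) : Prog 3 :=
  .seq (.assign 10 (.const 0)) <|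
  .loop (.bin .lt (.reg 10) (.bin .div (.reg 3) (.const 2))) (combineBody sw)

def combineStepTrace (q : ℕ) : List (Access 3) :=
  acc3 false 1 q ++ (acc3 false 2 q ++ (acc3 true 0 (2 * q) ++ acc3 true 0 (2 * q + 1)))

/-- The registers `reg` are those at the moment when `sw` is evaluated. Exposing them keeps the
exchange rule arbitrary. Both branches write the same two addresses in the same order, so the trace
does not depend on the rule. -/
theorem combineBody_run {sw : Expr} {m : Mem 3} {q : ℕ} (hq : m.reg 10 = q)
    (h : 6 * q + 6 < 2 ^ b) :
    ∃ reg, (combineBody sw).sem b ω m = ⟨Function.update reg 10 (q + 1),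
        Function.update m.disk 0 (if sw.eval b reg ≠ 0 then
          putRec (putRec (m.disk 0) (2 * q) (getRec (m.disk 2) q)) (2 * q + 1)
            (getRec (m.disk 1) q)
        else putRec (putRec (m.disk 0) (2 * q) (getRec (m.disk 1) q)) (2 * q + 1)
            (getRec (m.disk 2) q)), m.coins⟩ ∧
      (combineBody sw).acc b ω m = combineStepTrace q ∧
      (∀ r < 11, reg r = m.reg r) ∧ regRec reg 20 = getRec (m.disk 1) q ∧
      regRec reg 23 = getRec (m.disk 2) q := by
  obtain ⟨reg0, D, c⟩ := m
  dsimp only at hq ⊢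
  set reg1 := setRec (setRec reg0 20 (getRec (D 1) q)) 23 (getRec (D 2) q) with hreg1
  have e10 : reg1 10 = q := by
    rw [hreg1, setRec_of_lt _ (by omega), setRec_of_lt _ (by omega), hq]
  have e20 : regRec reg1 20 = getRec (D 1) q := by
    rw [hreg1, regRec_setRec_of_le _ (by omega), regRec_setRec]
  have e23 : regRec reg1 23 = getRec (D 2) q := by rw [hreg1, regRec_setRec]
  set reg2 := Function.update (Function.update reg1 11 (2 * q)) 12 (2 * q + 1) with hreg2
  have f10 : reg2 10 = q := by simp [hreg2, e10]
  have f11 : reg2 11 = 2 * q := by simp [hreg2]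
  have f12 : reg2 12 = 2 * q + 1 := by simp [hreg2]
  have f20 : regRec reg2 20 = getRec (D 1) q := by
    rw [hreg2, regRec_update_of_lt (by omega), regRec_update_of_lt (by omega), e20]
  have f23 : regRec reg2 23 = getRec (D 2) q := by
    rw [hreg2, regRec_update_of_lt (by omega), regRec_update_of_lt (by omega), e23]
  obtain ⟨s1, a1⟩ := sem_readRec (ω := ω) (D := D) (c := c) (r := 20) 1 hq
    (show 3 * q + 3 < 2 ^ b by omega) (by omega)
  obtain ⟨s2, a2⟩ := sem_readRec (ω := ω) (D := D) (c := c) (r := 23) 2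
    (show setRec reg0 20 (getRec (D 1) q) 10 = q by rw [setRec_of_lt _ (by omega), hq])
    (show 3 * q + 3 < 2 ^ b by omega) (by omega)
  have v1 : (Expr.bin .mul (.const 2) (.reg 10)).eval b reg1 = 2 * q :=
    eval_mul (eval_const (by omega)) (eval_reg e10) (by omega)
  have v2 : (Expr.bin .add (.reg 11) (.const 1)).eval b (Function.update reg1 11 (2 * q)) =
      2 * q + 1 := eval_add (by simp [Expr.eval]) (eval_const (by omega)) (by omega)
  have v3 : (Expr.bin .add (.reg 10) (.const 1)).eval b reg2 = q + 1 :=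
    eval_add (eval_reg f10) (eval_const (by omega)) (by omega)
  have w : ∀ (D : Fin 3 → ℕ → ℕ) (i r x : ℕ) (y : Rec), reg2 i = x → regRec reg2 r = y →
      3 * x + 3 < 2 ^ b → _ := fun D i r x y h1 h2 h3 =>
    sem_writeRec (ω := ω) (i := i) (r := r) (reg := reg2) (D := D) (c := c) 0 h1 h2 h3
  refine ⟨reg2, ?_, ?_, ?_, f20, f23⟩
  · simp only [combineBody, Prog.sem, s1, s2, ← hreg1, v1, v2, ← hreg2]
    split_ifs with hsw
    · rw [(w _ 11 23 _ _ f11 f23 (by omega)).1, (w _ 12 20 _ _ f12 f20 (by omega)).1]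
      simp only [v3, Function.update_self, Function.update_idem]
    · rw [(w _ 11 20 _ _ f11 f20 (by omega)).1, (w _ 12 23 _ _ f12 f23 (by omega)).1]
      simp only [v3, Function.update_self, Function.update_idem]
  · simp only [combineBody, Prog.sem, Prog.acc, s1, s2, a1, a2, ← hreg1, v1, v2, ← hreg2,
      List.nil_append, List.append_nil]
    split_ifs with hsw
    · rw [(w _ 11 23 _ _ f11 f23 (by omega)).1, (w _ 11 23 _ _ f11 f23 (by omega)).2,
        (w _ 12 20 _ _ f12 f20 (by omega)).2]
      rfl
    · rw [(w _ 11 20 _ _ f11 f20 (by omega)).1, (w _ 11 20 _ _ f11 f20 (by omega)).2,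
        (w _ 12 23 _ _ f12 f23 (by omega)).2]
      rfl
  · intro r hr
    rw [hreg2, Function.update_of_ne (by omega), Function.update_of_ne (by omega), hreg1,
      setRec_of_lt _ (by omega), setRec_of_lt _ (by omega)]

def combineTrace (M : ℕ) : List (Access 3) := (List.range M).flatMap combineStepTrace

theorem runs_combine {sw : Expr} (hsw : sw.cost ≤ 80) {M : ℕ} {m : Mem 3} (U V : ℕ → Rec)
    (S : ℕ → Prop) [DecidablePred S] (hM : m.reg 3 = 2 * M) (hb : 6 * M + 6 < 2 ^ b)
    (hU : ∀ q < M, getRec (m.disk 1) q = U q) (hV : ∀ q < M, getRec (m.disk 2) q = V q)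
    (hS : ∀ q < M, ∀ reg : ℕ → ℕ, (∀ r < 10, reg r = m.reg r) → reg 10 = q →
      regRec reg 20 = U q → regRec reg 23 = V q → (sw.eval b reg ≠ 0 ↔ S q)) :
    Runs b ω (combine sw) m (300 * (M + 1)) (combineTrace M) (fun m' => Frame m m' ∧
      ∀ q < M, getRec (m'.disk 0) (2 * q) = (if S q then V q else U q) ∧
        getRec (m'.disk 0) (2 * q + 1) = if S q then U q else V q) := by
  have hcond : ∀ (m' : Mem 3) {k : ℕ}, Frame m m' → m'.reg 10 = k →
      (Expr.bin .lt (.reg 10) (.bin .div (.reg 3) (.const 2))).eval b m'.reg =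
        if k < M then 1 else 0 := fun m' k h2 h1 => by
    rw [eval_lt (eval_reg h1) (eval_div (eval_reg ((h2.1 3 (by omega)).trans hM))
      (eval_const (x := 2) (by omega))) (by omega), Nat.mul_div_cancel_left M two_pos]
  have hpre : Runs b ω (.assign 10 (.const 0) : Prog 3) m 2 []
      (fun m' => m' = ⟨Function.update m.reg 10 0, m.disk, m.coins⟩) :=
    Runs.straight rfl rfl (by simp [Prog.sem, Expr.eval])
  have hloop := fun m0 (h0 : m0 = (⟨Function.update m.reg 10 0, m.disk, m.coins⟩ : Mem 3)) =>
    Runs.loop_of_loopFree (b := b) (ω := ω) (m := m0)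
    (e := .bin .lt (.reg 10) (.bin .div (.reg 3) (.const 2))) (P := combineBody sw) rfl
    (fun k m' => m'.reg 10 = k ∧ Frame m m' ∧ m'.disk 1 = m.disk 1 ∧ m'.disk 2 = m.disk 2 ∧
      ∀ q < k, getRec (m'.disk 0) (2 * q) = (if S q then V q else U q) ∧
        getRec (m'.disk 0) (2 * q + 1) = if S q then U q else V q) combineStepTrace M
    (by
      subst h0
      exact ⟨by simp, ⟨fun r hr => by simp [show r ≠ 10 by omega], rfl⟩, rfl, rfl, by simp⟩)
    (by
      rintro k hk m' ⟨h1, h2, h3, h4, h5⟩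
      obtain ⟨reg, hs, ha, hr, hr1, hr2⟩ := combineBody_run (ω := ω) (sw := sw) (m := m') h1
        (by omega)
      refine ⟨?_, ha, ?_⟩
      · rw [hcond _ h2 h1, if_pos hk]
        exact one_ne_zero
      · have key : sw.eval b reg ≠ 0 ↔ S k := hS k hk reg
          (fun r hr' => by rw [hr r (by omega), h2.1 r hr']) (by rw [hr 10 (by omega), h1])
          (by rw [hr1, h3, hU k hk]) (by rw [hr2, h4, hV k hk])
        rw [hs, h3, h4, hU k hk, hV k hk]
        refine ⟨by simp, ⟨fun r hr' => ?_, h2.2⟩, by simp [h3], by simp [h4], fun q hq => ?_⟩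
        · simp only [Function.update_of_ne (show r ≠ 10 by omega)]
          rw [hr r (by omega), h2.1 r hr']
        · simp only [Function.update_self]
          rcases Nat.lt_succ_iff_lt_or_eq.mp hq with hq' | rfl
          · by_cases hSk : S k <;>
            simp only [key, hSk, if_true, if_false, getRec_putRec,
              show 2 * q ≠ 2 * k by omega, show 2 * q + 1 ≠ 2 * k by omega,
              show 2 * q ≠ 2 * k + 1 by omega, show 2 * q + 1 ≠ 2 * k + 1 by omega,
              h5 q hq', and_self]
          · by_cases hSk : S q <;>
            simp [key, hSk, getRec_putRec])
    (by
      rintro m' ⟨h1, h2, -⟩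
      rw [hcond _ h2 h1, if_neg (lt_irrefl _)])
  refine (hpre.seq hloop).mono ?_ rfl fun m' hm' => ⟨hm'.2.1, hm'.2.2.2.2⟩
  -- This is where the bound `80` on the cost of `sw` enters: it leaves a body cheap enough for
  -- `300` steps per pair.
  have : (combineBody sw).maxTime ≤ 270 := by
    simp only [combineBody, Prog.maxTime, readRec, writeRec, wordAddr, Expr.cost]
    omega
  have := Nat.mul_le_mul_left (M + 1) (show (combineBody sw).maxTime + 1 +
    (Expr.bin .lt (.reg 10) (.bin .div (.reg 3) (.const 2))).cost ≤ 280 by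
      simp only [Expr.cost]; omega)
  omega

end Passes


/-! ### Counting loops: splitting, labelling, extracting and copying back. -/

section Passes

variable {b : ℕ} {ω : ℕ → Fin (2 ^ b)}

/-- Run `body` with register `10` ranging over the numbers below `bd`. -/
def forLoop (bd : Expr) (body : Prog 3) : Prog 3 :=
  .seq (.assign 10 (.const 0)) <|
  .loop (.bin .lt (.reg 10) bd) (.seq body (.assign 10 (.bin .add (.reg 10) (.const 1))))

/-- One numerical bound serves all passes: a body and loop bound of total cost at most `280` leave
room for test and increment within `300`. The body must preserve register `10`. -/
theorem runs_forLoop {bd : Expr} {body : Prog 3} (hbody : body.LoopFree = true)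
    (I : ℕ → Mem 3 → Prop) (τ : ℕ → List (Access 3)) (M : ℕ) {m : Mem 3} (hM : M + 1 < 2 ^ b)
    (hT : body.maxTime + bd.cost ≤ 280) (h0 : I 0 ⟨Function.update m.reg 10 0, m.disk, m.coins⟩)
    (h10 : ∀ k m, I k m → m.reg 10 = k) (hbd : ∀ k m, I k m → bd.eval b m.reg = M)
    (step : ∀ k < M, ∀ m, I k m → body.acc b ω m = τ k ∧ (body.sem b ω m).reg 10 = k ∧
      I (k + 1) ⟨Function.update (body.sem b ω m).reg 10 (k + 1), (body.sem b ω m).disk,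
        (body.sem b ω m).coins⟩) :
    Runs b ω (forLoop bd body) m (300 * (M + 1)) ((List.range M).flatMap τ) (I M) := by
  have hpre : Runs b ω (.assign 10 (.const 0) : Prog 3) m 2 []
      (fun m' => m' = ⟨Function.update m.reg 10 0, m.disk, m.coins⟩) :=
    Runs.straight rfl rfl (by simp [Prog.sem, Expr.eval])
  have hcond : ∀ k m, I k m → (Expr.bin .lt (.reg 10) bd).eval b m.reg = if k < M then 1 else 0 :=
    fun k m hm => eval_lt (eval_reg (h10 k m hm)) (hbd k m hm) (by omega)
  refine (hpre.seq (fun m0 hm0 => Runs.loop_of_loopFree (by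
    simpa [Prog.LoopFree] using hbody) I τ M (hm0 ▸ h0) (fun k hk m hm => ?_)
    (fun m hm => ?_))).mono ?_ rfl fun _ h => h
  · obtain ⟨h1, h2, h3⟩ := step k hk m hm
    refine ⟨by rw [hcond k m hm, if_pos hk]; exact one_ne_zero, ?_, ?_⟩
    · simp [Prog.acc, h1]
    · rw [Prog.sem, Prog.sem, eval_add (eval_reg h2) (eval_const (x := 1) (by omega)) (by omega)]
      exact h3
  · rw [hcond M m hm, if_neg (lt_irrefl _)]
  · have := Nat.mul_le_mul_left (M + 1) (show (Prog.seq body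
      (.assign 10 (.bin .add (.reg 10) (.const 1)))).maxTime + 1 + (Expr.bin .lt (.reg 10) bd).cost
        ≤ 290 by simp only [Expr.cost, Prog.maxTime]; omega)
    omega

/-- Position before a round of the record that a round with chunk length `h` brings to
position `2 * q + e`. -/
def pos (h q e : ℕ) : ℕ := q / h * (2 * h) + e * h + q % h

/-- Place of the record at position `p` on its disk after splitting into chunks of length `h`. -/
def splitIdx (h p : ℕ) : ℕ := p / (2 * h) * h + p % h

/-- Together with `splitIdx_pos` this makes splitting a bijection between positions and pairs of a
place and a disk: write `p` as chunk pair, parity of the chunk, and offset. -/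
theorem pos_splitIdx {h : ℕ} (hh : 0 < h) (p : ℕ) : pos h (splitIdx h p) (p / h % 2) = p := by
  have hr := Nat.mod_lt p hh
  have e1 : p / (2 * h) = p / h / 2 := by rw [Nat.div_div_eq_div_mul, mul_comm]
  have e2 : (p / h / 2 * h + p % h) / h = p / h / 2 := by
    rw [mul_comm, Nat.mul_add_div hh, Nat.div_eq_of_lt hr, add_zero]
  have e3 : (p / h / 2 * h + p % h) % h = p % h := by
    rw [mul_comm, Nat.mul_add_mod, Nat.mod_mod]
  simp only [pos, splitIdx, e1, e2, e3]
  have e4 := Nat.div_add_mod p h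
  have e5 := Nat.div_add_mod (p / h) 2
  calc p / h / 2 * (2 * h) + p / h % 2 * h + p % h
      = h * (2 * (p / h / 2) + p / h % 2) + p % h := by ring
    _ = p := by rw [e5, e4]

theorem pos_div {h e : ℕ} (hh : 0 < h) (q : ℕ) : pos h q e / h = q / h * 2 + e := by
  have hr := Nat.mod_lt q hh
  rw [pos, show q / h * (2 * h) + e * h + q % h = h * (q / h * 2 + e) + q % h by ring,
    Nat.mul_add_div hh, Nat.div_eq_of_lt hr, add_zero]

theorem pos_mod {h e : ℕ} (q : ℕ) : pos h q e % h = q % h := by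
  rw [pos, show q / h * (2 * h) + e * h + q % h = h * (q / h * 2 + e) + q % h by ring,
    Nat.mul_add_mod, Nat.mod_mod]

theorem splitIdx_pos {h e : ℕ} (hh : 0 < h) (he : e < 2) (q : ℕ) :
    splitIdx h (pos h q e) = q ∧ pos h q e / h % 2 = e := by
  refine ⟨?_, by rw [pos_div hh]; omega⟩
  rw [splitIdx, mul_comm 2 h, ← Nat.div_div_eq_div_mul, pos_div hh, pos_mod,
    show (q / h * 2 + e) / 2 = q / h by omega, Nat.div_add_mod']

theorem pos_div_two_mul {h e : ℕ} (hh : 0 < h) (he : e < 2) (q : ℕ) :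
    pos h q e / (2 * h) = q / h := by
  rw [mul_comm 2 h, ← Nat.div_div_eq_div_mul, pos_div hh]; omega

theorem splitIdx_le (h p : ℕ) : splitIdx h p ≤ p := by
  have e4 := Nat.div_add_mod p h
  have e1 : p / (2 * h) * h ≤ p / h * h :=
    Nat.mul_le_mul_right _ (by rw [mul_comm, ← Nat.div_div_eq_div_mul]; exact Nat.div_le_self _ _)
  rw [splitIdx]
  calc _ ≤ p / h * h + p % h := by omega
    _ = p := Nat.div_add_mod' p h

theorem pos_lt {h e M q : ℕ} (hh : 0 < h) (he : e < 2) (hM : h ∣ M) (hq : q < M) :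
    pos h q e < 2 * M := by
  obtain ⟨c, rfl⟩ := hM
  have h1 : q / h < c := Nat.div_lt_of_lt_mul hq
  have h2 := pos_div_two_mul hh he q
  have h3 : pos h q e < 2 * h * c := (Nat.div_lt_iff_lt_mul (by omega)).mp (h2 ▸ h1) |>.trans_eq
    (mul_comm _ _)
  linarith [mul_assoc 2 h c]

def splitBody : Prog 3 :=
  .seq (.assign 11 (.bin .add
    (.bin .mul (.bin .div (.reg 10) (.bin .mul (.const 2) (.reg 4))) (.reg 4))
    (.bin .mod (.reg 10) (.reg 4)))) <|
  .seq (readRec 20 0 10) <|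
  .ite (.bin .mod (.bin .div (.reg 10) (.reg 4)) (.const 2)) (writeRec 2 11 20) (writeRec 1 11 20)

/-- Distribute the chunks of `h` records on disk `0` alternately to disks `1` and `2`. -/
def split : Prog 3 := forLoop (.reg 3) splitBody

def splitDisk (h p : ℕ) : Fin 3 := if p / h % 2 ≠ 0 then 2 else 1

def splitStepTrace (h p : ℕ) : List (Access 3) :=
  acc3 false 0 p ++ acc3 true (splitDisk h p) (splitIdx h p)

def splitTrace (N h : ℕ) : List (Access 3) := (List.range N).flatMap (splitStepTrace h)

theorem splitBody_run {m : Mem 3} {p h : ℕ} (hp : m.reg 10 = p) (h4 : m.reg 4 = h)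
    (hb : 3 * p + 3 < 2 ^ b) (hb' : 2 * h + 2 < 2 ^ b) :
    ∃ reg, splitBody.sem b ω m = ⟨reg, Function.update m.disk (splitDisk h p)
        (putRec (m.disk (splitDisk h p)) (splitIdx h p) (getRec (m.disk 0) p)), m.coins⟩ ∧
      splitBody.acc b ω m = splitStepTrace h p ∧ ∀ r < 11, reg r = m.reg r := by
  obtain ⟨reg0, D, c⟩ := m
  dsimp only at hp h4 ⊢
  have hle := splitIdx_le h p
  have v1 : (Expr.bin .add
      (.bin .mul (.bin .div (.reg 10) (.bin .mul (.const 2) (.reg 4))) (.reg 4))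
      (.bin .mod (.reg 10) (.reg 4))).eval b reg0 = splitIdx h p := by
    refine eval_add (eval_mul (eval_div (eval_reg hp) (eval_mul (eval_const (by omega))
      (eval_reg h4) (by omega))) (eval_reg h4) ?_) (eval_mod (eval_reg hp) (eval_reg h4)) ?_
    · rw [splitIdx] at hle; omega
    · rw [splitIdx] at hle; omega
  obtain ⟨s1, a1⟩ := sem_readRec (ω := ω) (D := D) (c := c) (r := 20) (x := p) (i := 10)
    (reg := Function.update reg0 11 (splitIdx h p)) 0 (by simpa using hp)
    (show 3 * p + 3 < 2 ^ b by omega) (by omega)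
  set reg1 := setRec (Function.update reg0 11 (splitIdx h p)) 20 (getRec (D 0) p) with hreg1
  have f11 : reg1 11 = splitIdx h p := by rw [hreg1, setRec_of_lt _ (by omega)]; simp
  have f20 : regRec reg1 20 = getRec (D 0) p := by rw [hreg1, regRec_setRec]
  have flt : ∀ r < 11, reg1 r = reg0 r := fun r hr => by
    rw [hreg1, setRec_of_lt _ (by omega), Function.update_of_ne (by omega)]
  have v2 : (Expr.bin .mod (.bin .div (.reg 10) (.reg 4)) (.const 2)).eval b reg1 = p / h % 2 :=
    eval_mod (eval_div (eval_reg (by rw [flt 10 (by omega), hp]))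
      (eval_reg (by rw [flt 4 (by omega), h4]))) (eval_const (by omega))
  have w : ∀ d : Fin 3, _ := fun d =>
    sem_writeRec (ω := ω) (i := 11) (r := 20) (reg := reg1) (D := D) (c := c) d f11 f20
      (by omega)
  refine ⟨reg1, ?_, ?_, flt⟩
  · simp only [splitBody, Prog.sem, v1, s1, v2, splitDisk]
    split_ifs with hsw
    · rw [(w 2).1]
    · rw [(w 1).1]
  · simp only [splitBody, Prog.sem, Prog.acc, v1, s1, a1, v2, splitStepTrace, splitDisk]
    split_ifs with hsw
    · rw [(w 2).2]; rfl
    · rw [(w 1).2]; rfl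

theorem runs_split {M h : ℕ} {m : Mem 3} (A : ℕ → Rec) (hM : m.reg 3 = 2 * M) (h4 : m.reg 4 = h)
    (hh : 0 < h) (hd : h ∣ M) (hb : 6 * M + 6 < 2 ^ b)
    (hA : ∀ p < 2 * M, getRec (m.disk 0) p = A p) :
    Runs b ω split m (300 * (2 * M + 1)) (splitTrace (2 * M) h) (fun m' => Frame m m' ∧
      ∀ q < M, getRec (m'.disk 1) q = A (pos h q 0) ∧ getRec (m'.disk 2) q = A (pos h q 1)) := by
  -- For `M = 0` the divisibility does not bound `h`, so the word-size estimates below would fail;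
  -- the loop is empty then.
  rcases Nat.eq_zero_or_pos M with rfl | hMpos
  · refine (runs_forLoop (ω := ω) (bd := .reg 3) (body := splitBody) rfl
      (fun k m' => m'.reg 10 = k ∧ Frame m m')
      (splitStepTrace h) 0 (by omega) (by decide)
      ⟨by simp, fun r hr => by simp [show r ≠ 10 by omega], rfl⟩ (fun _ _ h => h.1)
      (fun k m' h => (h.2.1 3 (by omega)).trans hM) (fun k hk => absurd hk (by omega))).mono
      (by omega) rfl fun m' h => ⟨h.2, fun q hq => absurd hq (by omega)⟩
  have hhM := Nat.le_of_dvd hMpos hd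
  refine (runs_forLoop (ω := ω) (bd := .reg 3) (body := splitBody) rfl
    (fun k m' => m'.reg 10 = k ∧ Frame m m' ∧ m'.disk 0 = m.disk 0 ∧
      ∀ p < k, getRec (m'.disk (splitDisk h p)) (splitIdx h p) = A p)
    (splitStepTrace h) (2 * M) (by omega) (by decide)
    ⟨by simp, ⟨fun r hr => by simp [show r ≠ 10 by omega], rfl⟩, rfl, by simp⟩ (fun _ _ h => h.1)
    (fun k m' h => (h.2.1.1 3 (by omega)).trans hM) ?_).mono
    (by omega) rfl ?_
  · rintro k hk m' ⟨h1, h2, h3, h5⟩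
    obtain ⟨reg, hs, ha, hr⟩ := splitBody_run (ω := ω) h1 ((h2.1 4 (by omega)).trans h4)
      (by omega) (by omega)
    refine ⟨ha, ?_⟩
    rw [hs, h3, hA k hk]
    refine ⟨(hr 10 (by omega)).trans h1, by simp, ⟨fun r hr' => ?_, h2.2⟩, ?_, fun p hp => ?_⟩
    · simp only [Function.update_of_ne (show r ≠ 10 by omega)]
      rw [hr r (by omega), h2.1 r hr']
    · dsimp only
      rw [Function.update_of_ne, h3]
      rw [splitDisk]; split_ifs <;> decide
    · rcases Nat.lt_succ_iff_lt_or_eq.mp hp with hp' | rfl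
      · dsimp only
        by_cases hdk : splitDisk h p = splitDisk h k
        · rw [hdk, Function.update_self, getRec_putRec, if_neg, ← hdk, h5 p hp']
          -- A later write cannot hit the same place: equal disks mean equal chunk parities, and
          -- with equal indices `pos_splitIdx` recovers the position.
          intro he
          have hpar : p / h % 2 = k / h % 2 := by
            simp only [splitDisk] at hdk
            by_contra hne
            by_cases h0 : p / h % 2 = 0
            · have : k / h % 2 ≠ 0 := fun h => hne (h0.trans h.symm)
              simp [h0, this] at hdk
            · have : k / h % 2 = 0 := by omega
              simp [h0, this] at hdk
          have := pos_splitIdx hh p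
          rw [he, hpar, pos_splitIdx hh k] at this
          omega
        · rw [Function.update_of_ne hdk, h5 p hp']
      · simp only [Function.update_self, getRec_putRec, if_true]
  · rintro m' ⟨-, h2, -, h5⟩
    refine ⟨h2, fun q hq => ?_⟩
    have g := fun e (he : e < 2) => h5 _ (pos_lt hh he hd hq)
    obtain ⟨i0, j0⟩ := splitIdx_pos hh two_pos q
    obtain ⟨i1, j1⟩ := splitIdx_pos hh one_lt_two q
    have g0 := g 0 two_pos
    have g1 := g 1 one_lt_two
    simp only [i0, splitDisk, j0] at g0
    simp only [i1, splitDisk, j1] at g1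
    exact ⟨by simpa using g0, by simpa using g1⟩

/-- Body of the pass creating the record (value, index + 1, random label) of each input word. -/
def labelBody : Prog 3 :=
  .seq (.read 20 0 (.reg 10)) <| .seq (.assign 21 (.bin .add (.reg 10) (.const 1))) <|
  .seq (.rand 22) (writeRec 1 10 20)

def label : Prog 3 := forLoop (.reg 0) labelBody

def labelTrace (n : ℕ) : List (Access 3) :=
  (List.range n).flatMap fun p => ⟨false, 0, p⟩ :: acc3 true 1 p

/-- With no coins consumed before, the label of word `q` is exactly `ω q`. Tags start at `1`, so the
untouched zero records can serve as dummies. -/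
theorem runs_label {n : ℕ} {m : Mem 3} (h0 : m.reg 0 = n) (hc : m.coins = 0)
    (hb : 3 * n + 3 < 2 ^ b) :
    Runs b ω label m (300 * (n + 1)) (labelTrace n) (fun m' => (∀ r < 10, m'.reg r = m.reg r) ∧
      (∀ q < n, getRec (m'.disk 1) q = (m.disk 0 q, q + 1, (ω q : ℕ))) ∧
      (∀ q, n ≤ q → getRec (m'.disk 1) q = getRec (m.disk 1) q) ∧ m'.disk 2 = m.disk 2) := by
  refine (runs_forLoop (ω := ω) (bd := .reg 0) (body := labelBody) rfl
    (fun k m' => m'.reg 10 = k ∧ (∀ r < 10, m'.reg r = m.reg r) ∧ m'.coins = k ∧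
      m'.disk 0 = m.disk 0 ∧ (∀ q < k, getRec (m'.disk 1) q = (m.disk 0 q, q + 1, (ω q : ℕ))) ∧
      (∀ q, k ≤ q → getRec (m'.disk 1) q = getRec (m.disk 1) q) ∧ m'.disk 2 = m.disk 2)
    (fun p => ⟨false, 0, p⟩ :: acc3 true 1 p) n (by omega) (by decide)
    ⟨by simp, fun r hr => by simp [show r ≠ 10 by omega], hc, rfl, by simp, fun _ _ => rfl, rfl⟩
    (fun _ _ h => h.1) (fun k m' h => (h.2.1 0 (by omega)).trans h0) ?_).mono
    (by omega) rfl fun m' h => ⟨h.2.1, h.2.2.2.2⟩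
  rintro k hk ⟨reg, D, c⟩ ⟨h1, h2, h3, h4, h5, h6, h7⟩
  dsimp only at h1 h2 h3 h4 h5 h6 h7
  subst h3
  have v0 : (Expr.reg 10).eval b reg = c := h1
  have v1 : (Expr.bin .add (.reg 10) (.const 1)).eval b (Function.update reg 20 (D 0 c)) =
    c + 1 := eval_add (eval_reg (by simpa using h1)) (eval_const (by omega)) (by omega)
  obtain ⟨s, a⟩ := sem_writeRec (ω := ω) (i := 10) (r := 20) (D := D) (c := c + 1) (x := c)
    (y := (D 0 c, c + 1, (ω c : ℕ)))
    (reg := Function.update (Function.update (Function.update reg 20 (D 0 c)) 21 (c + 1)) 22 (ω c))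
    1 (by simpa using h1) (by simp [regRec]) (by omega)
  have hs : labelBody.sem b ω ⟨reg, D, c⟩ = ⟨Function.update (Function.update
      (Function.update reg 20 (D 0 c)) 21 (c + 1)) 22 (ω c),
      Function.update D 1 (putRec (D 1) c (D 0 c, c + 1, (ω c : ℕ))), c + 1⟩ := by
    simp only [labelBody, Prog.sem, v0, v1, s]
  have ha : labelBody.acc b ω ⟨reg, D, c⟩ = ⟨false, 0, c⟩ :: acc3 true 1 c := by
    simp only [labelBody, Prog.sem, Prog.acc, v0, v1, a]
    rfl
  rw [hs]
  refine ⟨ha, by simpa using h1, by simp, fun r hr => ?_, rfl, by simpa using h4, fun q hq => ?_,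
    fun q hq => ?_, by simpa using h7⟩
  · simp only [Function.update_apply]
    rw [if_neg (by omega), if_neg (by omega), if_neg (by omega), if_neg (by omega), h2 r hr]
  · simp only [Function.update_self, getRec_putRec]
    split_ifs with hqc
    · rw [hqc, h4]
    · exact h5 q (by omega)
  · simp only [Function.update_self, getRec_putRec]
    rw [if_neg (by omega), h6 q (by omega)]

def extractBody : Prog 3 :=
  .seq (.assign 11 (.bin .add (.bin .sub (.reg 3) (.reg 0)) (.reg 10))) <|
  .seq (readRec 20 0 11) (.write 1 (.reg 10) (.reg 20))

/-- Write the values of the last `n` records of disk `0` to disk `1`. -/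
def extract : Prog 3 := forLoop (.reg 0) extractBody

def extractTrace (N n : ℕ) : List (Access 3) :=
  (List.range n).flatMap fun p => acc3 false 0 (N - n + p) ++ [⟨true, 1, p⟩]

/-- The result goes to disk `1` first, because writing it directly to disk `0` would interleave two
distant cursors on the disk being read. -/
theorem runs_extract {N n : ℕ} {m : Mem 3} (h0 : m.reg 0 = n) (h3 : m.reg 3 = N) (hn : n ≤ N)
    (hb : 3 * N + 3 < 2 ^ b) :
    Runs b ω extract m (300 * (n + 1)) (extractTrace N n) (fun m' => Frame m m' ∧
      ∀ q < n, m'.disk 1 q = (getRec (m.disk 0) (N - n + q)).1) := by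
  refine (runs_forLoop (ω := ω) (bd := .reg 0) (body := extractBody) rfl
    (fun k m' => m'.reg 10 = k ∧ Frame m m' ∧ m'.disk 0 = m.disk 0 ∧
      ∀ q < k, m'.disk 1 q = (getRec (m.disk 0) (N - n + q)).1)
    (fun p => acc3 false 0 (N - n + p) ++ [⟨true, 1, p⟩]) n (by omega) (by decide)
    ⟨by simp, ⟨fun r hr => by simp [show r ≠ 10 by omega], rfl⟩, rfl, by simp⟩
    (fun _ _ h => h.1) (fun k m' h => (h.2.1.1 0 (by omega)).trans h0) ?_).mono
    (by omega) rfl fun m' h => ⟨h.2.1, h.2.2.2⟩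
  rintro k hk ⟨reg, D, c⟩ ⟨h1, h2, h4, h5⟩
  dsimp only at h1 h4 h5
  have v1 : (Expr.bin .add (.bin .sub (.reg 3) (.reg 0)) (.reg 10)).eval b reg = N - n + k :=
    eval_add (eval_sub (eval_reg ((h2.1 3 (by omega)).trans h3))
      (eval_reg ((h2.1 0 (by omega)).trans h0)) hn (by omega)) (eval_reg h1) (by omega)
  obtain ⟨s, a⟩ := sem_readRec (ω := ω) (i := 11) (r := 20) (D := D) (c := c) (x := N - n + k)
    (reg := Function.update reg 11 (N - n + k)) 0 (by simp) (by omega) (by omega)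
  have v2 : (Expr.reg 10).eval b (setRec (Function.update reg 11 (N - n + k)) 20
      (getRec (D 0) (N - n + k))) = k :=
    eval_reg (by rw [setRec_of_lt _ (by omega)]; simpa using h1)
  have v3 : (Expr.reg 20).eval b (setRec (Function.update reg 11 (N - n + k)) 20
      (getRec (D 0) (N - n + k))) = (getRec (D 0) (N - n + k)).1 :=
    eval_reg (by simp [setRec])
  have hs : extractBody.sem b ω ⟨reg, D, c⟩ = ⟨setRec (Function.update reg 11 (N - n + k)) 20
      (getRec (D 0) (N - n + k)), Function.update D 1
        (Function.update (D 1) k (getRec (D 0) (N - n + k)).1), c⟩ := by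
    simp only [extractBody, Prog.sem, v1, s, v2, v3]
  have ha : extractBody.acc b ω ⟨reg, D, c⟩ = acc3 false 0 (N - n + k) ++ [⟨true, 1, k⟩] := by
    simp only [extractBody, Prog.sem, Prog.acc, v1, s, a, v2]
    rfl
  rw [hs]
  refine ⟨ha, ?_, by simp,
    ⟨fun r hr => ?_, h2.2⟩,
    by simpa using h4, fun q hq => ?_⟩
  · dsimp only
    rw [setRec_of_lt _ (by omega), Function.update_of_ne (by omega), h1]
  · simp only [Function.update_of_ne (show r ≠ 10 by omega)]
    rw [setRec_of_lt _ (by omega), Function.update_of_ne (by omega)]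
    exact h2.1 r hr
  · simp only [Function.update_self, Function.update_apply]
    split_ifs with hqc
    · rw [hqc, h4]
    · exact h5 q (by omega)

def copyBackBody : Prog 3 :=
  .seq (.read 20 1 (.reg 10)) (.write 0 (.reg 10) (.reg 20))

/-- Copy the first `n` words of disk `1` to disk `0`. -/
def copyBack : Prog 3 := forLoop (.reg 0) copyBackBody

def copyBackTrace (n : ℕ) : List (Access 3) :=
  (List.range n).flatMap fun p => [⟨false, 1, p⟩, ⟨true, 0, p⟩]

theorem runs_copyBack {n : ℕ} {m : Mem 3} (h0 : m.reg 0 = n) (hb : n + 1 < 2 ^ b) :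
    Runs b ω copyBack m (300 * (n + 1)) (copyBackTrace n) (fun m' =>
      ∀ q < n, m'.disk 0 q = m.disk 1 q) := by
  refine (runs_forLoop (ω := ω) (bd := .reg 0) (body := copyBackBody) rfl
    (fun k m' => m'.reg 10 = k ∧ Frame m m' ∧ m'.disk 1 = m.disk 1 ∧
      ∀ q < k, m'.disk 0 q = m.disk 1 q)
    (fun p => [⟨false, 1, p⟩, ⟨true, 0, p⟩]) n (by omega) (by decide)
    ⟨by simp, ⟨fun r hr => by simp [show r ≠ 10 by omega], rfl⟩, rfl, by simp⟩
    (fun _ _ h => h.1) (fun k m' h => (h.2.1.1 0 (by omega)).trans h0) ?_).mono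
    (by omega) rfl fun m' h => h.2.2.2
  rintro k hk ⟨reg, D, c⟩ ⟨h1, h2, h4, h5⟩
  dsimp only at h1 h4 h5
  have v1 : (Expr.reg 10).eval b reg = k := h1
  have v2 : (Expr.reg 10).eval b (Function.update reg 20 (D 1 k)) = k :=
    eval_reg (by simpa using h1)
  have v3 : (Expr.reg 20).eval b (Function.update reg 20 (D 1 k)) = D 1 k := eval_reg (by simp)
  have hs : copyBackBody.sem b ω ⟨reg, D, c⟩ = ⟨Function.update reg 20 (D 1 k),
      Function.update D 0 (Function.update (D 0) k (D 1 k)), c⟩ := by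
    simp only [copyBackBody, Prog.sem, v1, v2, v3]
  have ha : copyBackBody.acc b ω ⟨reg, D, c⟩ = [⟨false, 1, k⟩, ⟨true, 0, k⟩] := by
    simp only [copyBackBody, Prog.sem, Prog.acc, v1, v2]
    rfl
  rw [hs]
  refine ⟨ha, by simpa using h1, by simp, ⟨fun r hr => ?_, h2.2⟩, by simpa using h4,
    fun q hq => ?_⟩
  · simp only [Function.update_of_ne (show r ≠ 10 by omega),
      Function.update_of_ne (show r ≠ 20 by omega)]
    exact h2.1 r hr
  · simp only [Function.update_self, Function.update_apply]
    split_ifs with hqc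
    · rw [hqc, h4]
    · exact h5 q (by omega)

end Passes


/-! ### The merge pass on the machine. -/

section Merge

variable {b : ℕ} {ω : ℕ → Fin (2 ^ b)}

/-- Lexicographic comparison of value and tag. -/
def recLt (x y : Rec) : Prop := x.1 < y.1 ∨ x.1 = y.1 ∧ x.2.1 < y.2.1

instance : DecidableRel recLt := fun x y => by unfold recLt; infer_instance

/-- Whether the record in registers `i, i + 1, i + 2` precedes that in `j, j + 1, j + 2`. -/
def lexLt (i j : ℕ) : Expr :=
  .bin .add (.bin .lt (.reg i) (.reg j))
    (.bin .mul (.bin .eq (.reg i) (.reg j)) (.bin .lt (.reg (i + 1)) (.reg (j + 1))))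

/-- The two summands exclude each other, so the sum is again a truth value. -/
theorem eval_lexLt {reg : ℕ → ℕ} {i j : ℕ} {x y : Rec} (hx : regRec reg i = x)
    (hy : regRec reg j = y) (hb : 2 < 2 ^ b) :
    (lexLt i j).eval b reg = if recLt x y then 1 else 0 := by
  subst hx hy
  have h := eval_add (b := b) 
    (eval_lt (r := reg) (eval_reg (i := i) rfl) (eval_reg (i := j) rfl) (by omega))
    (eval_mul (eval_eq (r := reg) (eval_reg (i := i) rfl) (eval_reg (i := j) rfl) (by omega))
      (eval_lt (r := reg) (eval_reg (i := i + 1) rfl) (eval_reg (i := j + 1) rfl) (by omega))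
        (by split_ifs <;> omega)) (by split_ifs <;> omega)
  rw [lexLt, h]
  simp only [recLt, regRec]
  by_cases c1 : reg i < reg j <;> by_cases c2 : reg i = reg j <;>
    by_cases c3 : reg (i + 1) < reg (j + 1) <;> simp [c1, c2, c3]

/-- Record `j` of the disk `E` precedes record `i` of the disk `D`. -/
def diskLt (D E : ℕ → ℕ) (i j : ℕ) : Prop := recLt (getRec E j) (getRec D i)

instance (D E : ℕ → ℕ) : DecidableRel (diskLt D E) := fun i j => by
  unfold diskLt; infer_instance

/-- While producing output `p` of a merge of runs of length `h`, with `i` and `j` records already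
consumed, the next record is taken from the first disk. `L i j` says that record `j` of the second
disk precedes record `i` of the first one. -/
def TakeFst (h : ℕ) (L : ℕ → ℕ → Prop) (p : ℕ) (s : ℕ × ℕ) : Prop :=
  s.1 < (p / (2 * h) + 1) * h ∧ ¬ (s.2 < (p / (2 * h) + 1) * h ∧ L s.1 s.2)

instance (h : ℕ) (L : ℕ → ℕ → Prop) [DecidableRel L] (p : ℕ) (s : ℕ × ℕ) :
    Decidable (TakeFst h L p s) := by unfold TakeFst; infer_instance

/-- Number of records consumed from either disk before output `p` of a merge. -/
def mergeState (h : ℕ) (L : ℕ → ℕ → Prop) [DecidableRel L] : ℕ → ℕ × ℕ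
  | 0 => (0, 0)
  | p + 1 => if TakeFst h L p (mergeState h L p) then
      ((mergeState h L p).1 + 1, (mergeState h L p).2)
    else ((mergeState h L p).1, (mergeState h L p).2 + 1)

theorem mergeState_add (h : ℕ) (L : ℕ → ℕ → Prop) [DecidableRel L] (p : ℕ) :
    (mergeState h L p).1 + (mergeState h L p).2 = p := by
  induction p with
  | zero => rfl
  | succ p ih =>
    rw [mergeState]
    split_ifs <;> simp only <;> omega

def mergeBody : Prog 3 :=
  .seq (.assign 13 (.bin .mul (.bin .add (.bin .div (.reg 10) (.bin .mul (.const 2) (.reg 4)))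
    (.const 1)) (.reg 4))) <|
  .ite (.bin .mul (.bin .lt (.reg 11) (.reg 13)) (.bin .eq (.const 0)
      (.bin .mul (.bin .lt (.reg 12) (.reg 13)) (lexLt 23 20))))
    (.seq (writeRec 0 10 20) <| .seq (.assign 11 (.bin .add (.reg 11) (.const 1)))
      (readRec 20 1 11))
    (.seq (writeRec 0 10 23) <| .seq (.assign 12 (.bin .add (.reg 12) (.const 1)))
      (readRec 23 2 12))

/-- Merge the runs of `h` records on disks `1` and `2` into runs of `2 * h` records on disk `0`. -/
def merge : Prog 3 :=
  .seq (.seq (.assign 11 (.const 0)) <| .seq (.assign 12 (.const 0)) <|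
    .seq (readRec 20 1 11) (readRec 23 2 12)) (forLoop (.reg 3) mergeBody)

def mergeStepTrace (h : ℕ) (L : ℕ → ℕ → Prop) [DecidableRel L] (p : ℕ) : List (Access 3) :=
  acc3 true 0 p ++ if TakeFst h L p (mergeState h L p) then
    acc3 false 1 ((mergeState h L p).1 + 1) else acc3 false 2 ((mergeState h L p).2 + 1)

def mergeTrace (N h : ℕ) (L : ℕ → ℕ → Prop) [DecidableRel L] : List (Access 3) :=
  (acc3 false 1 0 ++ acc3 false 2 0) ++ (List.range N).flatMap (mergeStepTrace h L)

/-- The registers always hold the next record of either disk; after one is written, its successor is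
read. This read may run past the current run or the data, which is harmless because `TakeFst` checks
the end of the run. Thus each disk sees one moving cursor. -/
theorem mergeBody_run {m : Mem 3} {p h i j : ℕ} (hp : m.reg 10 = p) (h4 : m.reg 4 = h)
    (h11 : m.reg 11 = i) (h12 : m.reg 12 = j) (h20 : regRec m.reg 20 = getRec (m.disk 1) i)
    (h23 : regRec m.reg 23 = getRec (m.disk 2) j) (hi : i ≤ p) (hj : j ≤ p)
    (hb : 3 * p + 6 < 2 ^ b) (hb' : p + 2 * h + 2 < 2 ^ b) :
    ∃ reg, mergeBody.sem b ω m = ⟨reg, Function.update m.disk 0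
        (putRec (m.disk 0) p (if TakeFst h (diskLt (m.disk 1) (m.disk 2)) p (i, j) then
          getRec (m.disk 1) i else getRec (m.disk 2) j)),
          m.coins⟩ ∧
      mergeBody.acc b ω m = acc3 true 0 p ++
        (if TakeFst h (diskLt (m.disk 1) (m.disk 2)) p (i, j) then acc3 false 1 (i + 1)
          else acc3 false 2 (j + 1)) ∧
      (∀ r < 11, reg r = m.reg r) ∧
      ∃ i' j', (i', j') = (if TakeFst h (diskLt (m.disk 1) (m.disk 2)) p (i, j) then (i + 1, j)
          else (i, j + 1)) ∧
        reg 11 = i' ∧ reg 12 = j' ∧ regRec reg 20 = getRec (m.disk 1) i' ∧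
        regRec reg 23 = getRec (m.disk 2) j' := by
  obtain ⟨reg0, D, c⟩ := m
  dsimp only at hp h4 h11 h12 h20 h23 ⊢
  set E := (p / (2 * h) + 1) * h with hE
  have hEle : E ≤ p + h := by
    rw [hE, add_mul, one_mul]
    have : p / (2 * h) * h ≤ p :=
      (Nat.mul_le_mul_left _ (by omega)).trans (Nat.div_mul_le_self p (2 * h))
    omega
  have v1 : (Expr.bin .mul (.bin .add (.bin .div (.reg 10) (.bin .mul (.const 2) (.reg 4)))
    (.const 1)) (.reg 4)).eval b reg0 = E := by
    refine eval_mul (eval_add (eval_div (eval_reg hp) (eval_mul (eval_const (by omega))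
      (eval_reg h4) (by omega))) (eval_const (by omega)) ?_) (eval_reg h4) ?_
    · have := Nat.div_le_self p (2 * h); omega
    · omega
  set reg1 := Function.update reg0 13 E with hreg1
  have f : ∀ r < 13, reg1 r = reg0 r := fun r hr => by
    rw [hreg1, Function.update_of_ne (by omega)]
  have f10 : reg1 10 = p := by rw [f 10 (by omega), hp]
  have f11 : reg1 11 = i := by rw [f 11 (by omega), h11]
  have f12 : reg1 12 = j := by rw [f 12 (by omega), h12]
  have f13 : reg1 13 = E := by simp [hreg1]
  have f20 : regRec reg1 20 = getRec (D 1) i := by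
    rw [hreg1, regRec_update_of_lt (by omega), h20]
  have f23 : regRec reg1 23 = getRec (D 2) j := by
    rw [hreg1, regRec_update_of_lt (by omega), h23]
  have v2 : (Expr.bin .mul (.bin .lt (.reg 11) (.reg 13)) (.bin .eq (.const 0)
      (.bin .mul (.bin .lt (.reg 12) (.reg 13)) (lexLt 23 20)))).eval b reg1 ≠ 0 ↔
        TakeFst h (diskLt (D 1) (D 2)) p (i, j) := by
    rw [eval_mul (eval_lt (eval_reg f11) (eval_reg f13) (by omega))
      (eval_eq (eval_const (x := 0) (by omega)) (eval_mul (eval_lt (eval_reg f12) (eval_reg f13)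
        (by omega)) (eval_lexLt f23 f20 (by omega)) (by split_ifs <;> omega)) (by omega))
        (by split_ifs <;> omega)]
    rw [TakeFst, ← hE]
    dsimp only
    by_cases c1 : i < E <;> by_cases c2 : j < E <;>
      by_cases c3 : recLt (getRec (D 2) j) (getRec (D 1) i) <;> simp [c1, c2, c3, diskLt]
  obtain ⟨w1, a1⟩ := sem_writeRec (ω := ω) (D := D) (c := c) 0 f10 f20 (by omega)
  obtain ⟨w2, a2⟩ := sem_writeRec (ω := ω) (D := D) (c := c) 0 f10 f23 (by omega)
  have v3 : (Expr.bin .add (.reg 11) (.const 1)).eval b reg1 = i + 1 :=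
    eval_add (eval_reg f11) (eval_const (by omega)) (by omega)
  have v4 : (Expr.bin .add (.reg 12) (.const 1)).eval b reg1 = j + 1 :=
    eval_add (eval_reg f12) (eval_const (by omega)) (by omega)
  by_cases hT : TakeFst h (diskLt (D 1) (D 2)) p (i, j)
  · obtain ⟨s1, b1⟩ := sem_readRec (ω := ω) (i := 11) (r := 20)
      (D := Function.update D 0 (putRec (D 0) p (getRec (D 1) i)))
      (c := c) (x := i + 1) (reg := Function.update reg1 11 (i + 1)) 1 (by simp)
      (by omega) (by omega)
    rw [Function.update_of_ne (by decide)] at s1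
    refine ⟨setRec (Function.update reg1 11 (i + 1)) 20 (getRec (D 1) (i + 1)), ?_, ?_, ?_,
      i + 1, j, ?_, ?_, ?_, ?_, ?_⟩
    · simp only [mergeBody, Prog.sem, v1, ← hreg1, if_pos (v2.mpr hT), w1, v3, s1, if_pos hT]
    · simp only [mergeBody, Prog.sem, Prog.acc, v1, ← hreg1, if_pos (v2.mpr hT), w1, v3, b1,
        if_pos hT, a1, List.nil_append]
    · intro r hr
      rw [setRec_of_lt _ (by omega), Function.update_of_ne (by omega), f r (by omega)]
    · rw [if_pos hT]
    · rw [setRec_of_lt _ (by omega)]; simp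
    · rw [setRec_of_lt _ (by omega)]; simpa using f12
    · rw [regRec_setRec]
    · simpa [regRec, setRec] using f23
  · obtain ⟨s1, b1⟩ := sem_readRec (ω := ω) (i := 12) (r := 23)
      (D := Function.update D 0 (putRec (D 0) p (getRec (D 2) j)))
      (c := c) (x := j + 1) (reg := Function.update reg1 12 (j + 1)) 2 (by simp)
      (by omega) (by omega)
    rw [Function.update_of_ne (by decide)] at s1
    refine ⟨setRec (Function.update reg1 12 (j + 1)) 23 (getRec (D 2) (j + 1)), ?_, ?_, ?_,
      i, j + 1, ?_, ?_, ?_, ?_, ?_⟩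
    · simp only [mergeBody, Prog.sem, v1, ← hreg1, if_neg (v2.not.mpr hT), w2, v4, s1, if_neg hT]
    · simp only [mergeBody, Prog.sem, Prog.acc, v1, ← hreg1, if_neg (v2.not.mpr hT), w2, v4, b1,
        if_neg hT, a2, List.nil_append]
    · intro r hr
      rw [setRec_of_lt _ (by omega), Function.update_of_ne (by omega), f r (by omega)]
    · rw [if_neg hT]
    · rw [setRec_of_lt _ (by omega)]; simpa using f11
    · rw [setRec_of_lt _ (by omega)]; simp
    · rw [regRec_setRec_of_le _ (by omega), regRec_update_of_lt (by omega), f20]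
    · rw [regRec_setRec]

theorem runs_merge {N h : ℕ} {m : Mem 3} (hN : m.reg 3 = N) (h4 : m.reg 4 = h)
    (hb : 6 * N + 6 < 2 ^ b) (hh : h ≤ N) :
    Runs b ω merge m (300 * (N + 2)) (mergeTrace N h (diskLt (m.disk 1) (m.disk 2)))
      (fun m' => Frame m m' ∧
      ∀ p < N, getRec (m'.disk 0) p = if TakeFst h (diskLt (m.disk 1) (m.disk 2)) p
          (mergeState h (diskLt (m.disk 1) (m.disk 2)) p) then
          getRec (m.disk 1) (mergeState h (diskLt (m.disk 1) (m.disk 2)) p).1 else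
          getRec (m.disk 2) (mergeState h (diskLt (m.disk 1) (m.disk 2)) p).2) := by
  have hpre : Runs b ω (.seq (.assign 11 (.const 0)) <| .seq (.assign 12 (.const 0)) <|
    .seq (readRec 20 1 11) (readRec 23 2 12)) m 100 (acc3 false 1 0 ++ acc3 false 2 0)
      (fun m' => Frame m m' ∧ m'.disk = m.disk ∧ m'.reg 11 = 0 ∧ m'.reg 12 = 0 ∧
        regRec m'.reg 20 = getRec (m.disk 1) 0 ∧ regRec m'.reg 23 = getRec (m.disk 2) 0) := by
    obtain ⟨reg0, D, c⟩ := m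
    have v : ∀ reg, (Expr.const 0).eval b reg = 0 := fun reg => eval_const (by omega)
    obtain ⟨s1, a1⟩ := sem_readRec (ω := ω) (D := D) (c := c) (r := 20) (x := 0) (i := 11)
      (reg := Function.update (Function.update reg0 11 0) 12 0) 1 (by simp) (by omega) (by omega)
    obtain ⟨s2, a2⟩ := sem_readRec (ω := ω) (D := D) (c := c) (r := 23) (x := 0) (i := 12)
      (reg := setRec (Function.update (Function.update reg0 11 0) 12 0) 20 (getRec (D 1) 0)) 2
      (by rw [setRec_of_lt _ (by omega)]; simp) (by omega) (by omega)
    refine (Runs.straight (τ := acc3 false 1 0 ++ acc3 false 2 0) rfl ?_ ?_).mono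
      (by decide) rfl fun _ h => h
    · simp only [Prog.acc, Prog.sem, v, s1, a1, a2, List.nil_append]
    · simp only [Prog.sem, v, s1, s2]
      refine ⟨⟨fun r hr => ?_, rfl⟩, trivial, ?_, ?_, ?_, ?_⟩
      · dsimp only
        rw [setRec_of_lt _ (by omega), setRec_of_lt _ (by omega), Function.update_of_ne (by omega),
          Function.update_of_ne (by omega)]
      · rw [setRec_of_lt _ (by omega), setRec_of_lt _ (by omega)]; simp
      · rw [setRec_of_lt _ (by omega), setRec_of_lt _ (by omega)]; simp
      · rw [regRec_setRec_of_le _ (by omega), regRec_setRec]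
      · rw [regRec_setRec]
  refine (hpre.seq fun m0 hm0 => runs_forLoop (ω := ω) (bd := .reg 3) (body := mergeBody) rfl
    (fun k m' => m'.reg 10 = k ∧ Frame m m' ∧ m'.disk 1 = m.disk 1 ∧ m'.disk 2 = m.disk 2 ∧
      m'.reg 11 = (mergeState h (diskLt (m.disk 1) (m.disk 2)) k).1 ∧
      m'.reg 12 = (mergeState h (diskLt (m.disk 1) (m.disk 2)) k).2 ∧
      regRec m'.reg 20 = getRec (m.disk 1) (mergeState h (diskLt (m.disk 1) (m.disk 2)) k).1 ∧
      regRec m'.reg 23 = getRec (m.disk 2) (mergeState h (diskLt (m.disk 1) (m.disk 2)) k).2 ∧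
      ∀ p < k, getRec (m'.disk 0) p = if TakeFst h (diskLt (m.disk 1) (m.disk 2)) p
          (mergeState h (diskLt (m.disk 1) (m.disk 2)) p) then
        getRec (m.disk 1) (mergeState h (diskLt (m.disk 1) (m.disk 2)) p).1 else
        getRec (m.disk 2) (mergeState h (diskLt (m.disk 1) (m.disk 2)) p).2)
    (mergeStepTrace h (diskLt (m.disk 1) (m.disk 2))) N (by omega) (by decide) ?_ (fun _ _ h => h.1)
    (fun k m' h => (h.2.1.1 3 (by omega)).trans hN) ?_).mono (by omega) rfl
    fun m' hm' => ⟨hm'.2.1, hm'.2.2.2.2.2.2.2.2⟩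
  · obtain ⟨g1, g2, g3, g4, g5, g6⟩ := hm0
    refine ⟨by simp, ⟨fun r hr => ?_, g1.2⟩, by rw [g2], by rw [g2], ?_, ?_, ?_, ?_, by simp⟩
    · simpa [show r ≠ 10 by omega] using g1.1 r hr
    · simpa [mergeState] using g3
    · simpa [mergeState] using g4
    · rw [regRec_update_of_lt (by omega)]; exact g5
    · rw [regRec_update_of_lt (by omega)]; exact g6
  · rintro k hk m' ⟨h1, h2, h3, h3', h5, h6, h7, h8, h9⟩
    have hadd := mergeState_add h (diskLt (m.disk 1) (m.disk 2)) k
    obtain ⟨reg, hs, ha, hr, i', j', hij, k1, k2, k3, k4⟩ := mergeBody_run (ω := ω) h1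
      ((h2.1 4 (by omega)).trans h4) h5 h6 (by rw [h3, h7]) (by rw [h3', h8])
      (by omega) (by omega) (by omega)
      (by omega)
    rw [h3, h3'] at hs ha hij
    rw [h3] at k3
    rw [h3'] at k4
    have hij' : (i', j') = mergeState h (diskLt (m.disk 1) (m.disk 2)) (k + 1) := by
      rw [hij, mergeState]
    refine ⟨ha, ?_⟩
    rw [hs]
    refine ⟨(hr 10 (by omega)).trans h1, by simp, ⟨fun r hr' => ?_, h2.2⟩, ?_, ?_, ?_, ?_, ?_, ?_,
      fun p hp => ?_⟩
    · simp only [Function.update_of_ne (show r ≠ 10 by omega)]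
      rw [hr r (by omega), h2.1 r hr']
    · simpa using h3
    · simpa using h3'
    · rw [← hij']; simpa using k1
    · rw [← hij']; simpa using k2
    · rw [← hij', regRec_update_of_lt (by omega), k3]
    · rw [← hij', regRec_update_of_lt (by omega), k4]
    · simp only [Function.update_self, getRec_putRec]
      rcases Nat.lt_succ_iff_lt_or_eq.mp hp with hp' | rfl
      · rw [if_neg (by omega), h9 p hp']
      · rw [if_pos rfl]

end Merge


/-! ### Rearrangements and shuffle rounds on arrays of ranks. -/

section Arrays

/-- `a'` arises from `a` by moving entries within blocks of length `S`. -/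
def Rearr (S : ℕ) (a a' : ℕ → ℕ) : Prop :=
  ∃ π : ℕ → ℕ, Function.Injective π ∧ (∀ p, π p / S = p / S) ∧ ∀ p, a' p = a (π p)

theorem Rearr.refl (S : ℕ) (a : ℕ → ℕ) : Rearr S a a :=
  ⟨id, Function.injective_id, fun _ => rfl, fun _ => rfl⟩

theorem Rearr.trans {S : ℕ} {a a' a'' : ℕ → ℕ} (h : Rearr S a a') (h' : Rearr S a' a'') :
    Rearr S a a'' := by
  obtain ⟨π, h1, h2, h3⟩ := h
  obtain ⟨ρ, k1, k2, k3⟩ := h'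
  exact ⟨π ∘ ρ, h1.comp k1, fun p => (h2 _).trans (k2 p), fun p => (k3 p).trans (h3 _)⟩

theorem Rearr.mono {S S' : ℕ} {a a' : ℕ → ℕ} (h : Rearr S a a') (hS : S ∣ S') :
    Rearr S' a a' := by
  obtain ⟨π, h1, h2, h3⟩ := h
  obtain ⟨c, rfl⟩ := hS
  exact ⟨π, h1, fun p => by rw [← Nat.div_div_eq_div_mul, h2, Nat.div_div_eq_div_mul], h3⟩

/-- A round: split into chunks of length `h` and interleave; `sw q x y` tells whether the pair
`x, y` with number `q` is exchanged. -/
def round (h : ℕ) (sw : ℕ → ℕ → ℕ → Bool) (a : ℕ → ℕ) (p : ℕ) : ℕ :=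
  if sw (p / 2) (a (pos h (p / 2) 0)) (a (pos h (p / 2) 1)) then a (pos h (p / 2) (1 - p % 2))
  else a (pos h (p / 2) (p % 2))

/-- The source of position `2 * q + e` is one of the two partners of pair `q`. `splitIdx` recovers
`q` from it, and within a pair an exchange only flips `e`. -/
theorem round_rearr {h : ℕ} (hh : 0 < h) (sw : ℕ → ℕ → ℕ → Bool) (a : ℕ → ℕ) :
    Rearr (2 * h) a (round h sw a) := by
  refine ⟨fun p => pos h (p / 2) (if sw (p / 2) (a (pos h (p / 2) 0)) (a (pos h (p / 2) 1)) then
    1 - p % 2 else p % 2), fun p p' hp => ?_, fun p => ?_, fun p => ?_⟩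
  · dsimp only at hp
    have hlt : ∀ (c : Bool) (p : ℕ), (if c then 1 - p % 2 else p % 2) < 2 := fun c p => by
      split_ifs <;> omega
    obtain ⟨i1, j1⟩ := splitIdx_pos hh (hlt (sw (p / 2) (a (pos h (p / 2) 0))
      (a (pos h (p / 2) 1))) p) (p / 2)
    obtain ⟨i2, j2⟩ := splitIdx_pos hh (hlt (sw (p' / 2) (a (pos h (p' / 2) 0))
      (a (pos h (p' / 2) 1))) p') (p' / 2)
    have hq : p / 2 = p' / 2 := by rw [← i1, ← i2, hp]
    rw [hp, j2, hq] at j1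
    split_ifs at j1 <;> omega
  · rw [pos_div_two_mul hh (by split_ifs <;> omega), Nat.div_div_eq_div_mul]
  · rw [round]; dsimp only; split_ifs <;> rfl

theorem round_even (h : ℕ) (sw : ℕ → ℕ → ℕ → Bool) (a : ℕ → ℕ) (q : ℕ) :
    round h sw a (2 * q) = if sw q (a (pos h q 0)) (a (pos h q 1)) then a (pos h q 1)
      else a (pos h q 0) := by
  simp [round]

theorem round_odd (h : ℕ) (sw : ℕ → ℕ → ℕ → Bool) (a : ℕ → ℕ) (q : ℕ) :
    round h sw a (2 * q + 1) = if sw q (a (pos h q 0)) (a (pos h q 1)) then a (pos h q 0)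
      else a (pos h q 1) := by
  simp [round, show (2 * q + 1) / 2 = q by omega, show (2 * q + 1) % 2 = 1 by omega]

end Arrays

/-! ### Correctness of the bitonic sorter. -/

section Bitonic

/-- On `[0, L)` the predicate holds on an interval or on the complement of an interval. -/
def Bitonic (L : ℕ) (g : ℕ → Prop) : Prop :=
  ∃ i j, (∀ v < L, g v ↔ i ≤ v ∧ v < j) ∨ (∀ v < L, g v ↔ ¬ (i ≤ v ∧ v < j))

theorem Bitonic.congr {L : ℕ} {g g' : ℕ → Prop} (h : Bitonic L g) (hg : ∀ v < L, g' v ↔ g v) :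
    Bitonic L g' := by
  obtain ⟨i, j, h | h⟩ := h
  · exact ⟨i, j, .inl fun v hv => (hg v hv).trans (h v hv)⟩
  · exact ⟨i, j, .inr fun v hv => (hg v hv).trans (h v hv)⟩

theorem Bitonic.compl {L : ℕ} {g : ℕ → Prop} (h : Bitonic L g) : Bitonic L fun v => ¬ g v := by
  obtain ⟨i, j, h | h⟩ := h
  · exact ⟨i, j, .inr fun v hv => not_congr (h v hv)⟩
  · exact ⟨i, j, .inl fun v hv => by dsimp only; rw [h v hv, not_not]⟩

/-- Fold the interval onto its first half. Conjunction keeps the overlap and disjunction the union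
of the two pieces, each cyclically an interval. If the overlap is nonempty, the interval is longer
than `M` and its fold covers everything: this is the last claim. -/
theorem halfClean_interval {M i j : ℕ} {g : ℕ → Prop} (h : ∀ v < 2 * M, g v ↔ i ≤ v ∧ v < j) :
    Bitonic M (fun v => g v ∧ g (v + M)) ∧ Bitonic M (fun v => g v ∨ g (v + M)) ∧
      ∀ v < M, ∀ v' < M, g v ∧ g (v + M) → g v' ∨ g (v' + M) := by
  refine ⟨⟨i, j - M, .inl fun v hv => ?_⟩, ?_, fun v hv v' hv' => ?_⟩
  · dsimp only; rw [h v (by omega), h (v + M) (by omega)]; omega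
  · by_cases h1 : j ≤ M
    · exact ⟨i, j, .inl fun v hv => by dsimp only; rw [h v (by omega), h (v + M) (by omega)]; omega⟩
    · by_cases h2 : M ≤ i
      · exact ⟨i - M, j - M, .inl fun v hv => by
          dsimp only; rw [h v (by omega), h (v + M) (by omega)]; omega⟩
      · exact ⟨j - M, i, .inr fun v hv => by
          dsimp only; rw [h v (by omega), h (v + M) (by omega)]; omega⟩
  · rw [h v (by omega), h (v + M) (by omega), h v' (by omega), h (v' + M) (by omega)]; omega

/-- The complementary case follows by De Morgan, which swaps conjunction and disjunction and
contraposes the comparison. -/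
theorem Bitonic.halfClean {M : ℕ} {g : ℕ → Prop} (h : Bitonic (2 * M) g) :
    Bitonic M (fun v => g v ∧ g (v + M)) ∧ Bitonic M (fun v => g v ∨ g (v + M)) ∧
      ∀ v < M, ∀ v' < M, g v ∧ g (v + M) → g v' ∨ g (v' + M) := by
  obtain ⟨i, j, h | h⟩ := h
  · exact halfClean_interval h
  · obtain ⟨h1, h2, h3⟩ := halfClean_interval (M := M) (g := fun v => ¬ g v) (i := i) (j := j)
      fun v hv => by rw [h v hv, not_not]
    refine ⟨h2.compl.congr fun v _ => by tauto, h1.compl.congr fun v _ => by tauto,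
      fun v hv v' hv' => ?_⟩
    have := h3 v' hv' v hv
    tauto

theorem exists_threshold {M : ℕ} {g : ℕ → Prop} (h : ∀ v v', v ≤ v' → v' < M → g v → g v') :
    ∃ i ≤ M, ∀ v < M, g v ↔ i ≤ v := by
  classical
  by_cases hg : ∃ v, v < M ∧ g v
  · refine ⟨Nat.find hg, (Nat.find_spec hg).1.le, fun v hv => ⟨fun h1 => Nat.find_min' hg ⟨hv, h1⟩,
      fun h1 => h _ v h1 hv (Nat.find_spec hg).2⟩⟩
  · exact ⟨M, le_rfl, fun v hv => ⟨fun h1 => absurd ⟨v, hv, h1⟩ hg, fun h1 => by omega⟩⟩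

/-- An ascending half followed by a descending half. -/
theorem bitonic_of_halves {M : ℕ} {g : ℕ → Prop} (h1 : ∀ v v', v ≤ v' → v' < M → g v → g v')
    (h2 : ∀ v v', v ≤ v' → v' < M → g (M + v') → g (M + v)) : Bitonic (2 * M) g := by
  obtain ⟨i, hi, hi'⟩ := exists_threshold h1
  obtain ⟨j, hj, hj'⟩ := exists_threshold (M := M) (g := fun v => ¬ g (M + v))
    fun v v' hv hv' h h' => h (h2 v v' hv hv' h')
  refine ⟨i, M + j, .inl fun v hv => ?_⟩
  by_cases hvM : v < M
  · rw [hi' v hvM]; omega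
  · have := hj' (v - M) (by omega)
    rw [show M + (v - M) = v by omega] at this
    constructor
    · intro hg
      by_contra hc
      exact this.mpr (by omega) hg
    · intro hg
      by_contra hc
      exact absurd (this.mp hc) (by omega)

/-- After `t` rounds of the bitonic merge of the block `[B, B + 2 ^ t * 2 ^ r)`, the subsequences
of entries congruent modulo `2 ^ t` are bitonic and ordered by `le`. -/
def MergeInv (t r B : ℕ) (desc : Prop) (G : ℕ → Prop) : Prop :=
  (∀ u < 2 ^ t, Bitonic (2 ^ r) fun v => G (B + (v * 2 ^ t + u))) ∧
  ∀ u u', u < u' → u' < 2 ^ t → ∀ v < 2 ^ r, ∀ v' < 2 ^ r,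
    (¬ desc → G (B + (v * 2 ^ t + u)) → G (B + (v' * 2 ^ t + u'))) ∧
    (desc → G (B + (v' * 2 ^ t + u')) → G (B + (v * 2 ^ t + u)))

/-- The pairs with numbers in `[C * h, C * h + h)` match the two halves of block `C`, so blocks of
length `2 * h` never interact in a round. -/
theorem pos_block {h C w e : ℕ} (hw : w < h) : pos h (C * h + w) e = C * (2 * h) + (e * h + w) := by
  have h0 : 0 < h := by omega
  rw [pos, mul_comm C h, Nat.mul_add_div h0, Nat.div_eq_of_lt hw, Nat.mul_add_mod,
    Nat.mod_eq_of_lt hw]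
  ring

/-- Positions at distance `h` lie in the same class `u` modulo `2 ^ t`, at places `v` and `v + 2 ^
r` of it. Interleaving puts their minimum and maximum into the classes `2 * u` and `2 * u + 1`
modulo `2 ^ (t + 1)`. So a round half-cleans every class: bitonicity and the order of sibling
classes come from `Bitonic.halfClean`, the order of other classes is inherited. -/
theorem MergeInv.step {t r C h : ℕ} {desc : Prop} {G G' : ℕ → Prop} (hh : h = 2 ^ t * 2 ^ r)
    (hG : MergeInv t (r + 1) (C * (2 * h)) desc G)
    (hasc : ¬ desc → ∀ w < h, (G' (2 * (C * h + w)) ↔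
        G (pos h (C * h + w) 0) ∧ G (pos h (C * h + w) 1)) ∧
      (G' (2 * (C * h + w) + 1) ↔ G (pos h (C * h + w) 0) ∨ G (pos h (C * h + w) 1)))
    (hdesc : desc → ∀ w < h, (G' (2 * (C * h + w)) ↔
        G (pos h (C * h + w) 0) ∨ G (pos h (C * h + w) 1)) ∧
      (G' (2 * (C * h + w) + 1) ↔ G (pos h (C * h + w) 0) ∧ G (pos h (C * h + w) 1))) :
    MergeInv (t + 1) r (C * (2 * h)) desc G' := by
  obtain ⟨hb, ho⟩ := hG
  have hw : ∀ u < 2 ^ t, ∀ v < 2 ^ r, v * 2 ^ t + u < h := fun u hu v hv => by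
    rw [hh]
    calc v * 2 ^ t + u < v * 2 ^ t + 2 ^ t := by omega
      _ = (v + 1) * 2 ^ t := by ring
      _ ≤ 2 ^ r * 2 ^ t := Nat.mul_le_mul_right _ hv
      _ = _ := mul_comm _ _
  -- the two partners and the two results of a comparison
  have e0 : ∀ u < 2 ^ t, ∀ v < 2 ^ r, pos h (C * h + (v * 2 ^ t + u)) 0 =
      C * (2 * h) + (v * 2 ^ t + u) := fun u hu v hv => by rw [pos_block (hw u hu v hv)]; ring
  have e1 : ∀ u < 2 ^ t, ∀ v < 2 ^ r, pos h (C * h + (v * 2 ^ t + u)) 1 =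
      C * (2 * h) + ((v + 2 ^ r) * 2 ^ t + u) := fun u hu v hv => by
    rw [pos_block (hw u hu v hv), one_mul]; nth_rewrite 2 [hh]; ring
  have e2 : ∀ u v, C * (2 * h) + (v * 2 ^ (t + 1) + 2 * u) = 2 * (C * h + (v * 2 ^ t + u)) :=
    fun u v => by ring
  have e3 : ∀ u v, C * (2 * h) + (v * 2 ^ (t + 1) + (2 * u + 1)) =
      2 * (C * h + (v * 2 ^ t + u)) + 1 := fun u v => by ring
  set g : ℕ → ℕ → Prop := fun u v => G (C * (2 * h) + (v * 2 ^ t + u)) with hg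
  -- The underscore stands for the half-cleaner's three conclusions, applied separately to each
  -- residue class.
  have hhalf : ∀ u < 2 ^ t, _ := fun u hu => Bitonic.halfClean (M := 2 ^ r) (g := g u)
    (by have := hb u hu; rwa [pow_succ, mul_comm] at this)
  have hr2 : (2 : ℕ) ^ (r + 1) = 2 ^ r + 2 ^ r := by ring
  have ho' : ∀ u u', u < u' → u' < 2 ^ t → ∀ v < 2 ^ r + 2 ^ r, ∀ v' < 2 ^ r + 2 ^ r,
      (¬ desc → g u v → g u' v') ∧ (desc → g u' v' → g u v) := by
    rw [← hr2]; exact ho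
  have ht2 : (2 : ℕ) ^ (t + 1) = 2 * 2 ^ t := by ring
  by_cases hd : desc
  · have f0 : ∀ u < 2 ^ t, ∀ v < 2 ^ r, (G' (C * (2 * h) + (v * 2 ^ (t + 1) + 2 * u)) ↔
        g u v ∨ g u (v + 2 ^ r)) := fun u hu v hv => by
      rw [e2, (hdesc hd _ (hw u hu v hv)).1, e0 u hu v hv, e1 u hu v hv]
    have f1 : ∀ u < 2 ^ t, ∀ v < 2 ^ r, (G' (C * (2 * h) + (v * 2 ^ (t + 1) + (2 * u + 1))) ↔
        g u v ∧ g u (v + 2 ^ r)) := fun u hu v hv => by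
      rw [e3, (hdesc hd _ (hw u hu v hv)).2, e0 u hu v hv, e1 u hu v hv]
    constructor
    · intro U hU
      obtain ⟨u, rfl | rfl⟩ : ∃ u, U = 2 * u ∨ U = 2 * u + 1 := ⟨U / 2, by omega⟩
      · exact (hhalf u (by omega)).2.1.congr fun v hv => f0 u (by omega) v hv
      · exact (hhalf u (by omega)).1.congr fun v hv => f1 u (by omega) v hv
    · intro U U' hUU hU' v hv v' hv'
      refine ⟨fun hn => absurd hd hn, fun _ => ?_⟩
      have o := fun u u' (h1 : u < u') (h2 : u' < 2 ^ t) a (ha : a < 2 ^ r + 2 ^ r) a'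
        (ha' : a' < 2 ^ r + 2 ^ r) => (ho' u u' h1 h2 a ha a' ha').2 hd
      obtain ⟨u, rfl | rfl⟩ : ∃ u, U = 2 * u ∨ U = 2 * u + 1 := ⟨U / 2, by omega⟩ <;>
        obtain ⟨u', rfl | rfl⟩ : ∃ u, U' = 2 * u ∨ U' = 2 * u + 1 := ⟨U' / 2, by omega⟩
      · rw [f0 u (by omega) v hv, f0 u' (by omega) v' hv']
        rintro (h1 | h1)
        · exact .inl (o u u' (by omega) (by omega) _ (by omega) _ (by omega) h1)
        · exact .inl (o u u' (by omega) (by omega) _ (by omega) _ (by omega) h1)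
      · rw [f0 u (by omega) v hv, f1 u' (by omega) v' hv']
        rcases Nat.lt_or_ge u u' with h2 | h2
        · rintro ⟨h1, -⟩
          exact .inl (o u u' (by omega) (by omega) _ (by omega) _ (by omega) h1)
        · obtain rfl : u = u' := by omega
          exact (hhalf u (by omega)).2.2 v' hv' v hv
      · rw [f1 u (by omega) v hv, f0 u' (by omega) v' hv']
        rintro (h1 | h1)
        · exact ⟨o u u' (by omega) (by omega) _ (by omega) _ (by omega) h1,
            o u u' (by omega) (by omega) _ (by omega) _ (by omega) h1⟩
        · exact ⟨o u u' (by omega) (by omega) _ (by omega) _ (by omega) h1,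
            o u u' (by omega) (by omega) _ (by omega) _ (by omega) h1⟩
      · rw [f1 u (by omega) v hv, f1 u' (by omega) v' hv']
        rintro ⟨h1, -⟩
        exact ⟨o u u' (by omega) (by omega) _ (by omega) _ (by omega) h1,
            o u u' (by omega) (by omega) _ (by omega) _ (by omega) h1⟩
  · have f0 : ∀ u < 2 ^ t, ∀ v < 2 ^ r, (G' (C * (2 * h) + (v * 2 ^ (t + 1) + 2 * u)) ↔
        g u v ∧ g u (v + 2 ^ r)) := fun u hu v hv => by
      rw [e2, (hasc hd _ (hw u hu v hv)).1, e0 u hu v hv, e1 u hu v hv]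
    have f1 : ∀ u < 2 ^ t, ∀ v < 2 ^ r, (G' (C * (2 * h) + (v * 2 ^ (t + 1) + (2 * u + 1))) ↔
        g u v ∨ g u (v + 2 ^ r)) := fun u hu v hv => by
      rw [e3, (hasc hd _ (hw u hu v hv)).2, e0 u hu v hv, e1 u hu v hv]
    constructor
    · intro U hU
      obtain ⟨u, rfl | rfl⟩ : ∃ u, U = 2 * u ∨ U = 2 * u + 1 := ⟨U / 2, by omega⟩
      · exact (hhalf u (by omega)).1.congr fun v hv => f0 u (by omega) v hv
      · exact (hhalf u (by omega)).2.1.congr fun v hv => f1 u (by omega) v hv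
    · intro U U' hUU hU' v hv v' hv'
      refine ⟨fun _ => ?_, fun hn => absurd hn hd⟩
      have o := fun u u' (h1 : u < u') (h2 : u' < 2 ^ t) a (ha : a < 2 ^ r + 2 ^ r) a'
        (ha' : a' < 2 ^ r + 2 ^ r) => (ho' u u' h1 h2 a ha a' ha').1 hd
      obtain ⟨u, rfl | rfl⟩ : ∃ u, U = 2 * u ∨ U = 2 * u + 1 := ⟨U / 2, by omega⟩ <;>
        obtain ⟨u', rfl | rfl⟩ : ∃ u, U' = 2 * u ∨ U' = 2 * u + 1 := ⟨U' / 2, by omega⟩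
      · rw [f0 u (by omega) v hv, f0 u' (by omega) v' hv']
        rintro ⟨h1, -⟩
        exact ⟨o u u' (by omega) (by omega) _ (by omega) _ (by omega) h1,
          o u u' (by omega) (by omega) _ (by omega) _ (by omega) h1⟩
      · rw [f0 u (by omega) v hv, f1 u' (by omega) v' hv']
        rcases Nat.lt_or_ge u u' with h2 | h2
        · rintro ⟨h1, -⟩
          exact .inl (o u u' (by omega) (by omega) _ (by omega) _ (by omega) h1)
        · obtain rfl : u = u' := by omega
          exact (hhalf u (by omega)).2.2 v hv v' hv'
      · rw [f1 u (by omega) v hv, f0 u' (by omega) v' hv']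
        rintro (h1 | h1)
        · exact ⟨o u u' (by omega) (by omega) _ (by omega) _ (by omega) h1,
            o u u' (by omega) (by omega) _ (by omega) _ (by omega) h1⟩
        · exact ⟨o u u' (by omega) (by omega) _ (by omega) _ (by omega) h1,
            o u u' (by omega) (by omega) _ (by omega) _ (by omega) h1⟩
      · rw [f1 u (by omega) v hv, f1 u' (by omega) v' hv']
        rintro (h1 | h1)
        · exact .inl (o u u' (by omega) (by omega) _ (by omega) _ (by omega) h1)
        · exact .inl (o u u' (by omega) (by omega) _ (by omega) _ (by omega) h1)

variable {α : Type*} [LinearOrder α]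

/-- Exchange rule of the bitonic sorter for blocks of length `2 * H` in the rounds with chunk
length `h`: keys increase, except in every other block of the stages before the last. -/
def bitonicSwap (κ : ℕ → α) (h H : ℕ) (q x y : ℕ) : Bool :=
  if h < H ∧ q / h % 2 = 1 then decide (κ x < κ y) else decide (κ y < κ x)

/-- The stages with chunk lengths `1, 2, ..., 2 ^ (k - 1)` of the bitonic sorter. -/
def bitonicSort (κ : ℕ → α) (H : ℕ) : ℕ → (ℕ → ℕ) → ℕ → ℕ
  | 0, a => a
  | k + 1, a => (round (2 ^ k) (bitonicSwap κ (2 ^ k) H))^[k + 1] (bitonicSort κ H k a)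

theorem iterate_round_rearr {h : ℕ} (hh : 0 < h) (sw : ℕ → ℕ → ℕ → Bool) (a : ℕ → ℕ) (t : ℕ) :
    Rearr (2 * h) a ((round h sw)^[t] a) := by
  induction t with
  | zero => exact .refl _ _
  | succ t ih => rw [Function.iterate_succ_apply']; exact ih.trans (round_rearr hh sw _)

theorem bitonicSort_rearr (κ : ℕ → α) (H k : ℕ) (a : ℕ → ℕ) :
    Rearr (2 ^ k) a (bitonicSort κ H k a) := by
  induction k with
  | zero => exact .refl _ _
  | succ k ih =>
    refine (ih.mono ⟨2, by ring⟩).trans ?_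
    rw [pow_succ, mul_comm]
    exact iterate_round_rearr (by positivity) _ _ _

/-- The 0-1 principle: being at least `t` turns minimum into conjunction and maximum into
disjunction, so the sorter may be analysed on one predicate for each threshold. -/
theorem bitonicSwap_threshold (κ : ℕ → α) (h H q : ℕ) (a : ℕ → ℕ) (t : α) :
    (¬ (h < H ∧ q / h % 2 = 1) →
      (t ≤ κ (round h (bitonicSwap κ h H) a (2 * q)) ↔
        t ≤ κ (a (pos h q 0)) ∧ t ≤ κ (a (pos h q 1))) ∧
      (t ≤ κ (round h (bitonicSwap κ h H) a (2 * q + 1)) ↔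
        t ≤ κ (a (pos h q 0)) ∨ t ≤ κ (a (pos h q 1)))) ∧
    ((h < H ∧ q / h % 2 = 1) →
      (t ≤ κ (round h (bitonicSwap κ h H) a (2 * q)) ↔
        t ≤ κ (a (pos h q 0)) ∨ t ≤ κ (a (pos h q 1))) ∧
      (t ≤ κ (round h (bitonicSwap κ h H) a (2 * q + 1)) ↔
        t ≤ κ (a (pos h q 0)) ∧ t ≤ κ (a (pos h q 1)))) := by
  rw [round_even, round_odd]
  set x := a (pos h q 0)
  set y := a (pos h q 1)
  refine ⟨fun hd => ?_, fun hd => ?_⟩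
  · simp only [bitonicSwap, hd, if_false, decide_eq_true_eq]
    split_ifs with hxy
    · exact ⟨⟨fun h1 => ⟨h1.trans hxy.le, h1⟩, fun h1 => h1.2⟩,
        ⟨fun h1 => .inl h1, fun h1 => h1.elim id fun h2 => h2.trans hxy.le⟩⟩
    · have hxy := not_lt.mp hxy
      exact ⟨⟨fun h1 => ⟨h1, h1.trans hxy⟩, fun h1 => h1.1⟩,
        ⟨fun h1 => .inr h1, fun h1 => h1.elim (fun h2 => h2.trans hxy) id⟩⟩
  · simp only [bitonicSwap, hd, and_self, if_true, decide_eq_true_eq]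
    split_ifs with hxy
    · exact ⟨⟨fun h1 => .inr h1, fun h1 => h1.elim (fun h2 => h2.trans hxy.le) id⟩,
        ⟨fun h1 => ⟨h1, h1.trans hxy.le⟩, fun h1 => h1.1⟩⟩
    · have hxy := not_lt.mp hxy
      exact ⟨⟨fun h1 => .inl h1, fun h1 => h1.elim id fun h2 => h2.trans hxy⟩,
        ⟨fun h1 => ⟨h1.trans hxy, h1⟩, fun h1 => h1.2⟩⟩

/-- All rounds of a stage use the same chunk length; the shuffles themselves bring the right
partners together. The direction is constant along a block because every pair of block `C` has
quotient `C`. -/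
theorem mergeInv_iterate (κ : ℕ → α) (H k C : ℕ) (a : ℕ → ℕ) (s : α)
    (h0 : Bitonic (2 ^ (k + 1)) fun v => s ≤ κ (a (C * 2 ^ (k + 1) + v))) (t : ℕ)
    (ht : t ≤ k + 1) : MergeInv t (k + 1 - t) (C * (2 * 2 ^ k)) (2 ^ k < H ∧ C % 2 = 1)
      fun p => s ≤ κ ((round (2 ^ k) (bitonicSwap κ (2 ^ k) H))^[t] a p) := by
  induction t with
  | zero =>
    refine ⟨fun u hu => ?_, fun u u' hu hu' => by omega⟩
    obtain rfl : u = 0 := by simpa using hu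
    simpa [pow_succ, mul_comm, mul_assoc, mul_left_comm] using h0
  | succ t ih =>
    have hk : (2 : ℕ) ^ k = 2 ^ t * 2 ^ (k - t) := by rw [← pow_add]; congr 1; omega
    have ih' := ih (by omega)
    rw [show k + 1 - t = k - t + 1 by omega] at ih'
    rw [show k + 1 - (t + 1) = k - t by omega]
    have hC : ∀ w < 2 ^ k, (C * 2 ^ k + w) / 2 ^ k % 2 = C % 2 := fun w hw => by
      rw [mul_comm, Nat.mul_add_div (by positivity), Nat.div_eq_of_lt hw, add_zero]
    refine ih'.step hk (fun hd w hw => ?_) (fun hd w hw => ?_)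
    · simp only [Function.iterate_succ_apply']
      exact (bitonicSwap_threshold κ (2 ^ k) H (C * 2 ^ k + w) _ s).1 (by rwa [hC w hw])
    · simp only [Function.iterate_succ_apply']
      exact (bitonicSwap_threshold κ (2 ^ k) H (C * 2 ^ k + w) _ s).2 (by rwa [hC w hw])

/-- By induction the blocks `2 * C` and `2 * C + 1` are sorted in opposite directions, so their
union is bitonic. In the last stage, where `2 ^ k = 2 * H`, no block is descending. -/
theorem bitonicSort_threshold (κ : ℕ → α) (H k : ℕ) (hk : 2 ^ k ≤ 2 * H) (a : ℕ → ℕ) (s : α)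
    (C u u' : ℕ) (hu : u ≤ u') (hu' : u' < 2 ^ k) :
    (¬ (2 ^ k < 2 * H ∧ C % 2 = 1) → s ≤ κ (bitonicSort κ H k a (C * 2 ^ k + u)) →
      s ≤ κ (bitonicSort κ H k a (C * 2 ^ k + u'))) ∧
    (2 ^ k < 2 * H ∧ C % 2 = 1 → s ≤ κ (bitonicSort κ H k a (C * 2 ^ k + u')) →
      s ≤ κ (bitonicSort κ H k a (C * 2 ^ k + u))) := by
  induction k generalizing C u u' with
  | zero =>
    obtain rfl : u = u' := by simp at hu'; omega
    exact ⟨fun _ => id, fun _ => id⟩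
  | succ k ih =>
    rcases hu.eq_or_lt with rfl | hlt
    · exact ⟨fun _ => id, fun _ => id⟩
    have hpow : (2 : ℕ) ^ (k + 1) = 2 * 2 ^ k := by ring
    have hpos : 0 < 2 ^ k := by positivity
    have hbit : Bitonic (2 ^ (k + 1)) fun v =>
        s ≤ κ (bitonicSort κ H k a (C * 2 ^ (k + 1) + v)) := by
      rw [hpow]
      refine bitonic_of_halves (fun v v' h1 h2 => ?_) (fun v v' h1 h2 => ?_)
      · have := (ih (by omega) (2 * C) v v' h1 h2).1 (by omega)
        rwa [show 2 * C * 2 ^ k = C * (2 * 2 ^ k) by ring] at this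
      · have := (ih (by omega) (2 * C + 1) v v' h1 h2).2 (by omega)
        rwa [show (2 * C + 1) * 2 ^ k = C * (2 * 2 ^ k) + 2 ^ k by ring, add_assoc, add_assoc]
          at this
    -- After `k + 1` rounds every residue class is a single entry, so the order between classes is
    -- the order of the block.
    have hm := (mergeInv_iterate κ H k C _ s hbit (k + 1) le_rfl).2 u u' hlt hu' 0
      (by positivity) 0 (by positivity)
    simp only [zero_mul, zero_add] at hm
    rw [hpow]
    constructor
    · intro hd
      exact hm.1 (by omega)
    · intro hd
      exact hm.2 (by omega)

/-- The bitonic sorter sorts every block. -/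
theorem bitonicSort_sorted (κ : ℕ → α) (k : ℕ) (a : ℕ → ℕ) (C u u' : ℕ) (hu : u ≤ u')
    (hu' : u' < 2 ^ (k + 1)) :
    κ (bitonicSort κ (2 ^ k) (k + 1) a (C * 2 ^ (k + 1) + u)) ≤
      κ (bitonicSort κ (2 ^ k) (k + 1) a (C * 2 ^ (k + 1) + u')) :=
  (bitonicSort_threshold κ (2 ^ k) (k + 1) (by rw [pow_succ, mul_comm]) a _ C u u' hu hu').1
    (by rw [pow_succ]; omega) le_rfl

end Bitonic


/-! ### Merging adjacent runs of an array of ranks. -/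

section MergeArray

variable {h : ℕ} {L : ℕ → ℕ → Prop} [DecidableRel L]

/-- Neither cursor passes the end of its current run, and the cursors sum to `p`. Hence when `p`
reaches a multiple of `2 * h` both stand exactly at the end of their runs, and the next pair of runs
starts cleanly. -/
theorem mergeState_bounds (hh : 0 < h) (p : ℕ) :
    p / (2 * h) * h ≤ (mergeState h L p).1 ∧ (mergeState h L p).1 ≤ (p / (2 * h) + 1) * h ∧
    p / (2 * h) * h ≤ (mergeState h L p).2 ∧ (mergeState h L p).2 ≤ (p / (2 * h) + 1) * h := by
  induction p with
  | zero => simp [mergeState]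
  | succ p ih =>
    obtain ⟨h1, h2, h3, h4⟩ := ih
    have hadd := mergeState_add h L p
    have hadd' := mergeState_add h L (p + 1)
    have hc := Nat.div_add_mod p (2 * h)
    have hr := Nat.mod_lt p (show 0 < 2 * h by omega)
    have hc' := Nat.div_add_mod (p + 1) (2 * h)
    have hr' := Nat.mod_lt (p + 1) (show 0 < 2 * h by omega)
    have hstep : (mergeState h L (p + 1)).1 ≤ (p / (2 * h) + 1) * h ∧
        (mergeState h L (p + 1)).2 ≤ (p / (2 * h) + 1) * h ∧
        p / (2 * h) * h ≤ (mergeState h L (p + 1)).1 ∧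
        p / (2 * h) * h ≤ (mergeState h L (p + 1)).2 := by
      rw [mergeState]
      split_ifs with hT
      · have := hT.1
        exact ⟨this, h4, by dsimp only; omega, h3⟩
      · refine ⟨h2, ?_, h1, by dsimp only; omega⟩
        -- If the first run is exhausted, the sum of the cursors shows that the second is not.
        rw [TakeFst, not_and_or, not_not] at hT
        rcases hT with hT | hT
        · dsimp only
          set c := p / (2 * h)
          have e1 : 2 * h * c = 2 * (c * h) := by ring
          have e2 : (c + 1) * h = c * h + h := by ring
          omega
        · exact hT.1
    rcases Nat.lt_or_ge ((p + 1) % (2 * h)) 1 with h0 | h0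
    · have hq : (p + 1) / (2 * h) = p / (2 * h) + 1 := by
        rw [Nat.succ_div_of_dvd (Nat.dvd_of_mod_eq_zero (by omega))]
      rw [hq] at hc' ⊢
      set c := p / (2 * h)
      have e1 : 2 * h * (c + 1) = 2 * ((c + 1) * h) := by ring
      have e2 : (c + 1 + 1) * h = (c + 1) * h + h := by ring
      omega
    · have hq : (p + 1) / (2 * h) = p / (2 * h) := by
        rw [Nat.succ_div_of_not_dvd]
        intro hd
        rw [Nat.mod_eq_zero_of_dvd hd] at h0
        omega
      rw [hq]
      exact ⟨hstep.2.2.1, hstep.1, hstep.2.2.2, hstep.2.1⟩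

theorem mergeState_snd_lt (hh : 0 < h) {p : ℕ} (hT : ¬ TakeFst h L p (mergeState h L p)) :
    (mergeState h L p).2 < (p / (2 * h) + 1) * h := by
  rw [TakeFst, not_and_or, not_not] at hT
  rcases hT with hT | hT
  · have hadd := mergeState_add h L p
    have hc := Nat.div_add_mod p (2 * h)
    have hr := Nat.mod_lt p (show 0 < 2 * h by omega)
    have := mergeState_bounds (L := L) hh p
    set c := p / (2 * h)
    have e1 : 2 * h * c = 2 * (c * h) := by ring
    have e2 : (c + 1) * h = c * h + h := by ring
    omega
  · exact hT.1

theorem mergeState_mono {p p' : ℕ} (hp : p ≤ p') :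
    (mergeState h L p).1 ≤ (mergeState h L p').1 ∧
      (mergeState h L p).2 ≤ (mergeState h L p').2 := by
  induction hp with
  | refl => exact ⟨le_rfl, le_rfl⟩
  | step _ ih =>
    rw [mergeState]
    split_ifs <;> constructor <;> dsimp only <;> omega

/-- A comparison counts only while both cursors are inside their runs. So the order of records on
disk may be replaced by the order of ranks, which agrees with it only below `M`; read-ahead beyond
the data has no influence. -/
theorem mergeState_congr {L' : ℕ → ℕ → Prop} [DecidableRel L'] {M N : ℕ}
    (hN : ∀ p < N, (p / (2 * h) + 1) * h ≤ M) (hL : ∀ i < M, ∀ j < M, L i j ↔ L' i j) :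
    (∀ p ≤ N, mergeState h L p = mergeState h L' p) ∧
    ∀ p < N, (TakeFst h L p (mergeState h L p) ↔ TakeFst h L' p (mergeState h L' p)) := by
  have key : ∀ p < N, ∀ s, TakeFst h L p s ↔ TakeFst h L' p s := fun p hp s => by
    have hE := hN p hp
    rw [TakeFst, TakeFst]
    constructor
    · rintro ⟨h1, h2⟩
      exact ⟨h1, fun ⟨h3, h4⟩ => h2 ⟨h3, (hL _ (by omega) _ (by omega)).mpr h4⟩⟩
    · rintro ⟨h1, h2⟩
      exact ⟨h1, fun ⟨h3, h4⟩ => h2 ⟨h3, (hL _ (by omega) _ (by omega)).mp h4⟩⟩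
  have hst : ∀ p ≤ N, mergeState h L p = mergeState h L' p := fun p hp => by
    induction p with
    | zero => rfl
    | succ p ih => simp only [mergeState, ih (by omega), key p (by omega)]
  exact ⟨hst, fun p hp => by rw [hst p hp.le, key p hp]⟩

/-- Comparison made when merging adjacent runs of `a`. -/
def runLt (h : ℕ) (a : ℕ → ℕ) (i j : ℕ) : Prop := a (pos h j 1) < a (pos h i 0)

instance (h : ℕ) (a : ℕ → ℕ) : DecidableRel (runLt h a) := fun i j => by
  unfold runLt; infer_instance

/-- The result of merging adjacent runs of length `h`. -/
def mergeArr (h : ℕ) (a : ℕ → ℕ) (p : ℕ) : ℕ :=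
  if TakeFst h (runLt h a) p (mergeState h (runLt h a) p) then
    a (pos h (mergeState h (runLt h a) p).1 0) else a (pos h (mergeState h (runLt h a) p).2 1)

theorem div_eq_of_bounds {h c i : ℕ} (h1 : c * h ≤ i) (h2 : i < (c + 1) * h) : i / h = c :=
  Nat.div_eq_of_lt_le h1 h2

/-- Each step advances the cursor that it uses, so no source is taken twice; sources on different
disks differ in chunk parity. -/
theorem mergeArr_rearr (hh : 0 < h) (a : ℕ → ℕ) : Rearr (2 * h) a (mergeArr h a) := by
  set st := mergeState h (runLt h a) with hst
  set T : ℕ → Prop := fun p => TakeFst h (runLt h a) p (st p) with hT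
  have hb := fun p => mergeState_bounds (L := runLt h a) hh p
  refine ⟨fun p => if T p then pos h (st p).1 0 else pos h (st p).2 1, ?_, fun p => ?_,
    fun p => ?_⟩
  · have key : ∀ p p', p < p' → (if T p then pos h (st p).1 0 else pos h (st p).2 1) ≠
        (if T p' then pos h (st p').1 0 else pos h (st p').2 1) := by
      intro p p' hlt heq
      obtain ⟨m1, m2⟩ := mergeState_mono (h := h) (L := runLt h a) (Nat.succ_le_of_lt hlt)
      rw [Nat.succ_eq_add_one, mergeState] at m1 m2
      by_cases c1 : T p <;> by_cases c2 : T p'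
      · rw [if_pos c1, if_pos c2] at heq
        rw [if_pos c1] at m1
        have := (splitIdx_pos hh two_pos (st p).1).1
        rw [heq, (splitIdx_pos hh two_pos (st p').1).1] at this
        exact absurd (this ▸ m1) (Nat.not_succ_le_self _)
      · rw [if_pos c1, if_neg c2] at heq
        have := (splitIdx_pos hh two_pos (st p).1).2
        rw [heq, (splitIdx_pos hh one_lt_two (st p').2).2] at this
        omega
      · rw [if_neg c1, if_pos c2] at heq
        have := (splitIdx_pos hh one_lt_two (st p).2).2
        rw [heq, (splitIdx_pos hh two_pos (st p').1).2] at this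
        omega
      · rw [if_neg c1, if_neg c2] at heq
        rw [if_neg c1] at m2
        have := (splitIdx_pos hh one_lt_two (st p).2).1
        rw [heq, (splitIdx_pos hh one_lt_two (st p').2).1] at this
        exact absurd (this ▸ m2) (Nat.not_succ_le_self _)
    intro p p' heq
    rcases lt_trichotomy p p' with hlt | rfl | hlt
    · exact absurd heq (key p p' hlt)
    · rfl
    · exact absurd heq.symm (key p' p hlt)
  · dsimp only
    split_ifs with c
    · rw [pos_div_two_mul hh two_pos, div_eq_of_bounds (hb p).1 c.1]
    · rw [pos_div_two_mul hh one_lt_two, div_eq_of_bounds (hb p).2.2.1 (mergeState_snd_lt hh c)]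
  · rw [mergeArr]
    dsimp only
    split_ifs <;> rfl

/-- Every block of length `S` is sorted. -/
def BlocksSorted (S : ℕ) (a : ℕ → ℕ) : Prop :=
  ∀ c x y, x ≤ y → y < S → a (c * S + x) ≤ a (c * S + y)

/-- Within a block it suffices to compare consecutive outputs. Each output is at most both heads
that remain after it: one by sortedness of its run, the other by the comparison just made. -/
theorem mergeArr_sorted (hh : 0 < h) {a : ℕ → ℕ} (ha : BlocksSorted h a) :
    BlocksSorted (2 * h) (mergeArr h a) := by
  set st := mergeState h (runLt h a) with hst
  have hb := fun p => mergeState_bounds (L := runLt h a) hh p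
  have hsrt : ∀ c e i i', c * h ≤ i → i ≤ i' → i' < (c + 1) * h →
      a (pos h i e) ≤ a (pos h i' e) := by
    intro c e i i' h1 h2 h3
    have e2 : (c + 1) * h = c * h + h := by ring
    obtain ⟨x, rfl⟩ := Nat.exists_eq_add_of_le h1
    obtain ⟨y, rfl⟩ := Nat.exists_eq_add_of_le (h1.trans h2)
    rw [pos_block (by omega), pos_block (by omega)]
    have := ha (2 * c + e) x y (by omega) (by omega)
    rwa [show (2 * c + e) * h + x = c * (2 * h) + (e * h + x) by ring,
      show (2 * c + e) * h + y = c * (2 * h) + (e * h + y) by ring] at this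
  have hcons : ∀ p, (p + 1) / (2 * h) = p / (2 * h) → mergeArr h a p ≤ mergeArr h a (p + 1) := by
    intro p hp
    set c := p / (2 * h) with hc
    obtain ⟨b1, b2, b3, b4⟩ := hb p
    obtain ⟨d1, d2, d3, d4⟩ := hb (p + 1)
    have hnext : ∀ i' j', (mergeState h (runLt h a) (p + 1)).1 = i' →
        (mergeState h (runLt h a) (p + 1)).2 = j' →
        (i' < (c + 1) * h → mergeArr h a p ≤ a (pos h i' 0)) ∧
        (j' < (c + 1) * h → mergeArr h a p ≤ a (pos h j' 1)) := by
      intro i' j' hi hj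
      rw [mergeState] at hi hj
      rw [mergeArr]
      by_cases hT : TakeFst h (runLt h a) p (mergeState h (runLt h a) p)
      · rw [if_pos hT] at hi hj ⊢
        dsimp only at hi hj
        refine ⟨fun h1 => hsrt c 0 _ _ b1 (by omega) h1, fun h1 => ?_⟩
        have hle : ¬ runLt h a (mergeState h (runLt h a) p).1 (mergeState h (runLt h a) p).2 :=
          fun hl => hT.2 ⟨lt_of_eq_of_lt hj h1, hl⟩
        rw [runLt, not_lt] at hle
        rw [← hj]
        exact hle
      · rw [if_neg hT] at hi hj ⊢
        dsimp only at hi hj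
        refine ⟨fun h1 => ?_, fun h1 => hsrt c 1 _ _ b3 (by omega) h1⟩
        rw [TakeFst, not_and_or, not_not] at hT
        rcases hT with hT | hT
        · exact absurd (hi ▸ h1) hT
        · rw [← hi]
          exact hT.2.le
    obtain ⟨n1, n2⟩ := hnext _ _ rfl rfl
    conv_rhs => rw [mergeArr]
    split_ifs with hT
    · refine n1 ?_
      have := hT.1
      rwa [hp] at this
    · refine n2 ?_
      have := mergeState_snd_lt hh hT
      rwa [hp] at this
  intro c x y hxy hy
  induction hxy with
  | refl => exact le_rfl
  | @step y hxy ih =>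
    refine (ih (by omega)).trans (hcons _ ?_)
    have e : ∀ z, z < 2 * h → (c * (2 * h) + z) / (2 * h) = c := fun z hz => by
      rw [mul_comm c, Nat.mul_add_div (by omega), Nat.div_eq_of_lt hz, add_zero]
    rw [add_assoc, e _ (by omega), e _ (by omega)]

end MergeArray

/-! ### A sorted array with distinct nonzero entries is determined by those entries. -/

section Uniqueness

/-- On `[0, S)` the array is sorted and its nonzero entries are distinct. -/
structure SortedOn (S : ℕ) (a : ℕ → ℕ) : Prop where
  mono : ∀ x y, x ≤ y → y < S → a x ≤ a y
  inj : ∀ x < S, ∀ y < S, a x = a y → a x ≠ 0 → x = y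

/-- The position of a nonzero entry is read off from the set of values alone, counted from the right
end because the repeated zeros come first. -/
theorem SortedOn.card {S : ℕ} {a : ℕ → ℕ} (h : SortedOn S a) {x : ℕ} (hx : x < S) (h0 : a x ≠ 0) :
    (((Finset.range S).image a).filter (a x ≤ ·)).card = S - x := by
  have : ((Finset.range S).image a).filter (a x ≤ ·) = (Finset.Ico x S).image a := by
    ext r
    simp only [Finset.mem_filter, Finset.mem_image, Finset.mem_range, Finset.mem_Ico]
    constructor
    · rintro ⟨⟨y, hy, rfl⟩, hle⟩
      refine ⟨y, ⟨?_, hy⟩, rfl⟩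
      by_contra hlt
      have h1 := h.mono y x (by omega) hx
      have := h.inj x hx y hy (le_antisymm hle h1) h0
      omega
    · rintro ⟨y, ⟨h1, h2⟩, rfl⟩
      exact ⟨⟨y, h2, rfl⟩, h.mono x y h1 h2⟩
  rw [this, Finset.card_image_of_injOn, Nat.card_Ico]
  intro y hy z hz hyz
  simp only [Finset.coe_Ico, Set.mem_Ico] at hy hz
  exact h.inj y hy.2 z hz.2 hyz (fun h1 => h0 (by have := h.mono x y hy.1 hy.2; omega))

theorem SortedOn.eq {S : ℕ} {a a' : ℕ → ℕ} (h : SortedOn S a) (h' : SortedOn S a')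
    (hval : ∀ r, r ≠ 0 → ((∃ x < S, a x = r) ↔ ∃ x < S, a' x = r)) {x : ℕ} (hx : x < S) :
    a x = a' x := by
  have key : ∀ {a a' : ℕ → ℕ}, SortedOn S a → SortedOn S a' →
      (∀ r, r ≠ 0 → ((∃ x < S, a x = r) ↔ ∃ x < S, a' x = r)) → a x ≠ 0 → a x = a' x := by
    intro a a' h h' hval h0
    obtain ⟨y, hy, hyx⟩ := (hval _ h0).mp ⟨x, hx, rfl⟩
    have h1 := h.card hx h0
    have h2 := h'.card hy (hyx ▸ h0)
    have h3 : ((Finset.range S).image a).filter (a x ≤ ·) =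
        ((Finset.range S).image a').filter (a' y ≤ ·) := by
      ext r
      simp only [Finset.mem_filter, Finset.mem_image, Finset.mem_range, hyx]
      refine and_congr_left fun hr => hval r (by omega)
    rw [h3, h2] at h1
    obtain rfl : x = y := by omega
    exact hyx.symm
  by_cases h0 : a x = 0
  · by_cases h0' : a' x = 0
    · rw [h0, h0']
    · exact (key h' h (fun r hr => (hval r hr).symm) h0').symm
  · exact key h h' hval h0

end Uniqueness


/-! ### The routing network on ranks, the sorted buckets and the final merge. -/

section Routing

theorem Rearr.zero_of_le {N : ℕ} (hN : 0 < N) {a a' : ℕ → ℕ} (h : Rearr N a a')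
    (ha : ∀ p, N ≤ p → a p = 0) : ∀ p, N ≤ p → a' p = 0 := by
  obtain ⟨π, -, h2, h3⟩ := h
  intro p hp
  rw [h3, ha]
  have := h2 p
  by_contra hc
  rw [Nat.div_eq_of_lt (not_le.mp hc)] at this
  exact absurd this.symm (Nat.div_pos hp hN).ne'

theorem Rearr.inj {N : ℕ} {a a' : ℕ → ℕ} (h : Rearr N a a')
    (ha : ∀ p q, a p = a q → a p ≠ 0 → p = q) : ∀ p q, a' p = a' q → a' p ≠ 0 → p = q := by
  obtain ⟨π, h1, -, h3⟩ := h
  intro p q hpq h0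
  rw [h3, h3] at hpq
  rw [h3] at h0
  exact h1 (ha _ _ hpq h0)

/-- An injection preserving the finite block `[0, N)` is onto it. -/
theorem Rearr.surj {N : ℕ} {a a' : ℕ → ℕ} (h : Rearr N a a') {r p : ℕ} (hp : p < N)
    (hr : a p = r) : ∃ q < N, a' q = r := by
  obtain ⟨π, h1, h2, h3⟩ := h
  have hN : 0 < N := by omega
  have hmaps : ∀ q ∈ Finset.range N, π q ∈ Finset.range N := by
    intro q hq
    rw [Finset.mem_range] at hq ⊢
    have := h2 q
    rw [Nat.div_eq_of_lt hq] at this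
    exact (Nat.div_eq_zero_iff_lt hN).mp this
  obtain ⟨q, hq, hqp⟩ := Finset.surj_on_of_inj_on_of_card_le (s := Finset.range N)
    (t := Finset.range N) (fun q _ => π q) (fun q hq => hmaps q hq)
    (fun x y _ _ hxy => h1 hxy) le_rfl p (Finset.mem_range.mpr hp)
  exact ⟨q, Finset.mem_range.mp hq, by rw [h3, ← hqp, hr]⟩

/-- The exchange rule of rounds without comparisons. -/
def noSwap : ℕ → ℕ → ℕ → Bool := fun _ _ _ => false

/-- Key by which one routing level sorts: the current bit of the label for real records,
in between for dummies. -/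
def routeKey (lab : ℕ → ℕ) (g r : ℕ) : ℕ := if r = 0 then 1 else 2 * (lab r / g % 2)

/-- Records that ideally are in bucket `c` after `k` of `m` routing levels. -/
def loadSet (n m : ℕ) (ini lab : ℕ → ℕ) (k c : ℕ) : Finset ℕ :=
  (Finset.Icc 1 n).filter fun r => ini r % 2 ^ (m - k) = c / 2 ^ k ∧ lab r / 2 ^ (m - k) = c % 2 ^ k

/-- One routing level. -/
def routeLevel (w m : ℕ) (lab : ℕ → ℕ) (g : ℕ) (a : ℕ → ℕ) : ℕ → ℕ :=
  bitonicSort (routeKey lab g) (2 ^ w) (w + 1) (round (2 ^ (w + m) / 2) noSwap a)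

/-- Every record is in its ideal bucket after `k` routing levels. -/
def RouteInv (n w m : ℕ) (ini lab : ℕ → ℕ) (k : ℕ) (a : ℕ → ℕ) : Prop :=
  ∀ p, a p ≠ 0 → a p ≤ n ∧ p < 2 ^ (w + m) ∧ p / 2 ^ w / 2 ^ k = ini (a p) % 2 ^ (m - k) ∧
    p / 2 ^ w % 2 ^ k = lab (a p) / 2 ^ (m - k)

theorem routeLevel_rearr {w m : ℕ} (hm : 0 < m) (lab : ℕ → ℕ) (g : ℕ) (a : ℕ → ℕ) :
    Rearr (2 ^ (w + m)) a (routeLevel w m lab g a) := by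
  have h2 : 2 * (2 ^ (w + m) / 2) = 2 ^ (w + m) := by
    obtain ⟨m, rfl⟩ := Nat.exists_eq_add_of_lt hm
    rw [show w + (0 + m + 1) = (w + m) + 1 by ring, pow_succ]; omega
  have h1 := round_rearr (h := 2 ^ (w + m) / 2) (by have : 0 < 2 ^ (w + m) := by positivity
                                                    omega) noSwap a
  rw [h2] at h1
  exact h1.trans ((bitonicSort_rearr _ _ _ _).mono (pow_dvd_pow 2 (by omega)))

theorem round_noSwap (h : ℕ) (a : ℕ → ℕ) (p : ℕ) :
    round h noSwap a p = a (pos h (p / 2) (p % 2)) := by simp [round, noSwap]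

/-- The shuffle drops the top bit of the bucket index and makes the two candidates adjacent; the
sort appends the next label bit at the bottom. A record in the wrong half of its pair would force
more than `2 ^ w` records with the same bit there, all belonging to one bucket and contradicting the
load bound. -/
theorem routeLevel_inv {n w m : ℕ} {ini lab : ℕ → ℕ} {k : ℕ} (hk : k < m)
    (hload : ∀ c < 2 ^ m, (loadSet n m ini lab (k + 1) c).card ≤ 2 ^ w) {a : ℕ → ℕ}
    (hinj : ∀ p q, a p = a q → a p ≠ 0 → p = q) (ha : RouteInv n w m ini lab k a) :
    RouteInv n w m ini lab (k + 1) (routeLevel w m lab (2 ^ (m - 1 - k)) a) := by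
  obtain ⟨d, rfl⟩ : ∃ d, m = k + d + 1 := ⟨m - k - 1, by omega⟩
  have hsub : k + d + 1 - 1 - k = d := by omega
  have hsub' : k + d + 1 - (k + 1) = d := by omega
  have hsub2 : k + d + 1 - k = d + 1 := by omega
  have hN : 2 ^ (w + (k + d + 1)) = 2 * 2 ^ (w + (k + d)) := by ring
  have hN2 : 2 ^ (w + (k + d + 1)) / 2 = 2 ^ (w + (k + d)) := by omega
  have hWpos : 0 < 2 ^ w := by positivity
  have hkpos : 0 < 2 ^ k := by positivity
  have hdpos : 0 < 2 ^ d := by positivity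
  have hhpos : 0 < 2 ^ (w + (k + d)) := by positivity
  set a1 := round (2 ^ (w + (k + d + 1)) / 2) noSwap a with ha1
  set a2 := routeLevel w (k + d + 1) lab (2 ^ (k + d + 1 - 1 - k)) a with ha2
  -- location of records at the granularity of pairs of buckets
  have loc1 : ∀ p, a1 p ≠ 0 → a1 p ≤ n ∧ p < 2 ^ (w + (k + d + 1)) ∧
      p / (2 * 2 ^ w) / 2 ^ k = ini (a1 p) % 2 ^ d ∧
      p / (2 * 2 ^ w) % 2 ^ k = lab (a1 p) / 2 ^ (d + 1) := by
    intro p h0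
    rw [ha1, round_noSwap, hN2] at h0
    obtain ⟨g0, g1, g2, g3⟩ := ha _ h0
    have hr : a1 p = a (pos (2 ^ (w + (k + d))) (p / 2) (p % 2)) := by
      rw [ha1, round_noSwap, hN2]
    rw [hr]
    have hlt : p < 2 ^ (w + (k + d + 1)) := by
      have h1 := pos_div_two_mul (e := p % 2) hhpos (by omega) (p / 2)
      rw [← hN, Nat.div_eq_of_lt g1] at h1
      have := (Nat.div_eq_zero_iff_lt hhpos).mp h1.symm
      omega
    refine ⟨g0, hlt, ?_⟩
    have hq : p / 2 < 2 ^ (w + (k + d)) := by omega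
    have hpos : pos (2 ^ (w + (k + d))) (p / 2) (p % 2) = p % 2 * 2 ^ (w + (k + d)) + p / 2 := by
      have := pos_block (C := 0) (e := p % 2) hq
      simpa using this
    have hj : p / (2 * 2 ^ w) = p / 2 / 2 ^ w := by rw [Nat.div_div_eq_div_mul]
    rw [hj]
    set q := p / 2
    set e := p % 2
    have hc : pos (2 ^ (w + (k + d))) q e / 2 ^ w = e * 2 ^ (k + d) + q / 2 ^ w := by
      rw [hpos, show e * 2 ^ (w + (k + d)) + q = 2 ^ w * (e * 2 ^ (k + d)) + q by ring,
        Nat.mul_add_div hWpos]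
    rw [hc, hsub2] at g2 g3
    constructor
    · have h1 : (e * 2 ^ (k + d) + q / 2 ^ w) / 2 ^ k = e * 2 ^ d + q / 2 ^ w / 2 ^ k := by
        rw [show e * 2 ^ (k + d) = 2 ^ k * (e * 2 ^ d) by ring, Nat.mul_add_div hkpos]
      have h2 : q / 2 ^ w / 2 ^ k < 2 ^ d := by
        rw [Nat.div_div_eq_div_mul, ← pow_add]
        refine Nat.div_lt_of_lt_mul ?_
        rw [← pow_add]; rwa [add_assoc]
      have h3 := congrArg (· % 2 ^ d) g2
      simp only [h1] at h3
      rw [Nat.mod_mod_of_dvd _ (pow_dvd_pow 2 (Nat.le_succ d)), mul_comm, Nat.mul_add_mod,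
        Nat.mod_eq_of_lt h2] at h3
      exact h3
    · rw [← g3, show e * 2 ^ (k + d) = 2 ^ k * (e * 2 ^ d) by ring, Nat.mul_add_mod]
  have hrear : Rearr (2 ^ (w + 1)) a1 a2 := bitonicSort_rearr _ _ _ _
  have hrearN : Rearr (2 ^ (w + (k + d + 1))) a a2 := routeLevel_rearr (by omega) _ _ _
  have hinj2 := hrearN.inj hinj
  have loc2 : ∀ p, a2 p ≠ 0 → a2 p ≤ n ∧ p < 2 ^ (w + (k + d + 1)) ∧
      p / (2 * 2 ^ w) / 2 ^ k = ini (a2 p) % 2 ^ d ∧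
      p / (2 * 2 ^ w) % 2 ^ k = lab (a2 p) / 2 ^ (d + 1) := by
    intro p h0
    obtain ⟨π, h1, h2, h3⟩ := hrear
    rw [h3] at h0 ⊢
    have hp := h2 p
    rw [pow_succ, mul_comm] at hp
    obtain ⟨g0, g1, g2, g3⟩ := loc1 _ h0
    rw [hp] at g2 g3
    refine ⟨g0, ?_, g2, g3⟩
    have hp' := congrArg (· / 2 ^ (k + d)) hp
    simp only [Nat.div_div_eq_div_mul] at hp'
    rw [show 2 * 2 ^ w * 2 ^ (k + d) = 2 ^ (w + (k + d + 1)) by ring, Nat.div_eq_of_lt g1] at hp'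
    exact (Nat.div_eq_zero_iff_lt (by positivity)).mp hp'.symm
  have hbit : ∀ y, y / 2 ^ d = 2 * (y / 2 ^ (d + 1)) + y / 2 ^ d % 2 := fun y => by
    rw [pow_succ, ← Nat.div_div_eq_div_mul]; omega
  have hsorted := bitonicSort_sorted (routeKey lab (2 ^ (k + d + 1 - 1 - k))) w a1
  change ∀ C u u', u ≤ u' → u' < 2 ^ (w + 1) → routeKey lab _ (a2 (C * 2 ^ (w + 1) + u)) ≤
    routeKey lab _ (a2 (C * 2 ^ (w + 1) + u')) at hsorted
  rw [hsub] at hsorted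
  have hW2 : 2 ^ (w + 1) = 2 * 2 ^ w := by ring
  rw [hW2] at hsorted
  -- too many records with the same bit would overload a bucket
  have hover : ∀ j β s, j < 2 ^ (k + d) → β < 2 → s + 2 ^ w < 2 * 2 ^ w →
      (∀ x ≤ 2 ^ w, a2 (j * (2 * 2 ^ w) + (s + x)) ≠ 0 ∧
        lab (a2 (j * (2 * 2 ^ w) + (s + x))) / 2 ^ d % 2 = β) → False := by
    intro j β s hj hβ hs hx
    have hcard := hload (2 * j + β) (by rw [pow_succ]; omega)
    have himg : (Finset.range (2 ^ w + 1)).image (fun x => a2 (j * (2 * 2 ^ w) + (s + x))) ⊆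
        loadSet n (k + d + 1) ini lab (k + 1) (2 * j + β) := by
      intro r hr
      obtain ⟨x, hx', rfl⟩ := Finset.mem_image.mp hr
      rw [Finset.mem_range] at hx'
      obtain ⟨h0, hb⟩ := hx x (by omega)
      obtain ⟨g0, -, g2, g3⟩ := loc2 _ h0
      have hdiv : (j * (2 * 2 ^ w) + (s + x)) / (2 * 2 ^ w) = j := by
        rw [mul_comm j, Nat.mul_add_div (by positivity), Nat.div_eq_of_lt (by omega), add_zero]
      rw [hdiv] at g2 g3
      rw [loadSet, Finset.mem_filter, Finset.mem_Icc, hsub']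
      refine ⟨⟨by omega, g0⟩, ?_, ?_⟩
      · rw [← g2, pow_succ, mul_comm (2 ^ k), ← Nat.div_div_eq_div_mul]
        congr 1; omega
      · rw [hbit, ← g3, hb, pow_succ, mul_comm (2 ^ k), Nat.mod_mul]
        rw [show (2 * j + β) / 2 = j by omega]; omega
    have hle := Finset.card_le_card himg
    rw [Finset.card_image_of_injOn, Finset.card_range] at hle
    · omega
    · intro x hx1 y hy1 hxy
      simp only [Finset.coe_range, Set.mem_Iio] at hx1 hy1
      have := hinj2 _ _ hxy (hx x (by omega)).1
      omega
  intro p h0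
  obtain ⟨g0, g1, g2, g3⟩ := loc2 p h0
  refine ⟨g0, g1, ?_⟩
  set j := p / (2 * 2 ^ w) with hj
  set z := p % (2 * 2 ^ w) with hz
  have hp : p = j * (2 * 2 ^ w) + z := (Nat.div_add_mod' p _).symm
  have hzlt : z < 2 * 2 ^ w := Nat.mod_lt _ (by positivity)
  have hjlt : j < 2 ^ (k + d) := by
    refine Nat.div_lt_of_lt_mul ?_
    rwa [show 2 * 2 ^ w * 2 ^ (k + d) = 2 ^ (w + (k + d + 1)) by ring]
  have hhalf : p / 2 ^ w = 2 * j + lab (a2 p) / 2 ^ d % 2 := by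
    have hpw : p / 2 ^ w = 2 * j + z / 2 ^ w := by
      rw [hp, show j * (2 * 2 ^ w) + z = 2 ^ w * (2 * j) + z by ring, Nat.mul_add_div hWpos]
    rw [hpw]
    congr 1
    rcases Nat.mod_two_eq_zero_or_one (lab (a2 p) / 2 ^ d) with hb | hb
    · rw [hb]
      refine Nat.div_eq_of_lt ?_
      by_contra hge
      -- A record with bit `0` in the upper half has only bit-`0` records before it, so the first `2
      -- ^ w + 1` places witness the overload.
      refine hover j 0 0 hjlt (by omega) (by omega) fun x hx => ?_
      have := hsorted j x z (by omega) hzlt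
      rw [← hp, routeKey, routeKey, if_neg h0, hb] at this
      rw [zero_add]
      split_ifs at this with h1
      · omega
      · exact ⟨h1, by omega⟩
    · rw [hb]
      refine Nat.div_eq_of_lt_le ?_ (by omega)
      by_contra hlt
      -- Symmetrically, a record with bit `1` in the lower half fills the last `2 ^ w + 1` places.
      refine hover j 1 (2 ^ w - 1) hjlt (by omega) (by omega) fun x hx => ?_
      have := hsorted j z (2 ^ w - 1 + x) (by omega) (by omega)
      rw [← hp, routeKey, routeKey, if_neg h0, hb] at this
      split_ifs at this with h1
      · omega
      · exact ⟨h1, by omega⟩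
  rw [hhalf, hsub']
  have hβ : lab (a2 p) / 2 ^ d % 2 < 2 := Nat.mod_lt _ two_pos
  constructor
  · rw [← g2, pow_succ, mul_comm (2 ^ k), ← Nat.div_div_eq_div_mul]
    congr 1; omega
  · conv_rhs => rw [hbit, ← g3]
    rw [pow_succ, mul_comm (2 ^ k), Nat.mod_mul,
      show (2 * j + lab (a2 p) / 2 ^ d % 2) / 2 = j by omega]
    omega

/-- All routing levels. -/
def routeArr (w m : ℕ) (lab : ℕ → ℕ) (a : ℕ → ℕ) : ℕ → ℕ → ℕ
  | 0 => a
  | k + 1 => routeLevel w m lab (2 ^ (m - 1 - k)) (routeArr w m lab a k)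

theorem routeArr_rearr (w m : ℕ) (lab a : ℕ → ℕ) (k : ℕ) (hk : k ≤ m) :
    Rearr (2 ^ (w + m)) a (routeArr w m lab a k) := by
  induction k with
  | zero => exact .refl _ _
  | succ k ih => exact (ih (by omega)).trans (routeLevel_rearr (by omega) _ _ _)

theorem routeArr_inv {n w m : ℕ} {ini lab a : ℕ → ℕ}
    (hload : ∀ k < m, ∀ c < 2 ^ m, (loadSet n m ini lab (k + 1) c).card ≤ 2 ^ w)
    (hinj : ∀ p q, a p = a q → a p ≠ 0 → p = q) (ha : RouteInv n w m ini lab 0 a) (k : ℕ)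
    (hk : k ≤ m) : RouteInv n w m ini lab k (routeArr w m lab a k) := by
  induction k with
  | zero => exact ha
  | succ k ih =>
    exact routeLevel_inv (by omega) (hload k (by omega))
      ((routeArr_rearr w m lab a k (by omega)).inj hinj) (ih (by omega))

/-- Buckets of length `W` that are sorted, with the records of label `c` in bucket `c`. -/
structure IsBucketed (W n : ℕ) (lab a : ℕ → ℕ) : Prop where
  sorted : BlocksSorted W a
  inj : ∀ p q, a p = a q → a p ≠ 0 → p = q
  mem : ∀ c r, r ≠ 0 → ((∃ x < W, a (c * W + x) = r) ↔ r ≤ n ∧ lab r = c)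

/-- This is what removes the input from the merge trace: the routing history is forgotten and only
the labels of the ranks matter. -/
theorem IsBucketed.eq {W n : ℕ} (hW : 0 < W) {lab a a' : ℕ → ℕ} (h : IsBucketed W n lab a)
    (h' : IsBucketed W n lab a') : a = a' := by
  funext p
  have hon : ∀ {a : ℕ → ℕ}, IsBucketed W n lab a → ∀ c, SortedOn W fun x => a (c * W + x) :=
    fun h c => ⟨fun x y => h.sorted c x y, fun x _ y _ hxy h0 => by
      have := h.inj _ _ hxy h0; omega⟩
  have := (hon h (p / W)).eq (hon h' (p / W)) (fun r hr => by rw [h.mem _ r hr, h'.mem _ r hr])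
    (Nat.mod_lt p hW)
  simpa [Nat.div_add_mod'] using this

open Classical in
/-- The sorted buckets determined by the labels. -/
noncomputable def bucketed (W n : ℕ) (lab : ℕ → ℕ) : ℕ → ℕ :=
  if h : ∃ a, IsBucketed W n lab a then h.choose else fun _ => 0

theorem IsBucketed.eq_bucketed {W n : ℕ} (hW : 0 < W) {lab a : ℕ → ℕ}
    (h : IsBucketed W n lab a) : a = bucketed W n lab := by
  have hex : ∃ a, IsBucketed W n lab a := ⟨a, h⟩
  rw [bucketed, dif_pos hex]
  exact h.eq hW hex.choose_spec

/-- `a` contains each of `1, ..., n` exactly once below `N`, and zeros elsewhere. -/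
structure IsArr (N n : ℕ) (a : ℕ → ℕ) : Prop where
  inj : ∀ p q, a p = a q → a p ≠ 0 → p = q
  le : ∀ p, a p ≤ n
  zero : ∀ p, N ≤ p → a p = 0
  surj : ∀ r, r ≠ 0 → r ≤ n → ∃ p < N, a p = r

theorem IsArr.rearr {N n : ℕ} (hN : 0 < N) {a a' : ℕ → ℕ} (h : IsArr N n a) (hr : Rearr N a a') :
    IsArr N n a' where
  inj := hr.inj h.inj
  le p := by obtain ⟨π, -, -, h3⟩ := hr; rw [h3]; exact h.le _
  zero := hr.zero_of_le hN h.zero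
  surj r h0 hn := by
    obtain ⟨p, hp, hpr⟩ := h.surj r h0 hn
    exact hr.surj hp hpr

/-- Routing followed by sorting every bucket. -/
theorem isBucketed_sort_route {n w m : ℕ} {ini lab a : ℕ → ℕ}
    (hload : ∀ k < m, ∀ c < 2 ^ m, (loadSet n m ini lab (k + 1) c).card ≤ 2 ^ (w + 1))
    (harr : IsArr (2 ^ (w + 1 + m)) n a)
    (hini : ∀ p, a p ≠ 0 → p / 2 ^ (w + 1) = ini (a p) ∧ ini (a p) < 2 ^ m)
    (hlab : ∀ r, lab r < 2 ^ m) :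
    IsBucketed (2 ^ (w + 1)) n lab
      (bitonicSort id (2 ^ w) (w + 1) (routeArr (w + 1) m lab a m)) := by
  set W := 2 ^ (w + 1) with hW
  have hWpos : 0 < W := by positivity
  have hNpos : 0 < 2 ^ (w + 1 + m) := by positivity
  have h0 : RouteInv n (w + 1) m ini lab 0 a := by
    intro p hp
    refine ⟨harr.le p, ?_, ?_, ?_⟩
    · by_contra hc
      exact hp (harr.zero p (by omega))
    · rw [pow_zero, Nat.div_one, Nat.sub_zero, Nat.mod_eq_of_lt (hini p hp).2, (hini p hp).1]
    · rw [pow_zero, Nat.mod_one, Nat.sub_zero, Nat.div_eq_of_lt (hlab _)]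
  have hm := routeArr_inv hload harr.inj h0 m le_rfl
  have h1 := harr.rearr hNpos (routeArr_rearr (w + 1) m lab a m le_rfl)
  set a1 := routeArr (w + 1) m lab a m with ha1
  have hr2 : Rearr W a1 (bitonicSort id (2 ^ w) (w + 1) a1) := bitonicSort_rearr _ _ _ _
  have h2 := h1.rearr hNpos (hr2.mono ⟨2 ^ m, by rw [hW, ← pow_add]⟩)
  set a2 := bitonicSort id (2 ^ w) (w + 1) a1 with ha2
  have hloc : ∀ p, a2 p ≠ 0 → p / W = lab (a2 p) := by
    intro p hp
    obtain ⟨π, -, h3, h4⟩ := hr2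
    rw [h4] at hp ⊢
    obtain ⟨-, g1, -, g3⟩ := hm _ hp
    rw [← h3]
    rw [Nat.sub_self, pow_zero, Nat.div_one, Nat.mod_eq_of_lt] at g3
    · exact g3
    · refine Nat.div_lt_of_lt_mul ?_
      rwa [← pow_add]
  refine ⟨fun c x y hxy hy => bitonicSort_sorted id w a1 c x y hxy hy, h2.inj, fun c r hr => ?_⟩
  constructor
  · rintro ⟨x, hx, rfl⟩
    refine ⟨h2.le _, ?_⟩
    rw [← hloc _ hr, mul_comm, Nat.mul_add_div hWpos, Nat.div_eq_of_lt hx, add_zero]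
  · rintro ⟨hn, rfl⟩
    obtain ⟨p, hp, rfl⟩ := h2.surj r hr hn
    refine ⟨p % W, Nat.mod_lt _ hWpos, ?_⟩
    rw [← hloc p hr, Nat.div_add_mod']

/-- Repeated merging of adjacent runs. -/
def mergeAll (W : ℕ) : ℕ → (ℕ → ℕ) → ℕ → ℕ
  | 0, a => a
  | k + 1, a => mergeArr (2 ^ k * W) (mergeAll W k a)

theorem mergeAll_spec {W : ℕ} (hW : 0 < W) {a : ℕ → ℕ} (ha : BlocksSorted W a) (k : ℕ) :
    BlocksSorted (2 ^ k * W) (mergeAll W k a) ∧ Rearr (2 ^ k * W) a (mergeAll W k a) := by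
  induction k with
  | zero => simpa [mergeAll] using ⟨ha, Rearr.refl _ _⟩
  | succ k ih =>
    have hpos : 0 < 2 ^ k * W := by positivity
    rw [show 2 ^ (k + 1) * W = 2 * (2 ^ k * W) by ring]
    exact ⟨mergeArr_sorted hpos ih.1, (ih.2.mono ⟨2, by ring⟩).trans (mergeArr_rearr hpos _)⟩

/-- Neither labels nor loads occur here, so the output is right even after an overflow. -/
theorem mergeAll_eq {w m n : ℕ} (hn : n ≤ 2 ^ (w + m)) {a : ℕ → ℕ} (ha : BlocksSorted (2 ^ w) a)
    (harr : IsArr (2 ^ (w + m)) n a) {p : ℕ} (hp : p < 2 ^ (w + m)) :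
    mergeAll (2 ^ w) m a p = p + 1 + n - 2 ^ (w + m) := by
  obtain ⟨h1, h2⟩ := mergeAll_spec (by positivity) ha m
  rw [show 2 ^ m * 2 ^ w = 2 ^ (w + m) by ring] at h1 h2
  have h3 := harr.rearr (by positivity) h2
  have hs : SortedOn (2 ^ (w + m)) (mergeAll (2 ^ w) m a) :=
    ⟨fun x y hxy hy => by simpa using h1 0 x y hxy hy, fun x _ y _ hxy h0 => h3.inj x y hxy h0⟩
  -- Truncated subtraction yields the zeros of the dummies first, and then `1, ..., n`.
  have hs' : SortedOn (2 ^ (w + m)) fun p => p + 1 + n - 2 ^ (w + m) :=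
    ⟨fun x y hxy _ => by omega, fun x _ y _ hxy h0 => by omega⟩
  refine hs.eq hs' (fun r hr => ⟨?_, ?_⟩) hp
  · rintro ⟨x, -, rfl⟩
    have := h3.le x
    exact ⟨mergeAll (2 ^ w) m a x + 2 ^ (w + m) - 1 - n, by omega, by omega⟩
  · rintro ⟨x, hx, rfl⟩
    exact h3.surj _ hr (by omega)

end Routing


/-! ### Counting discontiguous regions: every pass is streamed. -/

section Regions

/-- The addresses accessed on disk `d`. -/
def addrs {p : ℕ} (d : Fin p) (t : List (Access p)) : List ℕ :=
  (t.filter (fun a => a.disk = d)).map Access.addr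

theorem addrs_append {p : ℕ} (d : Fin p) (t t' : List (Access p)) :
    addrs d (t ++ t') = addrs d t ++ addrs d t' := by simp [addrs]

theorem newRegions_le_none (prev : Option ℕ) (l : List ℕ) :
    newRegions prev l ≤ newRegions none l := by
  cases l with
  | nil => rfl
  | cons a l =>
    simp only [newRegions, Option.map_none, reduceCtorEq, if_false]
    split_ifs <;> omega

theorem newRegions_append_le (prev : Option ℕ) (l l' : List ℕ) :
    newRegions prev (l ++ l') ≤ newRegions prev l + newRegions none l' := by
  induction l generalizing prev with
  | nil => simpa [newRegions] using newRegions_le_none prev l'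
  | cons a l ih =>
    simp only [List.cons_append, newRegions]
    have := ih (some a)
    omega

theorem newRegions_range'_succ (a k : ℕ) : newRegions (some a) (List.range' (a + 1) k) = 0 := by
  induction k generalizing a with
  | zero => rfl
  | succ k ih => simp [List.range'_succ, newRegions, ih]

theorem newRegions_range' (s k : ℕ) : newRegions none (List.range' s k) ≤ 1 := by
  cases k with
  | zero => simp [newRegions]
  | succ k => simp [List.range'_succ, newRegions, newRegions_range'_succ]

theorem numRegions_append_le {p : ℕ} (t t' : List (Access p)) :
    numRegions (t ++ t') ≤ numRegions t + numRegions t' := by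
  rw [numRegions, numRegions, numRegions, ← Finset.sum_add_distrib]
  refine Finset.sum_le_sum fun d _ => ?_
  simp only [List.filter_append, List.map_append]
  exact newRegions_append_le _ _ _

theorem numRegions_flatMap_le {p : ℕ} {α : Type*} (l : List α) (f : α → List (Access p)) (B : ℕ)
    (h : ∀ x ∈ l, numRegions (f x) ≤ B) : numRegions (l.flatMap f) ≤ l.length * B := by
  induction l with
  | nil => simp [numRegions, newRegions]
  | cons x l ih =>
    rw [List.flatMap_cons, List.length_cons, add_mul, one_mul, add_comm]
    exact (numRegions_append_le _ _).trans (add_le_add (h x (by simp))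
      (ih fun y hy => h y (by simp [hy])))

/-- On every disk consecutive addresses are accessed. -/
def Streamed (t : List (Access 3)) : Prop := ∀ d, ∃ s k, addrs d t = List.range' s k

theorem Streamed.numRegions_le {t : List (Access 3)} (h : Streamed t) : numRegions t ≤ 3 := by
  rw [numRegions]
  refine (Finset.sum_le_sum (g := fun _ => 1) fun d _ => ?_).trans (by simp)
  obtain ⟨s, k, hsk⟩ := h d
  rw [addrs] at hsk
  rw [hsk]
  exact newRegions_range' s k

/-- `f p` is the cursor of the disk before step `p`: if each step reads or writes exactly from one
cursor value to the next, the steps concatenate to one interval. -/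
theorem addrs_flatMap_range (d : Fin 3) (τ : ℕ → List (Access 3)) (f : ℕ → ℕ) (N : ℕ)
    (hf : ∀ p, f p ≤ f (p + 1)) (h : ∀ p, addrs d (τ p) = List.range' (f p) (f (p + 1) - f p)) :
    f 0 ≤ f N ∧ addrs d ((List.range N).flatMap τ) = List.range' (f 0) (f N - f 0) := by
  induction N with
  | zero => simp [addrs]
  | succ N ih =>
    refine ⟨ih.1.trans (hf N), ?_⟩
    rw [List.range_succ, List.flatMap_append, addrs_append, ih.2, List.flatMap_singleton, h]
    have h1 := hf N
    have h2 := ih.1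
    obtain ⟨x, hx⟩ := Nat.exists_eq_add_of_le h2
    obtain ⟨y, hy⟩ := Nat.exists_eq_add_of_le h1
    rw [hy, hx, show f 0 + x + y - f 0 = x + y by omega, show f 0 + x - f 0 = x by omega,
      show f 0 + x + y - (f 0 + x) = y by omega, ← List.range'_append_1]

theorem streamed_flatMap_range {τ : ℕ → List (Access 3)} (f : Fin 3 → ℕ → ℕ) (N : ℕ)
    (hf : ∀ d p, f d p ≤ f d (p + 1))
    (h : ∀ d p, addrs d (τ p) = List.range' (f d p) (f d (p + 1) - f d p)) :
    Streamed ((List.range N).flatMap τ) :=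
  fun d => ⟨_, _, (addrs_flatMap_range d τ (f d) N (hf d) (h d)).2⟩

theorem addrs_acc3 (d d' : Fin 3) (w : Bool) (q : ℕ) :
    addrs d (acc3 w d' q) = if d' = d then List.range' (3 * q) 3 else [] := by
  by_cases h : d' = d <;> simp [addrs, acc3, h, List.range'_succ]

theorem combineTrace_streamed (M : ℕ) : Streamed (combineTrace M) := by
  refine streamed_flatMap_range (fun d p => if d = 0 then 6 * p else 3 * p) M
    (fun d p => by split_ifs <;> omega) fun d p => ?_
  simp only [combineStepTrace, addrs_append, addrs_acc3]
  fin_cases d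
  · simp only [Fin.zero_eta, Fin.isValue, Fin.reduceEq, if_false, if_true, List.nil_append]
    rw [show 6 * (p + 1) - 6 * p = 3 + 3 by omega, ← List.range'_append_1]
    congr 2 <;> omega
  · simp [show 3 * (p + 1) - 3 * p = 3 by omega]
  · simp [show 3 * (p + 1) - 3 * p = 3 by omega]

/-- The two expressions count the positions below `p` in even and in odd chunks, the truncated
difference being `0` during an even chunk. They are the cursors of disks `1` and `2`. -/
theorem splitIdx_count {h : ℕ} (hh : 0 < h) (p : ℕ) :
    (p / h % 2 = 0 → splitIdx h p = p / (2 * h) * h + min (p % (2 * h)) h ∧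
      (p + 1) / (2 * h) * h + min ((p + 1) % (2 * h)) h =
        p / (2 * h) * h + min (p % (2 * h)) h + 1 ∧
      (p + 1) / (2 * h) * h + ((p + 1) % (2 * h) - h) =
        p / (2 * h) * h + (p % (2 * h) - h)) ∧
    (p / h % 2 ≠ 0 → splitIdx h p = p / (2 * h) * h + (p % (2 * h) - h) ∧
      (p + 1) / (2 * h) * h + min ((p + 1) % (2 * h)) h =
        p / (2 * h) * h + min (p % (2 * h)) h ∧
      (p + 1) / (2 * h) * h + ((p + 1) % (2 * h) - h) =
        p / (2 * h) * h + (p % (2 * h) - h) + 1) := by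
  set c := p / (2 * h) with hc
  set r := p % (2 * h) with hr
  have hrlt : r < 2 * h := Nat.mod_lt _ (by omega)
  have hp : p = 2 * h * c + r := (Nat.div_add_mod p (2 * h)).symm
  have hdiv : p / h = 2 * c + r / h := by
    rw [hp, show 2 * h * c + r = h * (2 * c) + r by ring, Nat.mul_add_div hh]
  have hmod : p % h = r % h := by
    rw [hp, show 2 * h * c + r = h * (2 * c) + r by ring, Nat.mul_add_mod]
  have hnext : (p + 1) / (2 * h) * h + min ((p + 1) % (2 * h)) h = c * h + min (r + 1) h ∧
      (p + 1) / (2 * h) * h + ((p + 1) % (2 * h) - h) = c * h + (r + 1 - h) := by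
    rcases Nat.lt_or_ge (r + 1) (2 * h) with h1 | h1
    · rw [hp, add_assoc, Nat.mul_add_div (by omega), Nat.mul_add_mod, Nat.div_eq_of_lt h1,
        Nat.mod_eq_of_lt h1, add_zero]
      exact ⟨rfl, rfl⟩
    · have h2 : r + 1 = 2 * h := by omega
      rw [hp, add_assoc, h2, show 2 * h * c + 2 * h = 2 * h * (c + 1) by ring,
        Nat.mul_div_cancel_left _ (by omega), Nat.mul_mod_right]
      constructor
      · rw [add_mul]; omega
      · rw [add_mul]; omega
  rw [splitIdx, ← hc, hdiv, hmod, hnext.1, hnext.2]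
  rcases Nat.lt_or_ge r h with h1 | h1
  · rw [Nat.div_eq_of_lt h1, Nat.mod_eq_of_lt h1]
    omega
  · have h2 : r / h = 1 := Nat.div_eq_of_lt_le (by omega) (by omega)
    have h3 : r % h = r - h := by rw [Nat.mod_eq_sub_mod h1, Nat.mod_eq_of_lt (by omega)]
    rw [h2, h3]
    omega

theorem splitTrace_streamed {h : ℕ} (hh : 0 < h) (N : ℕ) : Streamed (splitTrace N h) := by
  refine streamed_flatMap_range (fun d p => if d = 0 then 3 * p else
    if d = 1 then 3 * (p / (2 * h) * h + min (p % (2 * h)) h) else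
      3 * (p / (2 * h) * h + (p % (2 * h) - h))) N (fun d p => ?_) fun d p => ?_
  · have := splitIdx_count hh p
    by_cases hp : p / h % 2 = 0
    · have := this.1 hp; split_ifs <;> omega
    · have := this.2 hp; split_ifs <;> omega
  · have := splitIdx_count hh p
    simp only [splitStepTrace, splitDisk, addrs_append, addrs_acc3]
    by_cases hp : p / h % 2 = 0
    · obtain ⟨h1, h2, h3⟩ := this.1 hp
      rw [h1, h2, h3]
      fin_cases d
      · simp [hp, show 3 * (p + 1) - 3 * p = 3 by omega]
      · simp [hp, show ∀ z, 3 * (z + 1) - 3 * z = 3 by omega]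
      · simp [hp]
    · obtain ⟨h1, h2, h3⟩ := this.2 hp
      rw [h1, h2, h3]
      fin_cases d
      · simp [hp, show 3 * (p + 1) - 3 * p = 3 by omega]
      · simp [hp]
      · simp [hp, show ∀ z, 3 * (z + 1) - 3 * z = 3 by omega]

/-- How the two input disks alternate depends on `L`, but on each disk separately the cursor only
moves forward, one record ahead of `mergeState`. Regions are counted per disk, so the bound is
uniform in the data. -/
theorem mergeTrace_streamed (N h : ℕ) (L : ℕ → ℕ → Prop) [DecidableRel L] :
    Streamed (mergeTrace N h L) := by
  intro d
  have key := fun d => addrs_flatMap_range d (mergeStepTrace h L)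
    (fun p => if d = 0 then 3 * p else if d = 1 then 3 * ((mergeState h L p).1 + 1) else
      3 * ((mergeState h L p).2 + 1)) N
    (fun p => by
      have := mergeState_mono (h := h) (L := L) (Nat.le_succ p)
      rw [Nat.succ_eq_add_one] at this
      split_ifs <;> omega)
    (fun p => by
      simp only [mergeStepTrace, addrs_append, addrs_acc3, mergeState]
      by_cases hT : TakeFst h L p (mergeState h L p)
      · simp only [hT, if_true, addrs_acc3]
        fin_cases d
        · simp [show 3 * (p + 1) - 3 * p = 3 by omega]
        · simp [show ∀ z, 3 * (z + 1 + 1) - 3 * (z + 1) = 3 by omega]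
        · simp
      · simp only [hT, if_false, addrs_acc3]
        fin_cases d
        · simp [show 3 * (p + 1) - 3 * p = 3 by omega]
        · simp
        · simp [show ∀ z, 3 * (z + 1 + 1) - 3 * (z + 1) = 3 by omega])
  obtain ⟨h1, h2⟩ := key d
  rw [mergeTrace, addrs_append, addrs_append, h2, addrs_acc3, addrs_acc3]
  fin_cases d
  · exact ⟨0, 3 * N, by simp⟩
  · simp only [Fin.mk_one, Fin.isValue, Fin.reduceEq, if_false, if_true, List.append_nil,
      mergeState]
    exact ⟨_, _, List.range'_append_1⟩
  · simp only [Fin.reduceFinMk, Fin.isValue, Fin.reduceEq, if_false, if_true, List.nil_append,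
      mergeState]
    exact ⟨_, _, List.range'_append_1⟩

theorem addrs_single (d d' : Fin 3) (w : Bool) (q : ℕ) (l : List (Access 3)) :
    addrs d (⟨w, d', q⟩ :: l) = if d' = d then q :: addrs d l else addrs d l := by
  by_cases h : d' = d <;> simp [addrs, h]

theorem labelTrace_streamed (n : ℕ) : Streamed (labelTrace n) := by
  refine streamed_flatMap_range (fun d p => if d = 0 then p else if d = 1 then 3 * p else 0) n
    (fun d p => by split_ifs <;> omega) fun d p => ?_
  rw [addrs_single, addrs_acc3]
  fin_cases d
  · simp
  · simp [show 3 * (p + 1) - 3 * p = 3 by omega]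
  · simp

theorem extractTrace_streamed (N n : ℕ) : Streamed (extractTrace N n) := by
  refine streamed_flatMap_range (fun d p => if d = 0 then 3 * (N - n + p) else
    if d = 1 then p else 0) n
    (fun d p => by split_ifs <;> omega) fun d p => ?_
  rw [addrs_append, addrs_single, addrs_acc3]
  fin_cases d
  · simp [addrs, show 3 * (N - n + (p + 1)) - 3 * (N - n + p) = 3 by omega]
  · simp [addrs]
  · simp [addrs]

theorem copyBackTrace_streamed (n : ℕ) : Streamed (copyBackTrace n) := by
  refine streamed_flatMap_range (fun d p => if d = 2 then 0 else p) n
    (fun d p => by split_ifs <;> omega) fun d p => ?_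
  rw [addrs_single, addrs_single]
  fin_cases d <;> simp [addrs]

end Regions


/-! ### Rounds and the bitonic sorter as programs. -/

section Network

variable {b : ℕ} {ω : ℕ → Fin (2 ^ b)} {dec : ℕ → Rec} {a : ℕ → ℕ}

/-- The first `N` records of disk `0` encode the array `a` of ranks. -/
def Holds (dec : ℕ → Rec) (N : ℕ) (a : ℕ → ℕ) (m : Mem 3) : Prop :=
  ∀ p < N, getRec (m.disk 0) p = dec (a p)

/-- One round of a sorting network on disk `0`. -/
def netRound (sw : Expr) : Prog 3 := .seq split (combine sw)

def netRoundTrace (M h : ℕ) : List (Access 3) := splitTrace (2 * M) h ++ combineTrace M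

theorem runs_netRound {sw : Expr} (hsw : sw.cost ≤ 80) {M h : ℕ} {m : Mem 3}
    (S : ℕ → ℕ → ℕ → Bool) (hM : m.reg 3 = 2 * M) (h4 : m.reg 4 = h) (hh : 0 < h) (hd : h ∣ M)
    (hb : 6 * M + 6 < 2 ^ b) (ha : Holds dec (2 * M) a m)
    (hS : ∀ q < M, ∀ reg : ℕ → ℕ, (∀ r < 10, reg r = m.reg r) → reg 10 = q → ∀ x y,
      regRec reg 20 = dec x → regRec reg 23 = dec y → (sw.eval b reg ≠ 0 ↔ S q x y = true)) :
    Runs b ω (netRound sw) m (900 * (M + 1)) (netRoundTrace M h)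
      (fun m' => Frame m m' ∧ Holds dec (2 * M) (round h S a) m') := by
  refine ((runs_split (fun p => dec (a p)) hM h4 hh hd hb ha).seq fun m1 ⟨hf, hm1⟩ =>
    (runs_combine hsw (fun q => dec (a (pos h q 0))) (fun q => dec (a (pos h q 1)))
      (fun q => S q (a (pos h q 0)) (a (pos h q 1)) = true)
      ((hf.1 3 (by omega)).trans hM) hb (fun q hq => (hm1 q hq).1) (fun q hq => (hm1 q hq).2)
      fun q hq reg hr h10 hU hV => hS q hq reg (fun r hr' => (hr r hr').trans (hf.1 r hr')) h10 _ _
        hU hV).mono (T' := 300 * (M + 1)) le_rfl rfl fun m2 hm2 => (⟨hf.trans hm2.1, ?_⟩ :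
        Frame m m2 ∧ Holds dec (2 * M) (round h S a) m2)).mono (by omega) rfl fun _ h => h
  intro p hp
  rcases Nat.even_or_odd' p with ⟨q, rfl | rfl⟩
  · rw [(hm2.2 q (by omega)).1, round_even]
    split_ifs <;> rfl
  · rw [(hm2.2 q (by omega)).2, round_odd]
    split_ifs <;> rfl

/-- `1` if the chunks of the current pair are to be merged in descending order. -/
def descExpr : Expr :=
  .bin .mul (.bin .lt (.reg 4) (.reg 7)) (.bin .mod (.bin .div (.reg 10) (.reg 4)) (.const 2))

def bitonicSwapExpr (lt gt : Expr) : Expr :=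
  .bin .add (.bin .mul descExpr lt) (.bin .mul (.bin .eq descExpr (.const 0)) gt)

theorem eval_bitonicSwapExpr {α : Type*} [LinearOrder α] {κ : ℕ → α} {h H q x y : ℕ}
    {lt gt : Expr} {reg : ℕ → ℕ} (hb : 2 < 2 ^ b) (h4 : reg 4 = h) (h7 : reg 7 = H)
    (h10 : reg 10 = q) (hlt : lt.eval b reg = if κ x < κ y then 1 else 0)
    (hgt : gt.eval b reg = if κ y < κ x then 1 else 0) :
    (bitonicSwapExpr lt gt).eval b reg ≠ 0 ↔ bitonicSwap κ h H q x y = true := by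
  have hsel : descExpr.eval b reg = if h < H ∧ q / h % 2 = 1 then 1 else 0 := by
    have := eval_mul (b := b) (eval_lt (eval_reg h4) (eval_reg h7) (by omega))
      (eval_mod (eval_div (eval_reg h10) (eval_reg h4)) (eval_const hb)) (by
        split_ifs <;> omega)
    rw [descExpr, this]
    rcases Nat.mod_two_eq_zero_or_one (q / h) with e | e <;> by_cases h' : h < H <;> simp [e, h']
  have hall := eval_add (b := b) (eval_mul hsel hlt (by split_ifs <;> omega))
    (eval_mul (eval_eq hsel (eval_const (x := 0) (by omega)) (by omega)) hgt
      (by split_ifs <;> omega)) (by split_ifs <;> omega)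
  rw [bitonicSwapExpr, hall, bitonicSwap]
  by_cases hd : h < H ∧ q / h % 2 = 1
  · by_cases h1 : κ x < κ y <;> simp [hd, h1]
  · by_cases h1 : κ y < κ x <;> simp [hd, h1]

/-- Sort the blocks of `2 * H` records on disk `0`, where register `7` holds `H`. -/
def bitonic (sw : Expr) : Prog 3 :=
  .seq (.assign 4 (.const 1)) <|
  .loop (.bin .lt (.reg 4) (.bin .add (.reg 7) (.const 1))) <|
  .seq (.assign 5 (.const 1)) <|
  .seq (.loop (.bin .lt (.reg 5) (.bin .add (.reg 4) (.const 1)))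
    (.seq (netRound sw) (.assign 5 (.bin .mul (.const 2) (.reg 5)))))
  (.assign 4 (.bin .mul (.const 2) (.reg 4)))

def bitonicTrace (M s : ℕ) : List (Access 3) :=
  (List.range s).flatMap fun k => (List.range (k + 1)).flatMap fun _ => netRoundTrace M (2 ^ k)

theorem runs_assign {i v : ℕ} {e : Expr} {m : Mem 3} (he : e.eval b m.reg = v)
    {T : ℕ} (hT : 1 + e.cost ≤ T) :
    Runs b ω (.assign i e : Prog 3) m T [] fun m' =>
      m' = ⟨Function.update m.reg i v, m.disk, m.coins⟩ :=
  (Runs.straight rfl rfl (by simp [Prog.sem, he])).mono hT rfl fun _ h => h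

theorem Runs.assign {i v : ℕ} {e : Expr} {m : Mem 3} {Q : Mem 3 → Prop}
    (he : e.eval b m.reg = v) (hQ : Q ⟨Function.update m.reg i v, m.disk, m.coins⟩) {T : ℕ}
    (hT : 1 + e.cost ≤ T) : Runs b ω (.assign i e : Prog 3) m T [] Q :=
  (runs_assign he hT).mono le_rfl rfl (by rintro _ rfl; exact hQ)

/-- Registers `4` and `5` hold `2 ^ k` and `2 ^ t`, for the stage and the round. Counting by
doubling avoids logarithms: the test `2 ^ t ≤ 2 ^ k` allows exactly `k + 1` rounds. Only these two
parameter registers change, so the keys may depend on the others. -/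
theorem runs_bitonic {α : Type*} [LinearOrder α] {κ : ℕ → α} {lt gt : Expr}
    (hlt : lt.cost ≤ 23) (hgt : gt.cost ≤ 23) {M s : ℕ} {m : Mem 3} (hM : m.reg 3 = 2 * M)
    (h7 : m.reg 7 = 2 ^ s) (hd : 2 ^ s ∣ M) (hMpos : 0 < M) (hb : 6 * M + 6 < 2 ^ b)
    (ha : Holds dec (2 * M) a m)
    (hS : ∀ reg : ℕ → ℕ, (∀ r < 10, r ≠ 4 → r ≠ 5 → reg r = m.reg r) → ∀ x y,
      regRec reg 20 = dec x → regRec reg 23 = dec y →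
      lt.eval b reg = (if κ x < κ y then 1 else 0) ∧
      gt.eval b reg = if κ y < κ x then 1 else 0) :
    Runs b ω (bitonic (bitonicSwapExpr lt gt)) m (1000 * (M + 1) * (s + 2) ^ 2)
      (bitonicTrace M (s + 1))
      (fun m' => (∀ r < 10, r ≠ 4 → r ≠ 5 → m'.reg r = m.reg r) ∧
        Holds dec (2 * M) (bitonicSort κ (2 ^ s) (s + 1) a) m') := by
  have hsM : 2 ^ s ≤ M := Nat.le_of_dvd hMpos hd
  have hcost : (bitonicSwapExpr lt gt).cost ≤ 80 := by
    simp only [bitonicSwapExpr, descExpr, Expr.cost]; omega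
  have inner : ∀ k ≤ s, ∀ m1 : Mem 3, m1.reg 4 = 2 ^ k → m1.reg 5 = 1 →
      (∀ r < 10, r ≠ 4 → r ≠ 5 → m1.reg r = m.reg r) → ∀ a1, Holds dec (2 * M) a1 m1 →
      Runs b ω (.loop (.bin .lt (.reg 5) (.bin .add (.reg 4) (.const 1)))
        (.seq (netRound (bitonicSwapExpr lt gt)) (.assign 5 (.bin .mul (.const 2) (.reg 5))))) m1
        ((k + 2) * (910 * (M + 1)))
        ((List.range (k + 1)).flatMap fun _ => netRoundTrace M (2 ^ k))
        (fun m' => m'.reg 4 = 2 ^ k ∧ (∀ r < 10, r ≠ 4 → r ≠ 5 → m'.reg r = m.reg r) ∧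
          Holds dec (2 * M) ((round (2 ^ k) (bitonicSwap κ (2 ^ k) (2 ^ s)))^[k + 1] a1) m') := by
    intro k hk m1 h4 h5 hr a1 ha1
    have hks : 2 ^ k ≤ 2 ^ s := Nat.pow_le_pow_right two_pos hk
    have hcond : ∀ t ≤ k + 1, ∀ m2 : Mem 3, m2.reg 4 = 2 ^ k → m2.reg 5 = 2 ^ t →
        (Expr.bin .lt (.reg 5) (.bin .add (.reg 4) (.const 1))).eval b m2.reg =
          if t ≤ k then 1 else 0 := by
      intro t ht m2 e4 e5
      rw [eval_lt (eval_reg e5) (eval_add (eval_reg e4) (eval_const (x := 1) (by omega))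
        (by omega)) (by omega)]
      simp [Nat.pow_le_pow_iff_right]
    refine (Runs.loop (T := 900 * (M + 1) + 4) (fun t m' => m'.reg 4 = 2 ^ k ∧ m'.reg 5 = 2 ^ t ∧
      (∀ r < 10, r ≠ 4 → r ≠ 5 → m'.reg r = m.reg r) ∧
      Holds dec (2 * M) ((round (2 ^ k) (bitonicSwap κ (2 ^ k) (2 ^ s)))^[t] a1) m')
      (fun _ => netRoundTrace M (2 ^ k)) (k + 1) ⟨h4, h5, hr, ha1⟩ ?_ ?_).mono ?_ rfl
      fun m' hm' => ⟨hm'.1, hm'.2.2⟩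
    · rintro t ht m2 ⟨e4, e5, er, ea⟩
      refine ⟨by rw [hcond t (by omega) m2 e4 e5, if_pos (by omega)]; exact one_ne_zero, ?_⟩
      have htk : 2 ^ t ≤ 2 ^ k := Nat.pow_le_pow_right two_pos (by omega)
      refine ((runs_netRound hcost (bitonicSwap κ (2 ^ k) (2 ^ s))
        ((er 3 (by omega) (by omega) (by omega)).trans hM) e4 (by positivity)
        ((pow_dvd_pow 2 hk).trans hd) hb ea ?_).seq (T' := 4) fun m3 ⟨hf, hm3⟩ =>
          Runs.assign (v := 2 ^ (t + 1)) ?_ ?_ le_rfl).mono le_rfl (by simp)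
            fun _ h => h
      · intro q hq reg hreg h10 x y hx hy
        obtain ⟨k1, k2⟩ := hS reg (fun r hr' h1 h2 => (hreg r hr').trans (er r hr' h1 h2)) x y hx hy
        exact eval_bitonicSwapExpr (by omega) ((hreg 4 (by omega)).trans e4)
          ((hreg 7 (by omega)).trans ((er 7 (by omega) (by omega) (by omega)).trans h7)) h10 k1 k2
      · rw [pow_succ']
        exact eval_mul (eval_const (by omega)) (eval_reg ((hf.1 5 (by omega)).trans e5)) (by omega)
      · refine ⟨by simpa using (hf.1 4 (by omega)).trans e4, by simp, fun r hr' h1 h2 => ?_, ?_⟩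
        · simpa [h2] using (hf.1 r hr').trans (er r hr' h1 h2)
        · rw [Function.iterate_succ_apply']
          exact hm3
    · rintro m2 ⟨e4, e5, -⟩
      rw [hcond _ le_rfl m2 e4 e5, if_neg (by omega)]
    · exact Nat.mul_le_mul_left _ (by simp only [Expr.cost]; omega)
  have hcond : ∀ k ≤ s + 1, ∀ m2 : Mem 3, m2.reg 4 = 2 ^ k → m2.reg 7 = 2 ^ s →
      (Expr.bin .lt (.reg 4) (.bin .add (.reg 7) (.const 1))).eval b m2.reg =
        if k ≤ s then 1 else 0 := by
    intro t ht m2 e4 e5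
    rw [eval_lt (eval_reg e4) (eval_add (eval_reg e5) (eval_const (x := 1) (by omega))
      (by omega)) (by omega)]
    simp [Nat.pow_le_pow_iff_right]
  refine ((runs_assign (i := 4) (v := 1) (eval_const (by omega)) (T := 2) le_rfl).seq
    fun m0 hm0 => Runs.loop (T := 2 + ((s + 2) * (910 * (M + 1)) + 4))
      (fun k m' => m'.reg 4 = 2 ^ k ∧ (∀ r < 10, r ≠ 4 → r ≠ 5 → m'.reg r = m.reg r) ∧
        Holds dec (2 * M) (bitonicSort κ (2 ^ s) k a) m')
      (fun k => (List.range (k + 1)).flatMap fun _ => netRoundTrace M (2 ^ k)) (s + 1) ?_ ?_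
      ?_).mono ?_ rfl fun m' hm' => hm'.2
  · subst hm0
    exact ⟨by simp, fun r hr h1 h2 => by simp [h1], ha⟩
  · rintro k hk m1 ⟨e4, er, ea⟩
    have e7 := (er 7 (by omega) (by omega) (by omega)).trans h7
    have hks : 2 ^ k ≤ 2 ^ s := Nat.pow_le_pow_right two_pos (by omega)
    refine ⟨by rw [hcond k (by omega) m1 e4 e7, if_pos (by omega)]; exact one_ne_zero, ?_⟩
    refine ((runs_assign (i := 5) (v := 1) (eval_const (by omega)) (T := 2) le_rfl).seq
      fun m2 hm2 => ((inner k (by omega) m2 (by simpa [hm2] using e4) (by simp [hm2])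
        (fun r hr h1 h2 => by simpa [hm2, h2] using er r hr h1 h2) (bitonicSort κ (2 ^ s) k a)
        (by rw [hm2]; exact ea)).mono
          (Nat.mul_le_mul_right _ (show k + 2 ≤ s + 2 by omega)) rfl fun _ h => h).seq
        fun m3 ⟨f4, fr, fa⟩ => Runs.assign (i := 4) (v := 2 ^ (k + 1)) ?_ ?_ (T := 4) le_rfl).mono
        le_rfl (by simp) fun _ h => h
    · rw [pow_succ']
      exact eval_mul (eval_const (by omega)) (eval_reg f4) (by omega)
    · exact ⟨by simp, fun r hr h1 h2 => by simpa [h1] using fr r hr h1 h2, fa⟩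
  · rintro m2 ⟨e4, er, -⟩
    rw [hcond _ le_rfl m2 e4 ((er 7 (by omega) (by omega) (by omega)).trans h7),
      if_neg (by omega)]
  · simp only [Expr.cost]
    nlinarith [sq_nonneg s, Nat.zero_le (s * M)]

end Network


/-! ### The routing, sorting and merging phases as programs. -/

section Phases

variable {b : ℕ} {ω : ℕ → Fin (2 ^ b)} {dec : ℕ → Rec} {a : ℕ → ℕ}

/-- The machine tests bits of the full random word, while the analysis uses it modulo `2 ^ m`; the
bits used agree. -/
theorem mod_two_pow_div_mod_two {j m : ℕ} (h : j < m) (y : ℕ) :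
    y % 2 ^ m / 2 ^ j % 2 = y / 2 ^ j % 2 := by
  obtain ⟨i, rfl⟩ := Nat.exists_eq_add_of_lt h
  rw [show 2 ^ (j + i + 1) = 2 ^ j * 2 ^ (i + 1) by ring, Nat.mod_mul_right_div_self,
    Nat.mod_mod_of_dvd _ (dvd_pow_self 2 (by omega))]

/-- The sorting key of the record in registers `i`, `i + 1`, `i + 2` on the current level. -/
def routeKeyExpr (i : ℕ) : Expr :=
  .bin .add (.bin .eq (.reg (i + 1)) (.const 0))
    (.bin .mul (.const 2) (.bin .mod (.bin .div (.reg (i + 2)) (.reg 6)) (.const 2)))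

theorem eval_routeKeyExpr {lab : ℕ → ℕ} {j m i x : ℕ} {reg : ℕ → ℕ} (hj : j < m)
    (hlab : ∀ x, lab x = (dec x).2.2 % 2 ^ m) (htag : ∀ x, (dec x).2.1 = 0 ↔ x = 0)
    (hzero : (dec 0).2.2 = 0) (h6 : reg 6 = 2 ^ j) (hx : regRec reg i = dec x) (hb : 3 < 2 ^ b) :
    (routeKeyExpr i).eval b reg = routeKey lab (2 ^ j) x := by
  have h1 : reg (i + 1) = (dec x).2.1 := by rw [← hx]; rfl
  have h2 : reg (i + 2) = (dec x).2.2 := by rw [← hx]; rfl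
  have hmod : (dec x).2.2 / 2 ^ j % 2 < 2 := Nat.mod_lt _ two_pos
  rw [routeKeyExpr, eval_add (eval_eq (eval_reg h1) (eval_const (x := 0) (by omega)) (by omega))
    (eval_mul (eval_const (x := 2) (by omega)) (eval_mod (eval_div (eval_reg h2) (eval_reg h6))
      (eval_const (x := 2) (by omega))) (by omega)) (by split_ifs <;> omega), routeKey, hlab,
    mod_two_pow_div_mod_two hj]
  by_cases h0 : x = 0
  · subst h0
    simp [hzero, (htag 0).2 rfl]
  · simp [h0, (htag x).not.2 h0]

/-- Send every record to the bucket given by its label. -/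
def routePhase : Prog 3 :=
  .seq (.assign 6 (.bin .div (.reg 3) (.reg 2))) <|
  .loop (.bin .lt (.const 1) (.reg 6)) <|
  .seq (.assign 6 (.bin .div (.reg 6) (.const 2))) <|
  .seq (.assign 4 (.bin .div (.reg 3) (.const 2))) <|
  .seq (netRound (.const 0)) <|
  .seq (.assign 7 (.reg 2)) <|
  bitonic (bitonicSwapExpr (.bin .lt (routeKeyExpr 20) (routeKeyExpr 23))
    (.bin .lt (routeKeyExpr 23) (routeKeyExpr 20)))

def routeTrace (M w m : ℕ) : List (Access 3) :=
  (List.range m).flatMap fun _ => netRoundTrace M M ++ bitonicTrace M (w + 1)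

/-- Register `6` is loop counter and bit selector at once: it is halved from `2 ^ m` down to `1`,
and dividing a label by it exposes the bit of the level. -/
theorem runs_routePhase {lab : ℕ → ℕ} {M w m : ℕ} {s : Mem 3} (h2 : s.reg 2 = 2 ^ w)
    (h3 : s.reg 3 = 2 * M) (hM : 2 * M = 2 ^ (w + m)) (hMpos : 0 < M) (hb : 6 * M + 6 < 2 ^ b)
    (hlab : ∀ x, lab x = (dec x).2.2 % 2 ^ m) (htag : ∀ x, (dec x).2.1 = 0 ↔ x = 0)
    (hzero : (dec 0).2.2 = 0) (ha : Holds dec (2 * M) a s) :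
    Runs b ω routePhase s (2000 * (M + 1) * (m + 1) * (w + 2) ^ 2) (routeTrace M w m)
      (fun s' => (∀ r < 4, s'.reg r = s.reg r) ∧ Holds dec (2 * M) (routeArr w m lab a m) s') := by
  have hWM : 2 ^ w ≤ 2 * M := by rw [hM]; exact Nat.pow_le_pow_right two_pos (by omega)
  have hmM : 2 ^ m ≤ 2 * M := by rw [hM]; exact Nat.pow_le_pow_right two_pos (by omega)
  have hcond : ∀ k ≤ m, ∀ s1 : Mem 3, s1.reg 6 = 2 ^ (m - k) →
      (Expr.bin .lt (.const 1) (.reg 6)).eval b s1.reg = if k < m then 1 else 0 := by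
    intro k hk s1 e6
    rw [eval_lt (eval_const (by omega)) (eval_reg e6) (by omega)]
    simp only [Nat.one_lt_two_pow_iff]
    congr 1
    simp only [eq_iff_iff]
    omega
  refine ((runs_assign (i := 6) (v := 2 ^ m) (T := 4) ?_ le_rfl).seq fun s0 hs0 =>
    Runs.loop (T := 1900 * (M + 1) * (w + 2) ^ 2 + 20) (fun k s' => s'.reg 6 = 2 ^ (m - k) ∧
      (∀ r < 4, s'.reg r = s.reg r) ∧ Holds dec (2 * M) (routeArr w m lab a k) s')
      (fun _ => netRoundTrace M M ++ bitonicTrace M (w + 1)) m ?_ ?_ ?_).mono ?_ rfl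
      fun s' hs' => hs'.2
  · rw [eval_div (eval_reg h3) (eval_reg h2), hM, pow_add,
      Nat.mul_div_cancel_left _ (by positivity)]
  · subst hs0
    exact ⟨by simp, fun r hr => by simp [show r ≠ 6 by omega], ha⟩
  · rintro k hk s1 ⟨e6, er, ea⟩
    refine ⟨by rw [hcond k (by omega) s1 e6, if_pos hk]; exact one_ne_zero, ?_⟩
    have hmk : 2 ^ (m - k) = 2 * 2 ^ (m - 1 - k) := by
      rw [show m - k = m - 1 - k + 1 by omega, pow_succ']
    have hM2 : M = 2 ^ (w + (m - 1)) := by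
      have : 2 ^ (w + m) = 2 * 2 ^ (w + (m - 1)) := by
        rw [show w + m = w + (m - 1) + 1 by omega, pow_succ']
      omega
    refine ((Runs.assign (i := 6) (v := 2 ^ (m - 1 - k)) (T := 4)
      (Q := fun s' => s'.reg 6 = 2 ^ (m - 1 - k) ∧ (∀ r < 4, s'.reg r = s.reg r) ∧
        Holds dec (2 * M) (routeArr w m lab a k) s') ?_ ?_ le_rfl).seq fun s2 ⟨f6, fr, fa⟩ =>
      (Runs.assign (i := 4) (v := M) (T := 4)
      (Q := fun s' => s'.reg 4 = M ∧ s'.reg 6 = 2 ^ (m - 1 - k) ∧ (∀ r < 4, s'.reg r = s.reg r) ∧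
        Holds dec (2 * M) (routeArr w m lab a k) s') ?_ ?_ le_rfl).seq fun s3 ⟨g4, g6, gr, ga⟩ =>
      (runs_netRound (by decide) noSwap ((gr 3 (by omega)).trans h3) g4 hMpos dvd_rfl hb ga
        ?_).seq fun s4 ⟨hf, ka⟩ =>
      (Runs.assign (i := 7) (v := 2 ^ w) (T := 2)
      (Q := fun s' => s'.reg 7 = 2 ^ w ∧ s'.reg 6 = 2 ^ (m - 1 - k) ∧
        (∀ r < 4, s'.reg r = s.reg r) ∧
        Holds dec (2 * M) (round M noSwap (routeArr w m lab a k)) s') ?_ ?_ le_rfl).seq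
        fun s5 ⟨l7, l6, lr, la⟩ =>
      (runs_bitonic (κ := routeKey lab (2 ^ (m - 1 - k))) ?_ ?_ ((lr 3 (by omega)).trans h3) l7
        ?_ hMpos hb la ?_).mono (Q' := fun s' => s'.reg 6 = 2 ^ (m - (k + 1)) ∧
        (∀ r < 4, s'.reg r = s.reg r) ∧ Holds dec (2 * M) (routeArr w m lab a (k + 1)) s')
        le_rfl rfl ?_).mono ?_ (by simp) fun _ h => h
    · rw [eval_div (eval_reg e6) (eval_const (x := 2) (by omega)), hmk,
        Nat.mul_div_cancel_left _ two_pos]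
    · exact ⟨by simp, fun r hr => by simpa [show r ≠ 6 by omega] using er r hr, ea⟩
    · rw [eval_div (eval_reg ((fr 3 (by omega)).trans h3)) (eval_const (x := 2) (by omega)),
        Nat.mul_div_cancel_left _ two_pos]
    · exact ⟨by simp, by simpa using f6,
        fun r hr => by simpa [show r ≠ 4 by omega] using fr r hr, fa⟩
    · intro q _ reg _ _ x y _ _
      simp [noSwap, Expr.eval]
    · exact eval_reg ((hf.1 2 (by omega)).trans ((gr 2 (by omega)).trans h2))
    · exact ⟨by simp, by simpa using (hf.1 6 (by omega)).trans g6,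
        fun r hr => by simpa [show r ≠ 7 by omega] using (hf.1 r (by omega)).trans (gr r hr), ka⟩
    · simp [routeKeyExpr, Expr.cost]
    · simp [routeKeyExpr, Expr.cost]
    · rw [hM2]; exact pow_dvd_pow 2 (by omega)
    · intro reg hr x y hx hy
      have hr6 := (hr 6 (by omega) (by omega) (by omega)).trans l6
      have kx := eval_routeKeyExpr (b := b) (show m - 1 - k < m by omega) hlab htag hzero hr6 hx
        (by omega)
      have ky := eval_routeKeyExpr (b := b) (show m - 1 - k < m by omega) hlab htag hzero hr6 hy
        (by omega)
      exact ⟨eval_lt kx ky (by omega), eval_lt ky kx (by omega)⟩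
    · rintro s6 ⟨nr, na⟩
      refine ⟨?_, fun r hr => (nr r (by omega) (by omega) (by omega)).trans (lr r hr), ?_⟩
      · rw [nr 6 (by omega) (by omega) (by omega), l6, show m - 1 - k = m - (k + 1) by omega]
      · rw [routeArr, routeLevel, ← hM, Nat.mul_div_cancel_left _ two_pos]
        exact na
    · nlinarith [Nat.zero_le (M * w), Nat.zero_le w, Nat.zero_le M]
  · rintro s1 ⟨e6, -⟩
    rw [hcond m le_rfl s1 e6, if_neg (lt_irrefl _)]
  · simp only [Expr.cost]
    have h1 : 1900 * (M + 1) * (w + 2) ^ 2 + 20 + 1 + (1 + 1 + 1) + 4 ≤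
        2000 * (M + 1) * (w + 2) ^ 2 := by
      nlinarith [Nat.zero_le (M * w), Nat.zero_le w, Nat.zero_le M]
    have h2 := Nat.mul_le_mul_left (m + 1) h1
    calc _ ≤ (m + 1) * (1900 * (M + 1) * (w + 2) ^ 2 + 20 + 1 + (1 + 1 + 1) + 4) := by
          generalize 1900 * (M + 1) * (w + 2) ^ 2 = X; nlinarith [Nat.zero_le m]
      _ ≤ _ := h2
      _ = _ := by ring

/-- Sort every bucket by value, ties being broken by tag. -/
def sortPhase : Prog 3 :=
  .seq (.assign 7 (.bin .div (.reg 2) (.const 2)))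
    (bitonic (bitonicSwapExpr (lexLt 20 23) (lexLt 23 20)))

theorem runs_sortPhase {M w : ℕ} {s : Mem 3} (h2 : s.reg 2 = 2 ^ (w + 1))
    (h3 : s.reg 3 = 2 * M) (hd : 2 ^ w ∣ M) (hMpos : 0 < M) (hb : 6 * M + 6 < 2 ^ b)
    (hrec : ∀ x y, recLt (dec x) (dec y) ↔ x < y) (ha : Holds dec (2 * M) a s) :
    Runs b ω sortPhase s (1100 * (M + 1) * (w + 2) ^ 2) (bitonicTrace M (w + 1))
      (fun s' => (∀ r < 4, s'.reg r = s.reg r) ∧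
        Holds dec (2 * M) (bitonicSort id (2 ^ w) (w + 1) a) s') := by
  refine ((Runs.assign (i := 7) (v := 2 ^ w) (T := 4) (Q := fun s' => s'.reg 7 = 2 ^ w ∧
    (∀ r < 4, s'.reg r = s.reg r) ∧ Holds dec (2 * M) a s') ?_ ?_ le_rfl).seq
      fun s1 ⟨e7, er, ea⟩ => (runs_bitonic (κ := id) (by decide) (by decide)
        ((er 3 (by omega)).trans h3) e7 hd hMpos hb ea ?_).mono le_rfl rfl fun s2 ⟨fr, fa⟩ =>
        (⟨fun r hr => (fr r (by omega) (by omega) (by omega)).trans (er r hr), fa⟩ :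
          (∀ r < 4, s2.reg r = s.reg r) ∧
            Holds dec (2 * M) (bitonicSort id (2 ^ w) (w + 1) a) s2)).mono ?_ (by simp)
          fun _ h => h
  · rw [eval_div (eval_reg h2) (eval_const (x := 2) (by omega)), pow_succ,
      Nat.mul_div_cancel _ two_pos]
  · exact ⟨by simp, fun r hr => by simp [show r ≠ 7 by omega], ha⟩
  · intro reg _ x y hx hy
    rw [eval_lexLt hx hy (by omega), eval_lexLt hy hx (by omega)]
    simp [hrec]
  · nlinarith [Nat.zero_le (M * w), Nat.zero_le w, Nat.zero_le M]

theorem mergeTrace_congr {N h M : ℕ} {L L' : ℕ → ℕ → Prop} [DecidableRel L] [DecidableRel L']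
    (hN : ∀ p < N, (p / (2 * h) + 1) * h ≤ M) (hL : ∀ i < M, ∀ j < M, L i j ↔ L' i j) :
    mergeTrace N h L = mergeTrace N h L' := by
  obtain ⟨h1, h2⟩ := mergeState_congr hN hL
  simp only [mergeTrace, List.flatMap]
  congr 2
  refine List.map_congr_left fun p hp => ?_
  rw [List.mem_range] at hp
  simp only [mergeStepTrace, h1 p hp.le]
  have := h2 p hp
  rw [h1 p hp.le] at this
  simp only [this]

/-- Merge the sorted buckets pairwise until one sorted run is left. -/
def mergePhase : Prog 3 :=
  .seq (.assign 4 (.reg 2)) <|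
  .loop (.bin .lt (.reg 4) (.reg 3)) <|
  .seq split <| .seq merge (.assign 4 (.bin .mul (.const 2) (.reg 4)))

def mergePhaseTrace (N W m : ℕ) (a : ℕ → ℕ) : List (Access 3) :=
  (List.range m).flatMap fun k => splitTrace N (2 ^ k * W) ++
    mergeTrace N (2 ^ k * W) (runLt (2 ^ k * W) (mergeAll W k a))

theorem runs_mergePhase {M w m : ℕ} {s : Mem 3} (h2 : s.reg 2 = 2 ^ w)
    (h3 : s.reg 3 = 2 * M) (hM : 2 * M = 2 ^ (w + m)) (hMpos : 0 < M) (hb : 6 * (2 * M) + 6 < 2 ^ b)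
    (hrec : ∀ x y, recLt (dec x) (dec y) ↔ x < y) (ha : Holds dec (2 * M) a s) :
    Runs b ω mergePhase s (2000 * (M + 1) * (m + 1)) (mergePhaseTrace (2 * M) (2 ^ w) m a)
      (fun s' => (∀ r < 4, s'.reg r = s.reg r) ∧
        Holds dec (2 * M) (mergeAll (2 ^ w) m a) s') := by
  have hcond : ∀ k ≤ m, ∀ s1 : Mem 3, s1.reg 4 = 2 ^ k * 2 ^ w → s1.reg 3 = 2 * M →
      (Expr.bin .lt (.reg 4) (.reg 3)).eval b s1.reg = if k < m then 1 else 0 := by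
    intro k hk s1 e4 e3
    rw [eval_lt (eval_reg e4) (eval_reg e3) (by omega), hM, ← pow_add]
    simp only [Nat.pow_lt_pow_iff_right (show 1 < 2 by omega)]
    congr 1
    simp only [eq_iff_iff]
    omega
  refine ((Runs.assign (i := 4) (v := 2 ^ w) (T := 2) (Q := fun s' => s'.reg 4 = 2 ^ w ∧
    (∀ r < 4, s'.reg r = s.reg r) ∧ Holds dec (2 * M) a s') (eval_reg h2) ?_ le_rfl).seq
    fun s0 ⟨d4, dr, da⟩ =>
    Runs.loop (T := 1900 * (M + 1)) (fun k s' => s'.reg 4 = 2 ^ k * 2 ^ w ∧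
      (∀ r < 4, s'.reg r = s.reg r) ∧ Holds dec (2 * M) (mergeAll (2 ^ w) k a) s')
      (fun k => splitTrace (2 * M) (2 ^ k * 2 ^ w) ++ mergeTrace (2 * M) (2 ^ k * 2 ^ w)
        (runLt (2 ^ k * 2 ^ w) (mergeAll (2 ^ w) k a))) m ?_ ?_ ?_).mono ?_ rfl
      fun s' hs' => hs'.2
  · exact ⟨by simp, fun r hr => by simp [show r ≠ 4 by omega], ha⟩
  · exact ⟨by simpa using d4, dr, da⟩
  · rintro k hk s1 ⟨e4, er, ea⟩
    have e3 := (er 3 (by omega)).trans h3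
    refine ⟨by rw [hcond k (by omega) s1 e4 e3, if_pos hk]; exact one_ne_zero, ?_⟩
    have hM2 : M = 2 ^ (k + w) * 2 ^ (m - 1 - k) := by
      have : 2 ^ (w + m) = 2 * (2 ^ (k + w) * 2 ^ (m - 1 - k)) := by
        rw [← pow_add, ← pow_succ']; congr 1; omega
      omega
    have hpos : 0 < 2 ^ k * 2 ^ w := by positivity
    have hdvd : 2 ^ k * 2 ^ w ∣ M := ⟨_, by rw [← pow_add]; exact hM2⟩
    have hle := Nat.le_of_dvd hMpos hdvd
    set h := 2 ^ k * 2 ^ w with hh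
    set a1 := mergeAll (2 ^ w) k a with ha1
    have hbound : ∀ p < 2 * M, (p / (2 * h) + 1) * h ≤ M := by
      intro p hp
      obtain ⟨c, hc⟩ := hdvd
      have : p / (2 * h) < c := Nat.div_lt_of_lt_mul (by rw [mul_assoc, ← hc]; exact hp)
      calc (p / (2 * h) + 1) * h ≤ c * h := Nat.mul_le_mul_right _ this
        _ = M := by rw [hc, mul_comm]
    refine ((runs_split (fun p => dec (a1 p)) e3 e4 hpos hdvd (by omega) ea).seq
      fun s2 ⟨hf, fd⟩ => ?_ : Runs b ω _ s1
        (300 * (2 * M + 1) + (300 * (2 * M + 2) + 4)) _ _).mono (by omega) rfl fun _ h => h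
    -- Since `dec` is strictly monotone, comparing records on disk is comparing ranks; the trace
    -- thereby becomes a function of the rank array.
    have hL : ∀ i < M, ∀ j < M, diskLt (s2.disk 1) (s2.disk 2) i j ↔ runLt h a1 i j := by
      intro i hi j hj
      rw [diskLt, (fd i hi).1, (fd j hj).2, hrec, runLt]
    obtain ⟨c1, c2⟩ := mergeState_congr hbound hL
    refine ((runs_merge ((hf.1 3 (by omega)).trans e3) ((hf.1 4 (by omega)).trans e4) hb
      (by omega)).seq fun s3 ⟨hg, gd⟩ => Runs.assign (i := 4) (v := 2 ^ (k + 1) * 2 ^ w) (T := 4)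
        ?_ ?_ le_rfl).mono le_rfl
        (by rw [List.append_nil, mergeTrace_congr hbound hL]) fun _ h => h
    · rw [pow_succ', mul_assoc]
      exact eval_mul (eval_const (by omega)) (eval_reg ((hg.1 4 (by omega)).trans
        ((hf.1 4 (by omega)).trans e4))) (by omega)
    · have gr : ∀ r < 4, s3.reg r = s.reg r := fun r hr =>
        (hg.1 r (by omega)).trans ((hf.1 r (by omega)).trans (er r hr))
      refine ⟨by simp, fun r hr => by simpa [show r ≠ 4 by omega] using gr r hr, fun p hp => ?_⟩
      have hb1 := hbound p hp
      have hb2 := mergeState_bounds (L := runLt h a1) hpos p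
      have hadd := mergeState_add h (runLt h a1) p
      refine (gd p hp).trans ?_
      rw [c1 p hp.le, mergeAll, mergeArr]
      have hc2 := c2 p hp
      rw [c1 p hp.le] at hc2
      by_cases hT : TakeFst h (runLt h a1) p (mergeState h (runLt h a1) p)
      · rw [if_pos (hc2.2 hT), if_pos hT, (fd _ (hT.1.trans_le hb1)).1]
      · rw [if_neg (hc2.not.2 hT), if_neg hT,
          (fd _ ((mergeState_snd_lt hpos hT).trans_le hb1)).2]
  · rintro s1 ⟨e4, er, -⟩
    rw [hcond m le_rfl s1 e4 ((er 3 (by omega)).trans h3), if_neg (lt_irrefl _)]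
  · simp only [Expr.cost]
    nlinarith [Nat.zero_le (M * m), Nat.zero_le m, Nat.zero_le M]

/-- Double register `i` until it is at least twice register `j`. -/
def doubling (i j : ℕ) : Prog 3 :=
  .loop (.bin .lt (.reg i) (.bin .mul (.const 2) (.reg j)))
    (.assign i (.bin .mul (.const 2) (.reg i)))

/-- Only values below `2 * N` are doubled, so `4 * N` bounds everything computed. -/
theorem runs_doubling {i j v N K : ℕ} {s : Mem 3} (hij : j ≠ i) (hi : s.reg i = v)
    (hj : s.reg j = N) (hlt : ∀ k < K, 2 ^ k * v < 2 * N) (hle : 2 * N ≤ 2 ^ K * v)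
    (hb : 4 * N + 2 < 2 ^ b) :
    Runs b ω (doubling i j) s ((K + 1) * 10) []
      (fun s' => s' = ⟨Function.update s.reg i (2 ^ K * v), s.disk, s.coins⟩) := by
  have hcond : ∀ k, (Expr.bin .lt (.reg i) (.bin .mul (.const 2) (.reg j))).eval b
      (Function.update s.reg i (2 ^ k * v)) = if 2 ^ k * v < 2 * N then 1 else 0 := by
    intro k
    exact eval_lt (eval_reg (by simp)) (eval_mul (eval_const (by omega))
      (eval_reg (by simpa [hij] using hj)) (by omega)) (by omega)
  refine (Runs.loop (T := 4) (fun k s' => s' = ⟨Function.update s.reg i (2 ^ k * v), s.disk,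
    s.coins⟩) (fun _ => []) K ?_ ?_ ?_).mono ?_ (by simp) fun _ h => h
  · simp [← hi]
  · rintro k hk _ rfl
    refine ⟨by rw [hcond, if_pos (hlt k hk)]; exact one_ne_zero,
      Runs.assign (v := 2 ^ (k + 1) * v) ?_ (by simp) le_rfl⟩
    have := hlt k hk
    rw [pow_succ', mul_assoc]
    exact eval_mul (eval_const (by omega)) (eval_reg (by simp)) (by omega)
  · rintro _ rfl
    rw [hcond, if_neg (by omega)]
  · simp only [Expr.cost]; omega

end Phases


/-! ### The complete program: execution, running time and number of regions. -/

section Sorter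

variable {b : ℕ} {ω : ℕ → Fin (2 ^ b)} {dec : ℕ → Rec}

/-- The oblivious bucket sort. Register `2` holds the bucket size, a power of two that is at least
`2 * Z`, and register `3` the total size of all buckets, a power of two that is at least
`2 * n`. -/
def bucketSort : Prog 3 :=
  .seq (.assign 2 (.const 2)) <| .seq (doubling 2 1) <|
  .seq (.assign 3 (.reg 2)) <| .seq (doubling 3 0) <|
  .seq label <| .seq (combine (.const 0)) <| .seq routePhase <| .seq sortPhase <|
  .seq mergePhase <| .seq extract copyBack

/-- The accesses of `bucketSort` if `a` is the array of sorted buckets. -/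
def bucketSortTrace (n w m : ℕ) (a : ℕ → ℕ) : List (Access 3) :=
  labelTrace n ++ (combineTrace (2 ^ (w + m)) ++ (routeTrace (2 ^ (w + m)) (w + 1) m ++
    (bitonicTrace (2 ^ (w + m)) (w + 1) ++
      (mergePhaseTrace (2 * 2 ^ (w + m)) (2 ^ (w + 1)) m a ++
        (extractTrace (2 * 2 ^ (w + m)) n ++ copyBackTrace n)))))

/-- The decoding `dec` from ranks to records is abstract: being order preserving, with `0` as the
dummy, is all that the phases need. -/
theorem runs_bucketSort {n Z w m : ℕ} {x : Fin n → Fin (2 ^ b)} {lab a : ℕ → ℕ}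
    (hw : ∀ k < w, 2 ^ k * 2 < 2 * Z) (hZ : 2 * Z ≤ 2 ^ w * 2) (hZn : Z ≤ n)
    (hm : ∀ k < m, 2 ^ k * (2 ^ w * 2) < 2 * n) (hn : 2 * n ≤ 2 ^ m * (2 ^ w * 2))
    (hb : 12 * 2 ^ (w + m) + 6 < 2 ^ b)
    (hlab : ∀ r, lab r = (dec r).2.2 % 2 ^ m) (htag : ∀ r, (dec r).2.1 = 0 ↔ r = 0)
    (hzero : dec 0 = (0, 0, 0)) (hrec : ∀ r r', recLt (dec r) (dec r') ↔ r < r')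
    (heven : ∀ q, dec (a (2 * q)) =
      if h : q < n then ((x ⟨q, h⟩ : ℕ), q + 1, (ω q : ℕ)) else (0, 0, 0))
    (hodd : ∀ q, a (2 * q + 1) = 0) :
    ∃ s : State 3, Exec b ω bucketSort (init n Z x) s ∧
      s.time ≤ 10000 * (2 ^ (w + m) + 1) * (m + 1) * (w + 3) ^ 2 ∧
      s.trace = bucketSortTrace n w m (bitonicSort id (2 ^ w) (w + 1)
        (routeArr (w + 1) m lab a m)) ∧
      ∀ q < n, s.disk 0 q = (dec (mergeAll (2 ^ (w + 1)) m (bitonicSort id (2 ^ w) (w + 1)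
        (routeArr (w + 1) m lab a m)) (2 * 2 ^ (w + m) - n + q))).1 := by
  set M := 2 ^ (w + m) with hM
  have hMW : 2 ^ m * (2 ^ w * 2) = 2 * M := by rw [hM, pow_add]; ring
  have hM2 : 2 * M = 2 ^ (w + 1 + m) := by rw [hM]; ring
  have hnM : n ≤ M := by omega
  have hMpos : 0 < M := by positivity
  have hdvd : 2 ^ w ∣ M := pow_dvd_pow 2 (by omega)
  set D := (init n Z x : State 3).disk with hD
  have hD0 : ∀ q (h : q < n), D 0 q = x ⟨q, h⟩ := fun q h => by simp [hD, init, h]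
  have hD1 : ∀ q, D 1 q = 0 := fun q => by simp [hD, init]
  have hD2 : ∀ q, D 2 q = 0 := fun q => by simp [hD, init]
  let Env : Mem 3 → Prop := fun s => s.reg 0 = n ∧ s.reg 2 = 2 ^ (w + 1) ∧ s.reg 3 = 2 * M
  have env : ∀ {s s' : Mem 3}, Env s → (∀ r < 4, s'.reg r = s.reg r) → Env s' :=
    fun h hr => ⟨(hr 0 (by omega)).trans h.1, (hr 2 (by omega)).trans h.2.1,
      (hr 3 (by omega)).trans h.2.2⟩
  have run := ((runs_assign (b := b) (ω := ω) (i := 2) (v := 2) (e := .const 2) (T := 2)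
    (m := ⟨(init n Z x : State 3).reg, D, 0⟩) (eval_const (by omega)) le_rfl).seq fun s1 hs1 =>
    (runs_doubling (i := 2) (j := 1) (v := 2) (N := Z) (K := w) (s := s1) (by omega)
      (by simp [hs1]) (by simp [hs1, init]) hw hZ (by omega)).seq fun s2 hs2 =>
    (runs_assign (i := 3) (v := 2 ^ w * 2) (e := .reg 2) (T := 2) (m := s2)
      (eval_reg (by simp [hs2])) le_rfl).seq fun s3 hs3 =>
    (runs_doubling (i := 3) (j := 0) (v := 2 ^ w * 2) (N := n) (K := m) (s := s3) (by omega)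
      (by simp [hs3]) (by simp [hs3, hs2, hs1, init]) hm hn (by omega)).seq fun s4 hs4 =>
    have h4 : Env s4 ∧ s4.disk = D ∧ s4.coins = 0 := by
      refine ⟨⟨by simp [hs4, hs3, hs2, hs1, init], ?_, ?_⟩, by simp [hs4, hs3, hs2, hs1],
        by simp [hs4, hs3, hs2, hs1]⟩
      · simp [hs4, hs3, hs2, pow_succ]
      · simp [hs4, hMW]
    (runs_label h4.1.1 h4.2.2 (by omega)).seq fun s5 ⟨r5, l5, l5', d5⟩ =>
    (runs_combine (sw := .const 0) (by decide) (fun q => getRec (s5.disk 1) q)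
      (fun q => getRec (s5.disk 2) q) (fun _ => False) ((env h4.1 fun r hr => r5 r (by omega)).2.2)
      (by omega) (fun _ _ => rfl) (fun _ _ => rfl)
      (fun q _ reg _ _ _ _ => by simp [Expr.eval])).seq fun s6 ⟨f6, c6⟩ =>
    have e6 : Env s6 := env (env h4.1 fun r hr => r5 r (by omega)) fun r hr => f6.1 r (by omega)
    have a6 : Holds dec (2 * M) a s6 := by
      intro p hp
      rcases Nat.even_or_odd' p with ⟨q, rfl | rfl⟩
      · rw [(c6 q (by omega)).1, heven, if_neg not_false]
        split_ifs with hq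
        · rw [l5 q hq, h4.2.1, hD0 q hq]
        · rw [l5' q (by omega), h4.2.1]
          simp [getRec, hD1]
      · rw [(c6 q (by omega)).2, hodd, hzero, if_neg not_false, d5, h4.2.1]
        simp [getRec, hD2]
    (runs_routePhase e6.2.1 e6.2.2 hM2 hMpos (by omega) hlab htag (by rw [hzero]) a6).seq
      fun s7 ⟨r7, a7⟩ =>
    (runs_sortPhase (env e6 r7).2.1 (env e6 r7).2.2 hdvd hMpos (by omega) hrec a7).seq
      fun s8 ⟨r8, a8⟩ =>
    (runs_mergePhase (env (env e6 r7) r8).2.1 (env (env e6 r7) r8).2.2 hM2 hMpos (by omega) hrec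
      a8).seq fun s9 ⟨r9, a9⟩ =>
    have e9 : Env s9 := env (env (env e6 r7) r8) r9
    (runs_extract e9.1 e9.2.2 (by omega) (by omega)).seq fun s10 ⟨f10, d10⟩ =>
    (runs_copyBack ((f10.1 0 (by omega)).trans e9.1) (by omega)).mono (Q' := fun s =>
      ∀ q < n, s.disk 0 q = (dec (mergeAll (2 ^ (w + 1)) m (bitonicSort id (2 ^ w) (w + 1)
        (routeArr (w + 1) m lab a m)) (2 * M - n + q))).1) le_rfl rfl fun s11 d11 q hq => by
          rw [d11 q hq, d10 q hq, a9 _ (by omega)]) 0 []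
  obtain ⟨s, time, h1, h2, h3⟩ := run
  refine ⟨s.toState time _, h1, ?_, ?_, h3⟩
  · refine h2.trans ?_
    have k1 : n ≤ M + 1 := by omega
    -- This and `k3` absorb the cost of the two doubling loops into the cost of a pass.
    have k2 : w ≤ M := by
      calc w ≤ 2 ^ w := Nat.lt_two_pow_self.le
        _ ≤ M := Nat.pow_le_pow_right two_pos (by omega)
    have k3 : m ≤ M := by
      calc m ≤ 2 ^ m := Nat.lt_two_pow_self.le
        _ ≤ M := Nat.pow_le_pow_right two_pos (by omega)
    have k4 : (M + 1) * 1 ≤ (M + 1) * ((m + 1) * (w + 3) ^ 2) :=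
      Nat.mul_le_mul_left _ (Nat.succ_le_of_lt (by positivity))
    have k5 : (M + 1) * (w + 2) ^ 2 ≤ (M + 1) * ((m + 1) * (w + 3) ^ 2) :=
      Nat.mul_le_mul_left _ (by nlinarith [Nat.zero_le (m * (w + 3) ^ 2)])
    have k6 : (M + 1) * (m + 1) ≤ (M + 1) * ((m + 1) * (w + 3) ^ 2) :=
      Nat.mul_le_mul_left _ (by nlinarith [Nat.zero_le (m * w), Nat.zero_le (m * w ^ 2)])
    have e1 : 2000 * (M + 1) * (m + 1) * (w + 1 + 2) ^ 2 =
      2000 * ((M + 1) * ((m + 1) * (w + 3) ^ 2)) := by ring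
    have e2 : 1100 * (M + 1) * (w + 2) ^ 2 = 1100 * ((M + 1) * (w + 2) ^ 2) := by ring
    have e3 : 2000 * (M + 1) * (m + 1) = 2000 * ((M + 1) * (m + 1)) := by ring
    have e4 : 10000 * (M + 1) * (m + 1) * (w + 3) ^ 2 =
      10000 * ((M + 1) * ((m + 1) * (w + 3) ^ 2)) := by ring
    rw [e1, e2, e3, e4]
    omega
  · simp [Mem.toState, bucketSortTrace, ← hM]

theorem numRegions_netRoundTrace {h : ℕ} (hh : 0 < h) (M : ℕ) :
    numRegions (netRoundTrace M h) ≤ 6 :=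
  (numRegions_append_le _ _).trans
    (add_le_add (splitTrace_streamed hh _).numRegions_le (combineTrace_streamed _).numRegions_le)

theorem numRegions_bitonicTrace (M s : ℕ) : numRegions (bitonicTrace M s) ≤ s * (s * 6) := by
  refine (numRegions_flatMap_le _ _ (s * 6) fun k hk => ?_).trans_eq (by simp)
  rw [List.mem_range] at hk
  refine (numRegions_flatMap_le _ _ 6 fun _ _ =>
    numRegions_netRoundTrace (by positivity) _).trans ?_
  rw [List.length_range]
  omega

theorem numRegions_bucketSortTrace (n w m : ℕ) (a : ℕ → ℕ) :
    numRegions (bucketSortTrace n w m a) ≤ 30 * (m + 1) * (w + 3) ^ 2 := by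
  have h1 : numRegions (routeTrace (2 ^ (w + m)) (w + 1) m) ≤
      m * (6 + (w + 2) * ((w + 2) * 6)) := by
    refine (numRegions_flatMap_le _ _ _ fun k hk => ?_).trans_eq (by rw [List.length_range])
    exact (numRegions_append_le _ _).trans (add_le_add
      (numRegions_netRoundTrace (by positivity) _) (numRegions_bitonicTrace _ _))
  have h2 : numRegions (mergePhaseTrace (2 * 2 ^ (w + m)) (2 ^ (w + 1)) m a) ≤ m * 6 := by
    refine (numRegions_flatMap_le _ _ _ fun k hk => ?_).trans_eq (by rw [List.length_range])
    exact (numRegions_append_le _ _).trans (add_le_add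
      (splitTrace_streamed (by positivity) _).numRegions_le
      (mergeTrace_streamed _ _ _).numRegions_le)
  have h3 := numRegions_bitonicTrace (2 ^ (w + m)) (w + 1)
  have h4 := (labelTrace_streamed n).numRegions_le
  have h5 := (combineTrace_streamed (2 ^ (w + m))).numRegions_le
  have h6 := (extractTrace_streamed (2 * 2 ^ (w + m)) n).numRegions_le
  have h7 := (copyBackTrace_streamed n).numRegions_le
  have := (numRegions_append_le _ _).trans (add_le_add h4 <|
    (numRegions_append_le _ _).trans <| add_le_add h5 <|
    (numRegions_append_le _ _).trans <| add_le_add h1 <|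
    (numRegions_append_le _ _).trans <| add_le_add h3 <|
    (numRegions_append_le _ _).trans <| add_le_add h2 <|
    (numRegions_append_le _ _).trans <| add_le_add h6 h7)
  refine this.trans ?_
  nlinarith [Nat.zero_le (m * w), Nat.zero_le (m * w ^ 2), Nat.zero_le (w ^ 2)]

end Sorter


/-! ### Ranks of the input records, and the execution in terms of the tape. -/

section Ranks

variable {b n : ℕ}

/-- The permutation that sorts `x`, ties being broken by index. -/
noncomputable def sortPerm (x : Fin n → Fin (2 ^ b)) : Equiv.Perm (Fin n) := Tuple.sort x

theorem sortPerm_lt (x : Fin n → Fin (2 ^ b)) {i j : Fin n} (h : i < j) :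
    x (sortPerm x i) < x (sortPerm x j) ∨
      x (sortPerm x i) = x (sortPerm x j) ∧ sortPerm x i < sortPerm x j := by
  obtain ⟨h1, h2⟩ := Tuple.eq_sort_iff.1 (rfl : sortPerm x = Tuple.sort x)
  rcases (h1 h.le).lt_or_eq with h' | h'
  · exact Or.inl h'
  · exact Or.inr ⟨h', h2 i j h h'⟩

theorem sorted_eq (x : Fin n → Fin (2 ^ b)) :
    sorted x = List.ofFn fun i => (x (sortPerm x i) : ℕ) := by
  refine List.Perm.eq_of_pairwise (le := fun i j : ℕ => i ≤ j) (fun _ _ _ _ => le_antisymm) ?_ ?_ ?_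
  · exact List.pairwise_insertionSort _ _
  · rw [List.pairwise_ofFn]
    intro i j h
    rcases sortPerm_lt x h with h' | h'
    · exact h'.le
    · rw [h'.1]
  · refine (List.perm_insertionSort _ _).trans ?_
    exact (Equiv.Perm.ofFn_comp_perm (sortPerm x) fun i => (x i : ℕ)).symm

/-- The record of rank `r`: the `r`-th smallest value, its tag, and its label. -/
noncomputable def rankRec (x y : Fin n → Fin (2 ^ b)) (r : ℕ) : Rec :=
  if r = 0 then (0, 0, 0) else
    if h : r - 1 < n then ((x (sortPerm x ⟨r - 1, h⟩) : ℕ), (sortPerm x ⟨r - 1, h⟩ : ℕ) + 1,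
      (y (sortPerm x ⟨r - 1, h⟩) : ℕ))
    else (2 ^ b + r, r, 0)

/-- Real records have positive tags and so exceed the dummy even when their value is `0`. Numbers
above `n` decode to values beyond all `b`-bit words, which makes the decoding strictly monotone on
all of `ℕ`. -/
theorem rankRec_lt (x y : Fin n → Fin (2 ^ b)) {r s : ℕ} (h : r < s) :
    recLt (rankRec x y r) (rankRec x y s) := by
  have hs : s ≠ 0 := by omega
  simp only [rankRec, hs, if_false]
  by_cases hr : r = 0
  · simp only [hr, if_true]
    split_ifs with h2
    · simp only [recLt]; omega
    · left
      show 0 < 2 ^ b + s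
      positivity
  · simp only [hr, if_false]
    by_cases h1 : r - 1 < n
    · by_cases h2 : s - 1 < n
      · simp only [h1, h2, dif_pos, recLt]
        have := sortPerm_lt x (i := ⟨r - 1, h1⟩) (j := ⟨s - 1, h2⟩) (by
          rw [Fin.mk_lt_mk]; omega)
        simp only [Fin.lt_def, Fin.ext_iff] at this
        omega
      · simp only [h1, h2, dif_pos, recLt]
        have := (x (sortPerm x ⟨r - 1, h1⟩)).isLt
        left
        show (x (sortPerm x ⟨r - 1, h1⟩) : ℕ) < 2 ^ b + s
        omega
    · have h2 : ¬ s - 1 < n := by omega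
      simp only [h1, h2, dif_neg, not_false_eq_true, recLt]
      omega

theorem recLt_rankRec (x y : Fin n → Fin (2 ^ b)) (r s : ℕ) :
    recLt (rankRec x y r) (rankRec x y s) ↔ r < s := by
  refine ⟨fun h => ?_, rankRec_lt x y⟩
  by_contra hrs
  rcases Nat.eq_or_lt_of_not_lt hrs with rfl | h'
  · simp only [recLt] at h; omega
  · have := rankRec_lt x y h'
    simp only [recLt] at h this
    omega

theorem rankRec_tag (x y : Fin n → Fin (2 ^ b)) (r : ℕ) : (rankRec x y r).2.1 = 0 ↔ r = 0 := by
  by_cases hr : r = 0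
  · simp [rankRec, hr]
  · simp only [rankRec, hr, if_false, iff_false]
    split_ifs
    · simp
    · exact hr

/-- The buckets chosen by the labels `z`, as a function of the rank. -/
def labelOf (m : ℕ) (z : Fin n → Fin (2 ^ b)) (r : ℕ) : ℕ :=
  if r = 0 then 0 else if h : r - 1 < n then z ⟨r - 1, h⟩ % 2 ^ m else 0

theorem labelOf_eq (m : ℕ) (x y : Fin n → Fin (2 ^ b)) (r : ℕ) :
    labelOf m (y ∘ sortPerm x) r = (rankRec x y r).2.2 % 2 ^ m := by
  rw [labelOf, rankRec]
  split_ifs <;> simp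

theorem labelOf_lt (m : ℕ) (z : Fin n → Fin (2 ^ b)) (r : ℕ) : labelOf m z r < 2 ^ m := by
  rw [labelOf]
  split_ifs
  · positivity
  · exact Nat.mod_lt _ (by positivity)
  · positivity

/-- The initial array of ranks: every second place is empty. -/
noncomputable def initArr (x : Fin n → Fin (2 ^ b)) (p : ℕ) : ℕ :=
  if h : p % 2 = 0 ∧ p / 2 < n then ((sortPerm x).symm ⟨p / 2, h.2⟩ : ℕ) + 1 else 0

theorem initArr_eq_iff (x : Fin n → Fin (2 ^ b)) {p r : ℕ} (hr : r ≠ 0) :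
    initArr x p = r ↔ ∃ h : r - 1 < n, p = 2 * (sortPerm x ⟨r - 1, h⟩ : ℕ) := by
  constructor
  · intro h
    rw [initArr] at h
    split_ifs at h with hp
    · have h1 : (sortPerm x).symm ⟨p / 2, hp.2⟩ = (r - 1 : ℕ) := by omega
      have h2 : r - 1 < n := h1 ▸ ((sortPerm x).symm ⟨p / 2, hp.2⟩).isLt
      refine ⟨h2, ?_⟩
      have h3 : (sortPerm x).symm ⟨p / 2, hp.2⟩ = ⟨r - 1, h2⟩ := Fin.ext h1
      rw [← h3, Equiv.apply_symm_apply]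
      show p = 2 * (p / 2)
      omega
    · exact absurd h.symm hr
  · rintro ⟨h, rfl⟩
    have h1 : 2 * (sortPerm x ⟨r - 1, h⟩ : ℕ) / 2 = sortPerm x ⟨r - 1, h⟩ := by omega
    rw [initArr, dif_pos ⟨by omega, by rw [h1]; exact Fin.isLt _⟩]
    simp only [h1, Fin.eta, Equiv.symm_apply_apply]
    omega

theorem isArr_initArr (x : Fin n → Fin (2 ^ b)) {N : ℕ} (hN : 2 * n ≤ N) :
    IsArr N n (initArr x) where
  inj p q h hp := by
    obtain ⟨h1, h2⟩ := (initArr_eq_iff x hp).1 rfl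
    obtain ⟨h3, h4⟩ := (initArr_eq_iff x (p := q) hp).1 h.symm
    rw [h2, h4]
  le p := by
    rw [initArr]
    split_ifs with h
    · exact Fin.isLt _
    · omega
  zero p hp := by rw [initArr, dif_neg (by omega)]
  surj r hr hrn := by
    refine ⟨2 * (sortPerm x ⟨r - 1, by omega⟩ : ℕ), ?_, (initArr_eq_iff x hr).2 ⟨_, rfl⟩⟩
    have := (sortPerm x ⟨r - 1, by omega⟩).isLt
    omega

/-- Number of labels that are sent through place `c` of level `k` of the routing network. -/
def load (w m k c : ℕ) (y : Fin n → Fin (2 ^ b)) : ℕ :=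
  (Finset.univ.filter fun i : Fin n => 2 * (i : ℕ) / 2 ^ (w + 1) % 2 ^ (m - k) = c / 2 ^ k ∧
    (y i : ℕ) % 2 ^ m / 2 ^ (m - k) = c % 2 ^ k).card

/-- No place of the routing network overflows. -/
def NoOverflow (w m : ℕ) (y : Fin n → Fin (2 ^ b)) : Prop :=
  ∀ k < m, ∀ c < 2 ^ m, load w m (k + 1) c y ≤ 2 ^ (w + 1)

/-- The bucket in which rank `r` starts. -/
noncomputable def initBucket (w : ℕ) (x : Fin n → Fin (2 ^ b)) (r : ℕ) : ℕ :=
  if h : r - 1 < n then 2 * (sortPerm x ⟨r - 1, h⟩ : ℕ) / 2 ^ (w + 1) else 0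

/-- Passing from ranks to original indices removes `x`: record `i` starts at position `2 * i` with
label `y i`. So the overflow event is the same for all inputs. -/
theorem card_loadSet_le (w m k c : ℕ) (x y : Fin n → Fin (2 ^ b)) :
    (loadSet n m (initBucket w x) (labelOf m (y ∘ sortPerm x)) k c).card ≤ load w m k c y := by
  refine le_trans (Finset.card_le_card (t := (Finset.univ.filter fun i : Fin n =>
    2 * (i : ℕ) / 2 ^ (w + 1) % 2 ^ (m - k) = c / 2 ^ k ∧
      (y i : ℕ) % 2 ^ m / 2 ^ (m - k) = c % 2 ^ k).image
        fun i => ((sortPerm x).symm i : ℕ) + 1) fun r hr => ?_) Finset.card_image_le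
  simp only [loadSet, Finset.mem_filter, Finset.mem_Icc] at hr
  obtain ⟨⟨h1, h2⟩, h3, h4⟩ := hr
  have h5 : r - 1 < n := by omega
  simp only [Finset.mem_image, Finset.mem_filter, Finset.mem_univ, true_and]
  refine ⟨sortPerm x ⟨r - 1, h5⟩, ⟨?_, ?_⟩, ?_⟩
  · rwa [initBucket, dif_pos h5] at h3
  · rwa [labelOf, if_neg (by omega), dif_pos h5] at h4
  · rw [Equiv.symm_apply_apply]
    show r - 1 + 1 = r
    omega

theorem blocksSorted_bitonicSort (w : ℕ) (a : ℕ → ℕ) :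
    BlocksSorted (2 ^ (w + 1)) (bitonicSort id (2 ^ w) (w + 1) a) :=
  fun c u u' h h' => bitonicSort_sorted id w a c u u' h h'

/-- Overflow matters only for the last clause. There the trace depends on the input only through the
permutation applied to the labels. -/
theorem exec_bucketSort {Z w m : ℕ} (x : Fin n → Fin (2 ^ b)) (ω : ℕ → Fin (2 ^ b))
    (hw : ∀ k < w, 2 ^ k * 2 < 2 * Z) (hZ : 2 * Z ≤ 2 ^ w * 2) (hZn : Z ≤ n)
    (hm : ∀ k < m, 2 ^ k * (2 ^ w * 2) < 2 * n) (hn : 2 * n ≤ 2 ^ m * (2 ^ w * 2))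
    (hb : 12 * 2 ^ (w + m) + 6 < 2 ^ b) :
    ∃ s : State 3, Exec b ω bucketSort (init n Z x) s ∧
      s.time ≤ 10000 * (2 ^ (w + m) + 1) * (m + 1) * (w + 3) ^ 2 ∧
      numRegions s.trace ≤ 30 * (m + 1) * (w + 3) ^ 2 ∧ s.output n = sorted x ∧
      (NoOverflow w m (fun i : Fin n => ω i) → s.trace = bucketSortTrace n w m
        (bucketed (2 ^ (w + 1)) n (labelOf m ((fun i : Fin n => ω i) ∘ sortPerm x)))) := by
  set y : Fin n → Fin (2 ^ b) := fun i => ω i with hy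
  have hN : 2 * 2 ^ (w + m) = 2 ^ (w + 1 + m) := by ring
  have hnN : 2 * n ≤ 2 ^ (w + 1 + m) := by
    calc 2 * n ≤ _ := hn
      _ = _ := by ring
  have harr := isArr_initArr x hnN
  obtain ⟨s, h1, h2, h3, h4⟩ := runs_bucketSort (ω := ω) (x := x) (dec := rankRec x y)
    (lab := labelOf m (y ∘ sortPerm x)) (a := initArr x) hw hZ hZn hm hn hb
    (labelOf_eq m x y) (rankRec_tag x y) rfl (recLt_rankRec x y) (fun q => by
      split_ifs with hq
      · have hr : initArr x (2 * q) = ((sortPerm x).symm ⟨q, hq⟩ : ℕ) + 1 :=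
          (initArr_eq_iff x (by omega)).2 ⟨by simp, by simp⟩
        rw [hr]
        simp [rankRec, hy]
      · rw [initArr, dif_neg (by omega)]
        rfl)
    (fun q => by rw [initArr, dif_neg (by omega)])
  have hrearr := (routeArr_rearr (w + 1) m (labelOf m (y ∘ sortPerm x)) (initArr x) m le_rfl).trans
    ((bitonicSort_rearr id (2 ^ w) (w + 1) (routeArr (w + 1) m (labelOf m (y ∘ sortPerm x))
      (initArr x) m)).mono (pow_dvd_pow 2 (by omega)))
  refine ⟨s, h1, h2, h3 ▸ numRegions_bucketSortTrace n w m _, ?_, fun hG => ?_⟩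
  · rw [sorted_eq, State.output]
    congr 1
    funext i
    have hi := i.isLt
    rw [h4 i hi, mergeAll_eq (n := n) (by omega) (blocksSorted_bitonicSort w _)
      (harr.rearr (by positivity) hrearr) (by omega),
      show 2 * 2 ^ (w + m) - n + i + 1 + n - 2 ^ (w + 1 + m) = i + 1 by omega]
    simp [rankRec]
  · rw [h3]
    congr 1
    refine (isBucketed_sort_route (ini := initBucket w x) ?_ harr ?_ (labelOf_lt m _)).eq_bucketed
      (by positivity)
    · exact fun k hk c hc => (card_loadSet_le w m (k + 1) c x y).trans (hG k hk c hc)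
    · intro p hp
      obtain ⟨h5, h6⟩ := (initArr_eq_iff x hp).1 rfl
      rw [initBucket, dif_pos h5, ← h6]
      refine ⟨rfl, Nat.div_lt_of_lt_mul ?_⟩
      rw [← pow_add]
      have := (sortPerm x ⟨initArr x p - 1, h5⟩).isLt
      omega

end Ranks


/-! ### The probability of an overflow. -/

section Overflow

variable {b n : ℕ}

/-- Fixing `k` bits of a word leaves the `b - m` bits above and the `m - k` bits below free. -/
theorem card_label_le {m k u : ℕ} (hk : k ≤ m) (hm : m ≤ b) :
    (Finset.univ.filter fun v : Fin (2 ^ b) => (v : ℕ) % 2 ^ m / 2 ^ (m - k) = u).card * 2 ^ k ≤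
      2 ^ b := by
  have h : (Finset.univ.filter fun v : Fin (2 ^ b) => (v : ℕ) % 2 ^ m / 2 ^ (m - k) = u).card ≤
      (Finset.range (2 ^ (b - m)) ×ˢ Finset.range (2 ^ (m - k))).card := by
    refine Finset.card_le_card_of_injOn (fun v => ((v : ℕ) / 2 ^ m, (v : ℕ) % 2 ^ (m - k)))
      (fun v _ => ?_) fun v hv v' hv' h => ?_
    · simp only [Finset.coe_product, Set.mem_prod, Finset.coe_range, Set.mem_Iio]
      refine ⟨Nat.div_lt_of_lt_mul ?_, Nat.mod_lt _ (by positivity)⟩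
      rw [← pow_add, show m + (b - m) = b by omega]
      exact v.isLt
    · simp only [Finset.coe_filter, Finset.mem_univ, true_and, Set.mem_ofPred_eq] at hv hv'
      simp only [Prod.mk.injEq] at h
      have hd : 2 ^ (m - k) ∣ 2 ^ m := pow_dvd_pow 2 (by omega)
      have e1 := Nat.div_add_mod ((v : ℕ) % 2 ^ m) (2 ^ (m - k))
      have e2 := Nat.div_add_mod ((v' : ℕ) % 2 ^ m) (2 ^ (m - k))
      rw [Nat.mod_mod_of_dvd _ hd, hv] at e1
      rw [Nat.mod_mod_of_dvd _ hd, hv', ← h.2, e1] at e2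
      refine Fin.ext ?_
      rw [← Nat.div_add_mod (v : ℕ) (2 ^ m), ← Nat.div_add_mod (v' : ℕ) (2 ^ m), h.1, e2]
  calc _ ≤ _ := Nat.mul_le_mul_right _ h
    _ = 2 ^ b := by
      rw [Finset.card_product, Finset.card_range, Finset.card_range, ← pow_add, ← pow_add]
      congr 1
      omega

/-- There are at most `2 ^ k` initial buckets with the given residue, and each holds at most `2 ^ w`
real records because only even positions are filled. -/
theorem card_start_le {w m k u : ℕ} (hk : k ≤ m) (hn : n ≤ 2 ^ (w + m)) :
    (Finset.univ.filter fun i : Fin n => 2 * (i : ℕ) / 2 ^ (w + 1) % 2 ^ (m - k) = u).card ≤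
      2 ^ k * 2 ^ w := by
  have h : (Finset.univ.filter fun i : Fin n =>
      2 * (i : ℕ) / 2 ^ (w + 1) % 2 ^ (m - k) = u).card ≤
      (Finset.range (2 ^ k) ×ˢ Finset.range (2 ^ w)).card := by
    have hdiv : ∀ i : ℕ, 2 * i / 2 ^ (w + 1) = i / 2 ^ w := fun i => by
      rw [pow_succ', Nat.mul_div_mul_left _ _ two_pos]
    simp only [hdiv]
    refine Finset.card_le_card_of_injOn
      (fun i => ((i : ℕ) / 2 ^ w / 2 ^ (m - k), (i : ℕ) % 2 ^ w)) (fun i _ => ?_)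
      fun i hi i' hi' h => ?_
    · simp only [Finset.coe_product, Set.mem_prod, Finset.coe_range, Set.mem_Iio]
      refine ⟨?_, Nat.mod_lt _ (by positivity)⟩
      rw [Nat.div_div_eq_div_mul]
      refine Nat.div_lt_of_lt_mul ?_
      rw [← pow_add, ← pow_add, show w + (m - k) + k = w + m by omega]
      exact i.isLt.trans_le hn
    · simp only [Finset.coe_filter, Finset.mem_univ, true_and, Set.mem_ofPred_eq] at hi hi'
      simp only [Prod.mk.injEq] at h
      have e1 := Nat.div_add_mod ((i : ℕ) / 2 ^ w) (2 ^ (m - k))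
      have e2 := Nat.div_add_mod ((i' : ℕ) / 2 ^ w) (2 ^ (m - k))
      rw [hi] at e1
      rw [hi', ← h.1, e1] at e2
      refine Fin.ext ?_
      rw [← Nat.div_add_mod (i : ℕ) (2 ^ w), ← Nat.div_add_mod (i' : ℕ) (2 ^ w), e2, h.2]
  simpa using h

/-- The exponential moment factors over the independent labels. Each of the at most `2 ^ k * 2 ^ w`
candidates contributes at most `1 + 2 ^ (-k) ≤ exp (2 ^ (-k))`, apart from the normalisation `2 ^
b`. -/
theorem sum_two_pow_load_le {w m k c : ℕ} (hk : k ≤ m) (hm : m ≤ b) (hn : n ≤ 2 ^ (w + m)) :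
    ∑ y : Fin n → Fin (2 ^ b), (2 : ℝ) ^ load w m k c y ≤
      ((2 : ℝ) ^ b) ^ n * Real.exp (2 ^ w) := by
  set I := Finset.univ.filter fun i : Fin n =>
    2 * (i : ℕ) / 2 ^ (w + 1) % 2 ^ (m - k) = c / 2 ^ k with hI
  set L := Finset.univ.filter fun v : Fin (2 ^ b) =>
    (v : ℕ) % 2 ^ m / 2 ^ (m - k) = c % 2 ^ k with hL
  have hload : ∀ y : Fin n → Fin (2 ^ b), (2 : ℝ) ^ load w m k c y =
      ∏ i, if i ∈ I ∧ y i ∈ L then (2 : ℝ) else 1 := by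
    intro y
    rw [Finset.prod_ite, Finset.prod_const, Finset.prod_const_one, mul_one, load]
    simp [hI, hL]
  have hsum : ∀ i : Fin n, ∑ v : Fin (2 ^ b), (if i ∈ I ∧ v ∈ L then (2 : ℝ) else 1) ≤
      2 ^ b * if i ∈ I then Real.exp ((2 ^ k)⁻¹) else 1 := by
    intro i
    by_cases hi : i ∈ I
    · simp only [hi, true_and, if_true]
      have h1 : ∀ v, (if v ∈ L then (2 : ℝ) else 1) = 1 + if v ∈ L then 1 else 0 := by
        intro v; split_ifs <;> norm_num
      simp only [h1, Finset.sum_add_distrib, Finset.sum_ite_mem, Finset.univ_inter,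
        Finset.sum_const, Finset.card_univ, Fintype.card_fin, nsmul_eq_mul, mul_one]
      have h2 : (L.card : ℝ) * 2 ^ k ≤ 2 ^ b := by
        exact_mod_cast card_label_le (u := c % 2 ^ k) hk hm
      have h3 : (L.card : ℝ) ≤ 2 ^ b * (2 ^ k)⁻¹ := by
        rw [← div_eq_mul_inv, le_div_iff₀ (by positivity)]
        exact h2
      have h4 := Real.add_one_le_exp (((2 : ℝ) ^ k)⁻¹)
      have h5 : (2 : ℝ) ^ b * ((2 ^ k)⁻¹ + 1) ≤ 2 ^ b * Real.exp ((2 ^ k)⁻¹) :=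
        mul_le_mul_of_nonneg_left h4 (by positivity)
      push_cast
      linarith
    · simp [hi]
  calc ∑ y : Fin n → Fin (2 ^ b), (2 : ℝ) ^ load w m k c y
      = ∏ i : Fin n, ∑ v : Fin (2 ^ b), (if i ∈ I ∧ v ∈ L then (2 : ℝ) else 1) := by
        rw [Fintype.prod_sum]
        exact Finset.sum_congr rfl fun y _ => hload y
    _ ≤ ∏ i : Fin n, (2 ^ b * if i ∈ I then Real.exp ((2 ^ k)⁻¹) else 1) :=
        Finset.prod_le_prod (fun i _ => Finset.sum_nonneg fun v _ => by split_ifs <;> norm_num)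
          fun i _ => hsum i
    _ = ((2 : ℝ) ^ b) ^ n * Real.exp ((2 ^ k)⁻¹) ^ I.card := by
        rw [Finset.prod_mul_distrib, Finset.prod_const, Finset.prod_ite_mem, Finset.univ_inter,
          Finset.prod_const, Finset.card_univ, Fintype.card_fin]
    _ ≤ _ := by
        refine mul_le_mul_of_nonneg_left ?_ (by positivity)
        rw [← Real.exp_nat_mul, Real.exp_le_exp, ← div_eq_mul_inv, div_le_iff₀ (by positivity)]
        have := card_start_le (n := n) (u := c / 2 ^ k) hk hn
        rw [mul_comm]
        exact_mod_cast this

theorem card_overflow_le {w m k c Z : ℕ} (hk : k ≤ m) (hm : m ≤ b) (hn : n ≤ 2 ^ (w + m))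
    (hZ : Z ≤ 2 ^ w) :
    ((Finset.univ.filter fun y : Fin n → Fin (2 ^ b) => 2 ^ (w + 1) < load w m k c y).card : ℝ) ≤
      ((2 : ℝ) ^ b) ^ n * Real.exp (-(Z : ℝ) / 6) := by
  set S := Finset.univ.filter fun y : Fin n → Fin (2 ^ b) => 2 ^ (w + 1) < load w m k c y
  have h1 : (S.card : ℝ) * 2 ^ (2 ^ (w + 1)) ≤ ((2 : ℝ) ^ b) ^ n * Real.exp (2 ^ w) := by
    refine le_trans ?_ (sum_two_pow_load_le (c := c) hk hm hn)
    rw [← nsmul_eq_mul, ← Finset.sum_const]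
    refine le_trans (Finset.sum_le_sum (g := fun y => (2 : ℝ) ^ load w m k c y) fun y hy => ?_)
      (Finset.sum_le_sum_of_subset_of_nonneg (Finset.filter_subset _ _) fun _ _ _ => by positivity)
    exact pow_le_pow_right₀ one_le_two (Finset.mem_filter.1 hy).2.le
  have h2 : Real.exp (2 ^ w) ≤ Real.exp (-(Z : ℝ) / 6) * 2 ^ (2 ^ (w + 1)) := by
    have h3 : ((2 : ℝ) ^ (2 ^ (w + 1)) : ℝ) = Real.exp (Real.log 2 * (2 * 2 ^ w)) := by
      rw [← Real.rpow_def_of_pos two_pos, ← Real.rpow_natCast]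
      congr 1
      push_cast
      ring
    rw [h3, ← Real.exp_add, Real.exp_le_exp]
    -- What is needed is `2 * log 2 - 1 ≥ 1 / 6`, together with `Z ≤ 2 ^ w`.
    have h4 := Real.log_two_gt_d9
    have h5 : (Z : ℝ) ≤ 2 ^ w := by exact_mod_cast hZ
    have h6 : (0 : ℝ) < 2 ^ w := by positivity
    nlinarith
  have h3 : (S.card : ℝ) * 2 ^ (2 ^ (w + 1)) ≤
      (((2 : ℝ) ^ b) ^ n * Real.exp (-(Z : ℝ) / 6)) * 2 ^ (2 ^ (w + 1)) :=
    h1.trans (by rw [mul_assoc]; exact mul_le_mul_of_nonneg_left h2 (by positivity))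
  exact le_of_mul_le_mul_right h3 (by positivity)

open Classical in
theorem card_not_noOverflow_le {w m Z : ℕ} (hm : m ≤ b) (hn : n ≤ 2 ^ (w + m)) (hZ : Z ≤ 2 ^ w) :
    ((Finset.univ.filter fun y : Fin n → Fin (2 ^ b) => ¬ NoOverflow w m y).card : ℝ) ≤
      ((2 : ℝ) ^ b) ^ n * (2 ^ m * m * Real.exp (-(Z : ℝ) / 6)) := by
  have hsub : (Finset.univ.filter fun y : Fin n → Fin (2 ^ b) => ¬ NoOverflow w m y) ⊆
      (Finset.range m ×ˢ Finset.range (2 ^ m)).biUnion fun kc =>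
        Finset.univ.filter fun y => 2 ^ (w + 1) < load w m (kc.1 + 1) kc.2 y := by
    intro y hy
    simp only [NoOverflow, Finset.mem_filter, Finset.mem_univ, true_and, not_forall,
      not_le] at hy
    obtain ⟨k, hk, c, hc, h⟩ := hy
    simp only [Finset.mem_biUnion, Finset.mem_product, Finset.mem_range, Finset.mem_filter,
      Finset.mem_univ, true_and]
    exact ⟨(k, c), ⟨hk, hc⟩, h⟩
  calc _ ≤ (((Finset.range m ×ˢ Finset.range (2 ^ m)).biUnion fun kc =>
        Finset.univ.filter fun y : Fin n → Fin (2 ^ b) =>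
          2 ^ (w + 1) < load w m (kc.1 + 1) kc.2 y).card : ℝ) := by
        exact_mod_cast Finset.card_le_card hsub
    _ ≤ ∑ kc ∈ Finset.range m ×ˢ Finset.range (2 ^ m), ((Finset.univ.filter fun
        y : Fin n → Fin (2 ^ b) => 2 ^ (w + 1) < load w m (kc.1 + 1) kc.2 y).card : ℝ) := by
        exact_mod_cast Finset.card_biUnion_le
    _ ≤ ∑ kc ∈ Finset.range m ×ˢ Finset.range (2 ^ m),
        ((2 : ℝ) ^ b) ^ n * Real.exp (-(Z : ℝ) / 6) :=
        Finset.sum_le_sum fun kc hkc => by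
          simp only [Finset.mem_product, Finset.mem_range] at hkc
          exact card_overflow_le (by omega) hm hn hZ
    _ = _ := by
        rw [Finset.sum_const, Finset.card_product, Finset.card_range, Finset.card_range,
          nsmul_eq_mul]
        push_cast
        ring

end Overflow

/-! ### Finite prefixes of the random tape are uniform. -/

section Tape

variable {b n : ℕ}

instance : IsProbabilityMeasure (tape b) := by unfold tape; infer_instance

theorem tape_prefix_eq (y : Fin n → Fin (2 ^ b)) :
    tape b {ω | (fun i : Fin n => ω i) = y} = ((2 ^ b) ^ n : ENNReal)⁻¹ := by
  have hset : {ω : ℕ → Fin (2 ^ b) | (fun i : Fin n => ω i) = y} =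
      Set.pi (Finset.range n) fun i => if h : i < n then {y ⟨i, h⟩} else Set.univ := by
    ext ω
    simp only [Set.mem_ofPred_eq, Set.mem_pi, Finset.coe_range, Set.mem_Iio, funext_iff]
    constructor
    · intro h i hi
      rw [dif_pos hi]
      exact h ⟨i, hi⟩
    · intro h i
      have := h i i.isLt
      rwa [dif_pos i.isLt] at this
  rw [hset, tape, Measure.infinitePi_pi _ fun i _ => by
    split_ifs <;> exact MeasurableSet.of_discrete]
  rw [Finset.prod_congr rfl (g := fun _ => ((2 ^ b : ENNReal))⁻¹), Finset.prod_const,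
    Finset.card_range]
  · simp [ENNReal.inv_pow]
  intro i hi
  rw [Finset.mem_range] at hi
  rw [dif_pos hi, PMF.toMeasure_apply_singleton _ _ (MeasurableSet.singleton _),
    PMF.uniformOfFintype_apply, Fintype.card_fin]
  push_cast
  rfl

open Classical in
theorem tape_prefix_mem (S : Finset (Fin n → Fin (2 ^ b))) :
    (tape b).real {ω | (fun i : Fin n => ω i) ∈ S} = S.card / ((2 : ℝ) ^ b) ^ n := by
  have hmeas : ∀ y : Fin n → Fin (2 ^ b),
      MeasurableSet {ω : ℕ → Fin (2 ^ b) | (fun i : Fin n => ω i) = y} := fun y =>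
    measurableSet_eq_fun (measurable_pi_lambda _ fun i => measurable_pi_apply _) measurable_const
  have hset : {ω : ℕ → Fin (2 ^ b) | (fun i : Fin n => ω i) ∈ S} =
      ⋃ y ∈ S, {ω | (fun i : Fin n => ω i) = y} := by
    ext ω
    simp
  rw [Measure.real, hset, measure_biUnion_finset (fun y _ y' _ h =>
    Set.disjoint_left.2 fun ω h1 h2 => h (h1.symm.trans h2)) fun y _ => hmeas y]
  simp only [tape_prefix_eq, Finset.sum_const, nsmul_eq_mul, ENNReal.toReal_mul,
    ENNReal.toReal_inv, ENNReal.toReal_pow, ENNReal.toReal_natCast, ENNReal.toReal_ofNat]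
  rw [div_eq_mul_inv]

end Tape

/-! ### The simulator and its statistical distance from the machine. -/

section Obliviousness

variable {b n : ℕ}

/-- The distribution of the access pattern of `bucketSort` for independent uniform labels. -/
noncomputable def simulator (n w m b : ℕ) : PMF (List (Access 3)) :=
  (PMF.uniformOfFintype (Fin n → Fin (2 ^ b))).map fun z =>
    bucketSortTrace n w m (bucketed (2 ^ (w + 1)) n (labelOf m z))

open Classical in
theorem simulator_apply (w m : ℕ) (l : List ℕ) (A : Set (Option (List (Access 3) × List ℕ))) :
    (((simulator n w m b).map fun t => some (t, l)).toOuterMeasure A).toReal =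
      (Finset.univ.filter fun z : Fin n → Fin (2 ^ b) => some (bucketSortTrace n w m
        (bucketed (2 ^ (w + 1)) n (labelOf m z)), l) ∈ A).card / ((2 : ℝ) ^ b) ^ n := by
  rw [simulator, PMF.map_comp, PMF.toOuterMeasure_map_apply,
    PMF.toOuterMeasure_uniformOfFintype_apply, ENNReal.toReal_div, ENNReal.toReal_natCast,
    ENNReal.toReal_natCast, Fintype.card_fun, Fintype.card_fin, Fintype.card_fin,
    Fintype.card_subtype]
  push_cast
  rfl

-- Without overflow the outcome is `T` at the labels permuted by `sortPerm x`, while the simulator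
-- evaluates `T` at uniform labels. A permutation preserves uniformity, so the two probabilities
-- differ by at most that of an overflow. This also covers label vectors for which `bucketed` takes
-- its default value in the simulation.
open Classical in
theorem obliviouslySorts_bucketSort {Z w m : ℕ}
    (hw : ∀ k < w, 2 ^ k * 2 < 2 * Z) (hZ : 2 * Z ≤ 2 ^ w * 2) (hZn : Z ≤ n)
    (hm : ∀ k < m, 2 ^ k * (2 ^ w * 2) < 2 * n) (hn : 2 * n ≤ 2 ^ m * (2 ^ w * 2))
    (hb : 12 * 2 ^ (w + m) + 6 < 2 ^ b) :
    ObliviouslySorts bucketSort n Z b (2 ^ m * m * Real.exp (-(Z : ℝ) / 6)) := by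
  refine ⟨simulator n w m b, fun x A => ?_⟩
  set T : (Fin n → Fin (2 ^ b)) → Option (List (Access 3) × List ℕ) := fun z =>
    some (bucketSortTrace n w m (bucketed (2 ^ (w + 1)) n (labelOf m z)), sorted x) with hT
  set S := Finset.univ.filter fun z => T z ∈ A with hS
  set S' := Finset.univ.filter fun y => T (y ∘ sortPerm x) ∈ A with hS'
  set B := Finset.univ.filter fun y : Fin n → Fin (2 ^ b) => ¬ NoOverflow w m y with hB
  have hcard : S.card = S'.card := by
    -- Uniformity of labels is invariant under reindexing from input positions to ranks.
    refine (Finset.card_bij' (fun y _ => y ∘ sortPerm x) (fun z _ => z ∘ (sortPerm x).symm)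
      ?_ ?_ ?_ ?_).symm
    · intro y hy
      simpa [hS, hS'] using hy
    · intro z hz
      simpa [hS, hS', Function.comp_assoc] using hz
    · intro y _
      simp [Function.comp_assoc]
    · intro z _
      simp [Function.comp_assoc]
  have hrun : ∀ ω : ℕ → Fin (2 ^ b), NoOverflow w m (fun i : Fin n => ω i) →
      outcome bucketSort Z x ω = T ((fun i : Fin n => ω i) ∘ sortPerm x) := by
    intro ω hG
    obtain ⟨s, h1, -, -, h2, h3⟩ := exec_bucketSort x ω hw hZ hZn hm hn hb
    rw [outcome_of_exec h1, h2, h3 hG]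
  have hnM : n ≤ 2 ^ (w + m) := by
    have : 2 ^ m * (2 ^ w * 2) = 2 * 2 ^ (w + m) := by ring
    omega
  have hmb : m ≤ b := by
    refine (Nat.pow_le_pow_iff_right (show 1 < 2 by omega)).1 ?_
    have : 2 ^ m ≤ 2 ^ (w + m) := Nat.pow_le_pow_right two_pos (by omega)
    omega
  have hbad : (tape b).real {ω | (fun i : Fin n => ω i) ∈ B} ≤
      2 ^ m * m * Real.exp (-(Z : ℝ) / 6) := by
    rw [tape_prefix_mem, div_le_iff₀ (by positivity), mul_comm]
    exact card_not_noOverflow_le hmb hnM (by omega)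
  rw [simulator_apply]
  change |(S.card : ℝ) / _ - _| ≤ _
  rw [hcard, ← tape_prefix_mem]
  refine (abs_le.2 ⟨?_, ?_⟩).trans hbad
  -- Both bounds use only monotonicity and subadditivity, so measurability of the outcome event is
  -- not needed.
  · have : {ω : ℕ → Fin (2 ^ b) | outcome bucketSort Z x ω ∈ A} ⊆
        {ω | (fun i : Fin n => ω i) ∈ S'} ∪ {ω | (fun i : Fin n => ω i) ∈ B} := by
      intro ω hω
      by_cases hG : NoOverflow w m (fun i : Fin n => ω i)
      · left
        simp only [hS', Set.mem_ofPred_eq, Finset.mem_filter, Finset.mem_univ, true_and]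
        rw [← hrun ω hG]
        exact hω
      · right
        simpa [hB] using hG
    have := (measureReal_mono (μ := tape b) this).trans (measureReal_union_le _ _)
    linarith
  · have : {ω : ℕ → Fin (2 ^ b) | (fun i : Fin n => ω i) ∈ S'} ⊆
        {ω | outcome bucketSort Z x ω ∈ A} ∪ {ω | (fun i : Fin n => ω i) ∈ B} := by
      intro ω hω
      by_cases hG : NoOverflow w m (fun i : Fin n => ω i)
      · left
        simp only [hS', Set.mem_ofPred_eq, Finset.mem_filter, Finset.mem_univ, true_and] at hω
        rw [← hrun ω hG] at hω
        exact hω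
      · right
        simpa [hB] using hG
    have := (measureReal_mono (μ := tape b) this).trans (measureReal_union_le _ _)
    linarith

end Obliviousness


/-! ### Choice of the bucket size and number of levels. -/

section Parameters

theorem le_logb_two {k : ℕ} {x : ℝ} (h : (2 : ℝ) ^ k ≤ x) : (k : ℝ) ≤ Real.logb 2 x := by
  rw [Real.le_logb_iff_rpow_le one_lt_two ((by positivity : (0 : ℝ) < 2 ^ k).trans_le h),
    Real.rpow_natCast]
  exact h

theorem clog_two_le_two_mul_logb {n : ℕ} (hn : 2 ≤ n) :
    1 ≤ Real.logb 2 n ∧ (Nat.clog 2 n : ℝ) ≤ Real.logb 2 n + 1 := by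
  refine ⟨?_, ?_⟩
  · have := le_logb_two (k := 1) (x := n) (by simpa using (by exact_mod_cast hn : (2 : ℝ) ≤ n))
    simpa using this
  · have h1 := Nat.pow_pred_clog_lt_self (b := 2) one_lt_two (show 1 < n by omega)
    have h2 : 0 < Nat.clog 2 n := Nat.clog_pos one_lt_two (by omega)
    have h3 := le_logb_two (k := (Nat.clog 2 n).pred) (x := n) (by exact_mod_cast h1.le)
    have h4 : ((Nat.clog 2 n).pred : ℝ) = Nat.clog 2 n - 1 := by
      rw [Nat.pred_eq_sub_one, Nat.cast_sub h2, Nat.cast_one]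
    linarith

/-- Take `w = clog Z` and `w + m = clog n`. Since both logarithms are at least `1`, additive
constants are absorbed into factors. Minimality of `clog n` gives `2 ^ m * Z ≤ 2 ^ (w + m) < 2 * n`,
which bounds both `2 ^ m` and `m` in the error term. -/
theorem exists_bucket_params {n Z : ℕ} (hZ : 2 ≤ Z) (hZn : Z ≤ n) :
    ∃ w m : ℕ, ((∀ k < w, 2 ^ k * 2 < 2 * Z) ∧ 2 * Z ≤ 2 ^ w * 2 ∧
      (∀ k < m, 2 ^ k * (2 ^ w * 2) < 2 * n) ∧ 2 * n ≤ 2 ^ m * (2 ^ w * 2)) ∧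
      2 ^ (w + m) < 2 * n ∧ (w : ℝ) + 3 ≤ 5 * Real.logb 2 Z ∧ (m : ℝ) + 1 ≤ 2 * Real.logb 2 n ∧
      2 ^ m * m * Real.exp (-(Z : ℝ) / 6) ≤ errorProb n Z := by
  set w := Nat.clog 2 Z with hw
  have hwm : w ≤ Nat.clog 2 n := Nat.clog_mono_right 2 hZn
  obtain ⟨m, hm⟩ := Nat.exists_eq_add_of_le hwm
  have hw1 : 0 < w := Nat.clog_pos one_lt_two (by omega)
  have hZw : Z ≤ 2 ^ w := Nat.le_pow_clog one_lt_two Z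
  have hnw : n ≤ 2 ^ (w + m) := hm ▸ Nat.le_pow_clog one_lt_two n
  have hlt : 2 ^ (w + m) < 2 * n := by
    have h1 := Nat.pow_pred_clog_lt_self (b := 2) one_lt_two (show 1 < n by omega)
    rw [hm] at h1
    rw [show w + m = (w + m).pred + 1 by simp only [Nat.pred_eq_sub_one]; omega, pow_succ']
    omega
  have e : 2 ^ m * (2 ^ w * 2) = 2 * 2 ^ (w + m) := by ring
  obtain ⟨l1, l2⟩ := clog_two_le_two_mul_logb hZ
  obtain ⟨l3, l4⟩ := clog_two_le_two_mul_logb (hZ.trans hZn)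
  rw [← hw] at l2
  rw [hm] at l4
  push_cast at l4
  have hw1' : (1 : ℝ) ≤ w := by exact_mod_cast hw1
  refine ⟨w, m, ⟨fun k hk => ?_, by omega, fun k hk => ?_, by omega⟩, hlt, by linarith,
    by linarith, ?_⟩
  · have := (Nat.lt_clog_iff_pow_lt one_lt_two).1 (hw ▸ hk)
    omega
  · have := (Nat.lt_clog_iff_pow_lt one_lt_two).1 (show w + k < Nat.clog 2 n by omega)
    rw [pow_add] at this
    linarith [mul_comm (2 ^ k) (2 ^ w * 2)]
  · have hZ0 : (0 : ℝ) < Z := by exact_mod_cast (show 0 < Z by omega)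
    have h1 : (2 : ℝ) ^ m ≤ 2 * n / Z := by
      rw [le_div_iff₀ hZ0]
      have h2 : 2 ^ m * Z ≤ 2 * n := by
        calc 2 ^ m * Z ≤ 2 ^ m * 2 ^ w := Nat.mul_le_mul_left _ hZw
          _ = 2 ^ (w + m) := by ring
          _ ≤ 2 * n := hlt.le
      exact_mod_cast h2
    rw [errorProb]
    exact mul_le_mul_of_nonneg_right (mul_le_mul h1 (le_logb_two h1) (by positivity)
      (by positivity)) (by positivity)

end Parameters

end DiskRAM

theorem corollary1 :
    ∃ (P : DiskRAM.Prog 3) (C : ℕ), ∀ n Z b : ℕ, 2 ≤ Z → Z ≤ n → C * n ≤ 2 ^ b →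
      DiskRAM.ObliviouslySorts P n Z b (DiskRAM.errorProb n Z) ∧
      ∀ x : Fin n → Fin (2 ^ b),
        (DiskRAM.tape b)
          {ω | ¬ DiskRAM.CompletesWithin P Z x
            (C * (n * Real.logb 2 n * Real.logb 2 Z ^ 2))
            (C * (Real.logb 2 n * Real.logb 2 Z ^ 2)) ω}
          ≤ ENNReal.ofReal (DiskRAM.errorProb n Z) := by
  -- The constant is `10000 * 2 * 50`: the time bound, `2 ^ (w + m) + 1 ≤ 2 * n`, and the
  -- logarithmic factors `2 * 25`. It amply covers the word length and the number of regions.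
  refine ⟨DiskRAM.bucketSort, 1000000, fun n Z b hZ hZn hb => ?_⟩
  obtain ⟨w, m, ⟨h1, h2, h3, h4⟩, hlt, hw, hm, herr⟩ := DiskRAM.exists_bucket_params hZ hZn
  have hb' : 12 * 2 ^ (w + m) + 6 < 2 ^ b := by omega
  refine ⟨?_, fun x => ?_⟩
  · obtain ⟨Sim, hSim⟩ := DiskRAM.obliviouslySorts_bucketSort h1 h2 hZn h3 h4 hb'
    exact ⟨Sim, fun x A => (hSim x A).trans herr⟩
  -- The exceptional set is empty, as the sorter meets its bounds on every tape.
  · rw [show {ω | ¬ DiskRAM.CompletesWithin DiskRAM.bucketSort Z x _ _ ω} = ∅ from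
      Set.eq_empty_of_forall_notMem fun ω hω => hω ?_, MeasureTheory.measure_empty]
    · exact zero_le
    obtain ⟨s, hs, ht, hr, ho, -⟩ := DiskRAM.exec_bucketSort x ω h1 h2 hZn h3 h4 hb'
    have hwsq : ((w : ℝ) + 3) ^ 2 ≤ 25 * Real.logb 2 Z ^ 2 := by
      calc ((w : ℝ) + 3) ^ 2 ≤ (5 * Real.logb 2 Z) ^ 2 := pow_le_pow_left₀ (by positivity) hw 2
        _ = _ := by ring
    have hprod : ((m : ℝ) + 1) * ((w : ℝ) + 3) ^ 2 ≤
        50 * (Real.logb 2 n * Real.logb 2 Z ^ 2) := by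
      calc _ ≤ (2 * Real.logb 2 n) * (25 * Real.logb 2 Z ^ 2) :=
            mul_le_mul hm hwsq (by positivity) ((by positivity : (0 : ℝ) ≤ m + 1).trans hm)
        _ = _ := by ring
    refine ⟨s, hs, ho, ?_, ?_⟩
    · calc (s.time : ℝ) ≤ ((10000 * (2 ^ (w + m) + 1) * (m + 1) * (w + 3) ^ 2 : ℕ) : ℝ) := by
            exact_mod_cast ht
        _ = 10000 * ((2 ^ (w + m) + 1 : ℕ) * (((m : ℝ) + 1) * ((w : ℝ) + 3) ^ 2)) := by
            push_cast; ring
        _ ≤ 10000 * ((2 * n : ℕ) * (50 * (Real.logb 2 n * Real.logb 2 Z ^ 2))) := by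
            gcongr
            exact hlt
        _ = _ := by push_cast; ring
    · calc (DiskRAM.numRegions s.trace : ℝ) ≤ ((30 * (m + 1) * (w + 3) ^ 2 : ℕ) : ℝ) := by
            exact_mod_cast hr
        _ = 30 * (((m : ℝ) + 1) * ((w : ℝ) + 3) ^ 2) := by push_cast; ring
        _ ≤ 30 * (50 * (Real.logb 2 n * Real.logb 2 Z ^ 2)) := by gcongr
        _ ≤ _ := by
            have : 0 ≤ Real.logb 2 n * Real.logb 2 Z ^ 2 := by
              have : (0 : ℝ) ≤ ((m : ℝ) + 1) * ((w : ℝ) + 3) ^ 2 := by positivity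
              linarith
            push_cast
            linarith
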